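/- \textbf{Theorem.} Let $V_{\mathbb R}=\mathbb R^2\otimes\mathrm{Sym}^2\mathbb R^3$ be the space of pairs $(A,B)$ of real symmetric $3\times 3$ matrices, with Lebesgue measure in the twelve coordinates $a_{ij},b_{ij}$ ($i\le j$). Let $f_{(A,B)}(x,y)=\det(Ax-By)$ and $\mathrm{Disc}(A,B)=\mathrm{Disc}(f_{(A,B)})$. Let $\mathcal S_2=\mathrm{GL}_2(\mathbb Z)\backslash \mathrm{GL}_2(\mathbb R)/\mathrm{GO}_2(\mathbb R)$; the shape of a rank-two lattice is the class of a matrix whose rows are the coordinates of a basis of the lattice in an orthonormal basis of its span. Let $\mu$ be the measure on $\mathcal S_2$ given by the hyperbolic measure $dx\,dy/y^2$ on the fundamental domain $\{x+iy: 0\le x<\tfrac12,\ y>0,\ x^2+y^2\ge 1\}$, where $x+iy$ corresponds to the class of $\begin{pmatrix} y&x\\0&1\end{pmatrix}$. For $x\in V_{\mathbb R}$ with $\mathrm{Disc}(x)\ne 0$ let $R=\mathbb R\oplus\mathbb R\omega\oplus\mathbb R\theta$ be the cubic ring of $f_x=ax^3+bx^2y+cxy^2+dy^3$, given by $\omega\theta=-ad$,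 $\omega^2=-ac+b\omega-a\theta$, $\theta^2=-bd+d\omega-c\theta$, and let $\mathrm{sh}(x)\in\mathcal S_2$ be the shape of the lattice spanned by $\omega^\perp,\theta^\perp$, where $\alpha^\perp=3\alpha-\mathrm{tr}(\alpha)$ and $\langle\alpha,\beta\rangle=\sum_{\sigma:R\to\mathbb C}\sigma(\alpha)\overline{\sigma(\beta)}$ ($\sigma$ running over the $\mathbb R$-algebra homomorphisms). Let $G'_{\mathbb R}=\mathbb G_m(\mathbb R)\times\mathrm{GL}_3^{\pm1}(\mathbb R)\times\mathrm{GL}_2^{\pm1}(\mathbb R)$, where $\mathrm{GL}_n^{\pm1}$ is the group of matrices of determinant $\pm1$, and $G'_{\mathbb Z}=\{\pm1\}\times\mathrm{GL}_3(\mathbb Z)\times\mathrm{GL}_2(\mathbb Z)$. The group $G'_{\mathbb R}$ acts on $V_{\mathbb R}$ by \[ \Bigl(\lambda,g,\begin{pmatrix} r&s\\t&u\end{pmatrix}\Bigr)\cdot(A,B)=\bigl(\lambda\, g(rA-sB)g^t,\ \lambda\, g(-tA+uB)g^t\bigr). \] Let $\mathcal F\subset G'_{\mathbb R}$ be a fundamental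 domain for left multiplication by $G'_{\mathbb Z}$ (measurable up to a null set for Haar measure, with translates that are pairwise disjoint up to null sets and cover almost everything). Let $v\in V_{\mathbb R}$ satisfy $|\mathrm{Disc}(v)|=1$ and $\mathrm{sh}(v)=\begin{pmatrix}1&0\\0&1\end{pmatrix}\in\mathcal S_2$, and let $W\subseteq\mathcal S_2$ be measurable. Put \[ \mathcal R_1=\{x\in\mathcal Fv:\ |\mathrm{Disc}(x)|<1\},\qquad \mathcal R_{1,W}=\{x\in\mathcal Fv:\ |\mathrm{Disc}(x)|<1,\ \mathrm{sh}(x)\in W\}, \] where $\mathcal Fv$ is a multiset in which $x$ has multiplicity $\#\{g\in\mathcal F: gv=x\}$, and volumes are computed with multiplicity. Then $0<\mathrm{Vol}(\mathcal R_1)<\infty$, $0<\mu(\mathcal S_2)<\infty$, and \[ \frac{\mathrm{Vol}(\mathcal R_{1,W})}{\mathrm{Vol}(\mathcal R_1)}=\frac{\mu(W)}{\mu(\mathcal S_2)} . \] -/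

import Mathlib

open MeasureTheory
open scoped ENNReal UpperHalfPlane Matrix

noncomputable section

/-! ### The space of shapes of rank-two lattices -/

/-- `GL_n(ℤ)` as a subgroup of `GL_n(ℝ)`. -/
def GLInt (n : ℕ) : Subgroup (GL (Fin n) ℝ) :=
  (Matrix.GeneralLinearGroup.map (Int.castRingHom ℝ)).range

/-- `GL_n^{±1}(ℝ)`: real matrices of determinant `1` or `-1`. -/
def GLpm (n : ℕ) : Subgroup (GL (Fin n) ℝ) where
  carrier := {g | (g : Matrix (Fin n) (Fin n) ℝ).det = 1 ∨ (g : Matrix (Fin n) (Fin n) ℝ).det = -1}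
  one_mem' := by simp
  mul_mem' := by
    rintro a b (ha | ha) (hb | hb) <;> simp [ha, hb]
  inv_mem' := by
    rintro a (ha | ha) <;> simp [Matrix.det_nonsing_inv, ha, Ring.inverse_eq_inv']

/-- `GO_2(ℝ)`: transformations `v ↦ v M` (row vectors) that preserve the standard inner product
up to a positive scalar. -/
def GO2 : Subgroup (GL (Fin 2) ℝ) where
  carrier := {M | ∃ c : ℝ, 0 < c ∧
    (M : Matrix (Fin 2) (Fin 2) ℝ) * (M : Matrix (Fin 2) (Fin 2) ℝ)ᵀ = c • 1}
  one_mem' := ⟨1, one_pos, by simp⟩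
  mul_mem' := by
    rintro a b ⟨c, hc, ha⟩ ⟨d, hd, hb⟩
    refine ⟨c * d, mul_pos hc hd, ?_⟩
    rw [Units.val_mul, Matrix.transpose_mul, Matrix.mul_assoc,
      ← Matrix.mul_assoc (b : Matrix (Fin 2) (Fin 2) ℝ), hb]
    simp [ha, smul_smul, mul_comm]
  inv_mem' := by
    rintro a ⟨c, hc, ha⟩
    refine ⟨c⁻¹, inv_pos.2 hc, ?_⟩
    have h1 : (a : Matrix (Fin 2) (Fin 2) ℝ) * (c⁻¹ • (a : Matrix (Fin 2) (Fin 2) ℝ)ᵀ) = 1 := by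
      rw [Matrix.mul_smul, ha, smul_smul, inv_mul_cancel₀ hc.ne', one_smul]
    have h2 : ((a⁻¹ : GL (Fin 2) ℝ) : Matrix (Fin 2) (Fin 2) ℝ)
        = c⁻¹ • (a : Matrix (Fin 2) (Fin 2) ℝ)ᵀ := by
      rw [Matrix.coe_units_inv]
      exact Matrix.inv_eq_right_inv h1
    have h3 := mul_eq_one_comm.1 h1
    rw [h2, Matrix.transpose_smul, Matrix.transpose_transpose, Matrix.mul_smul, h3]

/-- The space of shapes `𝒮₂ = GL₂(ℤ) \ GL₂(ℝ) / GO₂(ℝ)`. -/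
def S2 : Type := DoubleCoset.Quotient (GLInt 2 : Set (GL (Fin 2) ℝ)) (GO2 : Set (GL (Fin 2) ℝ))

/-- The shape of the lattice whose basis is formed by the rows of `M`. -/
def S2.mk (M : GL (Fin 2) ℝ) : S2 := DoubleCoset.mk (GLInt 2) GO2 M

/-- The quotient topology. -/
instance : TopologicalSpace S2 := TopologicalSpace.coinduced S2.mk inferInstance

instance : MeasurableSpace S2 := borel S2

/-- The matrix with rows `(y, x)` and `(0, 1)`. Its Gram matrix is a positive multiple of the
matrix `(a, b; b, c)` with `x = b / c`, `y = √(a / c - x ^ 2)`. -/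
def matrixOfPoint (z : ℍ) : GL (Fin 2) ℝ :=
  Matrix.GeneralLinearGroup.mkOfDetNeZero !![z.im, z.re; 0, 1] (by simpa using z.im_pos.ne')

/-- The fundamental domain `{x + i y : 0 ≤ x < 1/2, x² + y² ≥ 1}` of `GL₂(ℤ)` on `ℍ`. -/
def shapeDomain : Set ℍ := {z | 0 ≤ z.re ∧ z.re < 1 / 2 ∧ 1 ≤ z.re ^ 2 + z.im ^ 2}

/-- The measure `μ` on `𝒮₂`: the hyperbolic measure `dx dy / y²` on the fundamental domain,
transported to `𝒮₂`. -/
def shapeMeasure : Measure S2 :=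
  ((volume : Measure ℍ).restrict shapeDomain).map fun z => S2.mk (matrixOfPoint z)

/-! ### Cubic rings -/

/-- The cubic ring `R(f) = T ⊕ Tω ⊕ Tθ` attached to the binary cubic form
`f = a x³ + b x² y + c x y² + d y³`, with
`ωθ = -ad`, `ω² = -ac + bω - aθ`, `θ² = -bd + dω - cθ`. -/
@[ext]
structure CubicRing {T : Type*} (f : Cubic T) where
  c0 : T
  c1 : T
  c2 : T

namespace CubicRing

variable {T : Type*} [CommRing T] {f : Cubic T}

instance : Zero (CubicRing f) := ⟨⟨0, 0, 0⟩⟩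
instance : One (CubicRing f) := ⟨⟨1, 0, 0⟩⟩
instance : Add (CubicRing f) := ⟨fun u w => ⟨u.c0 + w.c0, u.c1 + w.c1, u.c2 + w.c2⟩⟩
instance : Neg (CubicRing f) := ⟨fun u => ⟨-u.c0, -u.c1, -u.c2⟩⟩
instance : Mul (CubicRing f) := ⟨fun u w =>
  ⟨u.c0 * w.c0 + (-(f.a * f.c)) * (u.c1 * w.c1) + (-(f.a * f.d)) * (u.c1 * w.c2 + u.c2 * w.c1)
      + (-(f.b * f.d)) * (u.c2 * w.c2),
    u.c0 * w.c1 + u.c1 * w.c0 + f.b * (u.c1 * w.c1) + f.d * (u.c2 * w.c2),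
    u.c0 * w.c2 + u.c2 * w.c0 - f.a * (u.c1 * w.c1) - f.c * (u.c2 * w.c2)⟩⟩
instance : SMul T (CubicRing f) := ⟨fun t u => ⟨t * u.c0, t * u.c1, t * u.c2⟩⟩

@[simp] lemma c0_zero : (0 : CubicRing f).c0 = 0 := rfl
@[simp] lemma c1_zero : (0 : CubicRing f).c1 = 0 := rfl
@[simp] lemma c2_zero : (0 : CubicRing f).c2 = 0 := rfl
@[simp] lemma c0_one : (1 : CubicRing f).c0 = 1 := rfl
@[simp] lemma c1_one : (1 : CubicRing f).c1 = 0 := rfl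
@[simp] lemma c2_one : (1 : CubicRing f).c2 = 0 := rfl
@[simp] lemma c0_add (u w : CubicRing f) : (u + w).c0 = u.c0 + w.c0 := rfl
@[simp] lemma c1_add (u w : CubicRing f) : (u + w).c1 = u.c1 + w.c1 := rfl
@[simp] lemma c2_add (u w : CubicRing f) : (u + w).c2 = u.c2 + w.c2 := rfl
@[simp] lemma c0_neg (u : CubicRing f) : (-u).c0 = -u.c0 := rfl
@[simp] lemma c1_neg (u : CubicRing f) : (-u).c1 = -u.c1 := rfl
@[simp] lemma c2_neg (u : CubicRing f) : (-u).c2 = -u.c2 := rfl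
@[simp] lemma c0_smul (t : T) (u : CubicRing f) : (t • u).c0 = t * u.c0 := rfl
@[simp] lemma c1_smul (t : T) (u : CubicRing f) : (t • u).c1 = t * u.c1 := rfl
@[simp] lemma c2_smul (t : T) (u : CubicRing f) : (t • u).c2 = t * u.c2 := rfl
@[simp] lemma c0_mul (u w : CubicRing f) : (u * w).c0 =
    u.c0 * w.c0 + (-(f.a * f.c)) * (u.c1 * w.c1) + (-(f.a * f.d)) * (u.c1 * w.c2 + u.c2 * w.c1)
      + (-(f.b * f.d)) * (u.c2 * w.c2) := rfl
@[simp] lemma c1_mul (u w : CubicRing f) : (u * w).c1 =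
    u.c0 * w.c1 + u.c1 * w.c0 + f.b * (u.c1 * w.c1) + f.d * (u.c2 * w.c2) := rfl
@[simp] lemma c2_mul (u w : CubicRing f) : (u * w).c2 =
    u.c0 * w.c2 + u.c2 * w.c0 - f.a * (u.c1 * w.c1) - f.c * (u.c2 * w.c2) := rfl

instance : CommRing (CubicRing f) where
  add_assoc u v w := by ext <;> simp <;> ring
  zero_add u := by ext <;> simp
  add_zero u := by ext <;> simp
  nsmul := nsmulRec
  zsmul := zsmulRec
  add_comm u w := by ext <;> simp <;> ring
  left_distrib u v w := by ext <;> simp <;> ring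
  right_distrib u v w := by ext <;> simp <;> ring
  zero_mul u := by ext <;> simp
  mul_zero u := by ext <;> simp
  mul_assoc u v w := by ext <;> simp <;> ring
  one_mul u := by ext <;> simp
  mul_one u := by ext <;> simp
  mul_comm u w := by ext <;> simp <;> ring
  neg_add_cancel u := by ext <;> simp

instance : Algebra T (CubicRing f) where
  algebraMap :=
    { toFun := fun t => ⟨t, 0, 0⟩
      map_one' := rfl
      map_mul' := fun s t => by ext <;> simp
      map_zero' := rfl
      map_add' := fun s t => by ext <;> simp }
  commutes' t u := mul_comm _ _
  smul_def' t u := by ext <;> simp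

/-- The normal basis elements `ω` and `θ`. -/
def gen (f : Cubic T) : Fin 2 → CubicRing f := ![⟨0, 1, 0⟩, ⟨0, 0, 1⟩]

/-- `α^⊥ = 3 α - tr(α)`. -/
def perp (u : CubicRing f) : CubicRing f :=
  (3 : T) • u - algebraMap T (CubicRing f) (Algebra.trace T (CubicRing f) u)

/-- The inner product induced by the Minkowski embedding `α ↦ (σ(α))_σ` into `ℂ³` with its standard
Hermitian inner product, `σ` ranging over all homomorphisms to `ℂ`. When all `σ` are real this is
the trace form. -/
def minkowskiInner {f : Cubic ℝ} (u w : CubicRing f) : ℝ :=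
  (∑ᶠ σ : CubicRing f →ₐ[ℝ] ℂ, σ u * (starRingEnd ℂ) (σ w)).re

/-- The Gram matrix of the basis `ω^⊥, θ^⊥` of the projected lattice. -/
def gram (f : Cubic ℝ) : Matrix (Fin 2) (Fin 2) ℝ :=
  Matrix.of fun i j => minkowskiInner (perp (gen f i)) (perp (gen f j))

end CubicRing

/-- The shape of a rank-two lattice with Gram matrix `G`: the class of any matrix `M` whose rows
have Gram matrix `G`. (A junk value if there is no invertible such `M`, that is, if `G` is not
positive definite.) -/
def shapeOfGram (G : Matrix (Fin 2) (Fin 2) ℝ) : S2 := by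
  classical
  exact if h : ∃ M : GL (Fin 2) ℝ,
      (M : Matrix (Fin 2) (Fin 2) ℝ) * (M : Matrix (Fin 2) (Fin 2) ℝ)ᵀ = G
    then S2.mk h.choose else S2.mk 1

/-- The class does not depend on the choice of `M`. -/
theorem shapeOfGram_mul_transpose (M : GL (Fin 2) ℝ) :
    shapeOfGram ((M : Matrix (Fin 2) (Fin 2) ℝ) * (M : Matrix (Fin 2) (Fin 2) ℝ)ᵀ) = S2.mk M := by
  classical
  have h : ∃ N : GL (Fin 2) ℝ, (N : Matrix (Fin 2) (Fin 2) ℝ) * (N : Matrix (Fin 2) (Fin 2) ℝ)ᵀ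
      = (M : Matrix (Fin 2) (Fin 2) ℝ) * (M : Matrix (Fin 2) (Fin 2) ℝ)ᵀ := ⟨M, rfl⟩
  rw [shapeOfGram, dif_pos h]
  refine (DoubleCoset.eq (GLInt 2) GO2 _ _).2
    ⟨1, one_mem _, h.choose⁻¹ * M, ⟨1, one_pos, ?_⟩, by simp⟩
  have hN := h.choose_spec
  set N := h.choose
  have h1 : ((N⁻¹ : GL (Fin 2) ℝ) : Matrix (Fin 2) (Fin 2) ℝ)
      * (N : Matrix (Fin 2) (Fin 2) ℝ) = 1 := by
    rw [← Units.val_mul, inv_mul_cancel, Units.val_one]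
  rw [Units.val_mul, Matrix.transpose_mul, Matrix.mul_assoc,
    ← Matrix.mul_assoc (M : Matrix (Fin 2) (Fin 2) ℝ), ← hN, Matrix.mul_assoc,
    ← Matrix.transpose_mul, h1, Matrix.transpose_one, mul_one, one_smul, h1]

/-! ### Pairs of ternary quadratic forms -/

/-- `V_ℝ = ℝ² ⊗ Sym² ℝ³`: pairs `(A, B)` of real symmetric `3 × 3` matrices, given by their
coordinates `a_{ij} = v 0 s(i, j)`, `b_{ij} = v 1 s(i, j)`. The measure on `V_ℝ` is Lebesgue
measure in these twelve coordinates. -/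
abbrev VR : Type := Fin 2 → Sym2 (Fin 3) → ℝ

/-- The symmetric matrix with given coordinates. -/
def symMat (a : Sym2 (Fin 3) → ℝ) : Matrix (Fin 3) (Fin 3) ℝ := Matrix.of fun i j => a s(i, j)

/-- The coordinates of a symmetric matrix. -/
def symCoord (M : Matrix (Fin 3) (Fin 3) ℝ) (hM : M.IsSymm) : Sym2 (Fin 3) → ℝ :=
  Sym2.lift ⟨fun i j => M i j, fun i j => (hM.apply i j).symm⟩

lemma symMat_isSymm (a : Sym2 (Fin 3) → ℝ) : (symMat a).IsSymm := by
  ext i j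
  simp [symMat, Sym2.eq_swap]

/-- `γ · (A, B) = (r A - s B, -t A + u B)` for `γ = (r, s; t, u)`. -/
def actGL2 (γ : GL (Fin 2) ℝ) (v : VR) : VR :=
  ![γ 0 0 • v 0 - γ 0 1 • v 1, -(γ 1 0 • v 0) + γ 1 1 • v 1]

/-- `g · (A, B) = (g A gᵗ, g B gᵗ)`. -/
def actGL3 (g : GL (Fin 3) ℝ) (v : VR) : VR := fun k =>
  symCoord ((g : Matrix (Fin 3) (Fin 3) ℝ) * symMat (v k) * (g : Matrix (Fin 3) (Fin 3) ℝ)ᵀ) (by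
    unfold Matrix.IsSymm
    rw [Matrix.transpose_mul, Matrix.transpose_mul, Matrix.transpose_transpose,
      (symMat_isSymm _).eq, Matrix.mul_assoc])

/-- The binary cubic form `det(A x - B y)`, as the list of its coefficients. -/
def binaryCubic (v : VR) : Cubic ℝ where
  a := (symMat (v 0)).det
  b := -((symMat (v 0)).adjugate * symMat (v 1)).trace
  c := (symMat (v 0) * (symMat (v 1)).adjugate).trace
  d := -(symMat (v 1)).det

theorem binaryCubic_spec (v : VR) (x y : ℝ) :
    (x • symMat (v 0) - y • symMat (v 1)).det =
      (binaryCubic v).a * x ^ 3 + (binaryCubic v).b * x ^ 2 * y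
        + (binaryCubic v).c * x * y ^ 2 + (binaryCubic v).d * y ^ 3 := by
  simp [binaryCubic, Matrix.det_fin_three, Matrix.trace_fin_three, Matrix.adjugate_fin_three,
    Matrix.vecMul, dotProduct, Matrix.mul_apply, Fin.sum_univ_three]
  ring

/-- `Disc(A, B)`, the discriminant of `det(A x - B y)`. -/
def disc (v : VR) : ℝ := (binaryCubic v).discr

/-- The shape of the cubic ring of `det(A x - B y)`; meaningful when `Disc(A, B) ≠ 0`. -/
def shape (v : VR) : S2 := shapeOfGram (CubicRing.gram (binaryCubic v))

/-! ### The group acting and the regions -/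

/-- `G'_ℝ = 𝔾_m(ℝ) × GL₃^{±1}(ℝ) × GL₂^{±1}(ℝ)`. -/
def GR : Type := ℝˣ × GLpm 3 × GLpm 2

instance : Group GR := inferInstanceAs (Group (ℝˣ × GLpm 3 × GLpm 2))

instance : TopologicalSpace GR := inferInstanceAs (TopologicalSpace (ℝˣ × GLpm 3 × GLpm 2))

instance : MeasurableSpace GR := borel GR

/-- `G'_ℤ = 𝔾_m(ℤ) × GL₃(ℤ) × GL₂(ℤ)`, as a subgroup of `G'_ℝ`. -/
def GZ : Subgroup GR :=
  Subgroup.prod (Units.map (Int.castRingHom ℝ : ℤ →* ℝ)).range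
    (Subgroup.prod ((GLInt 3).subgroupOf (GLpm 3)) ((GLInt 2).subgroupOf (GLpm 2)))

/-- The action of `(λ, g₃, g₂) ∈ G'_ℝ` on `V_ℝ`. -/
def act (g : GR) (v : VR) : VR := (g.1 : ℝ) • actGL3 g.2.1 (actGL2 g.2.2 v)

/-- The multiset `ℛ_{X,W} = {x ∈ 𝓕 v : |Disc x| < X, sh(x) ∈ W}`, as its multiplicity function: the
multiplicity of `x` is the number of `g ∈ 𝓕` with `g v = x`. -/
def regionW (F : Set GR) (v : VR) (X : ℝ) (W : Set S2) : VR → ℕ∞ := fun x =>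
  {g : GR | g ∈ F ∧ act g v = x ∧ |disc x| < X ∧ shape x ∈ W}.encard

/-- The multiset `ℛ_X = {x ∈ 𝓕 v : |Disc x| < X}`, as its multiplicity function. -/
def region (F : Set GR) (v : VR) (X : ℝ) : VR → ℕ∞ := fun x =>
  {g : GR | g ∈ F ∧ act g v = x ∧ |disc x| < X}.encard

/-- The Euclidean volume of a multiset in `V_ℝ`, points being counted with multiplicity. -/
def Vol (m : VR → ℕ∞) : ℝ≥0∞ := ∫⁻ x, (m x : ℝ≥0∞)

end

/-! Pull Lebesgue measure on V_ℝ back to the group. An element (λ, g₃, g₂) of G'_ℝ acts on the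
twelve-dimensional space V_ℝ with determinant ±λ¹² (`abs_det_actLin`) and multiplies Disc by λ¹²
(`disc_act`), so |Disc(x)|⁻¹ dx is invariant (`measurePreserving_act`). If Disc(v) ≠ 0, the Lie
algebra of the stabilizer of v is zero (`infinitesimal_stabilizer`), and G'_ℝ also has dimension
twelve, so by the inverse function theorem g ↦ gv is a local homeomorphism. The pull-back of
|Disc(x)|⁻¹ dx, with points counted with multiplicity, is therefore left invariant, locally finite
and nonzero, that is, a Haar measure (`exists_isHaarMeasure_orbit`). No Jacobian has to be computed.

Consequently Vol(ℛ_{1,W}) is the Haar integral of |λ|¹² over those g ∈ 𝓕 with |λ| < 1 and sh(gv) ∈ W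
(`Vol_regionW`). By `CubicRing.gram_twist` the Gram matrix of gv is a positive multiple of g₂ G g₂ᵗ,
where G is that of v. Since sh(v) is the class of 1, sh(gv) is the class of g₂k for one fixed k ∈
GL₂(ℤ). The integrand is then G'_ℤ-invariant, so 𝓕 may be replaced by the product of {λ > 0} with
fundamental domains for GL₃(ℤ) and GL₂(ℤ), and the integral splits into three factors
(`exists_setLIntegral_fundamentalDomain`):

the integral of λ¹² over 0 < λ < 1 for multiplicative Haar measure, which is positive and finite;

the covolume of GL₃(ℤ), which is finite by reduction theory: every lattice has a basis in a Siegel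
domain (`exists_isSiegel`), and the cone over that domain has finite volume
(`volume_isSiegel_lt_top`);

the Haar measure of the part of the domain for GL₂(ℤ) with shape in W, which is a constant times
μ(W), because g ↦ g • i pushes Haar measure forward to hyperbolic measure (`haarGLpm_two_apply`,
`haarGLpm_two_shape`).

Only the last factor depends on W, and the others cancel in the quotient.

Haar measure on GL_n^{±1}(ℝ) is realized as Lebesgue measure of cones. Its invariance, like the
determinants ±1 on V_ℝ, comes from the fact that positive characters of GL_n(ℝ) are trivial on
GL_n^{±1}(ℝ) (`map_eq_one_of_mem_GLpm`). -/

noncomputable section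

/-! ### Characters of the general linear group -/

section Characters

variable {n : ℕ}

/-- Invertible diagonal matrices. -/
def diagGL : (Fin n → ℝˣ) →* GL (Fin n) ℝ :=
  (Units.map (Matrix.diagonalRingHom (Fin n) ℝ : (Fin n → ℝ) →* _)).comp
    (MulEquiv.piUnits (M := fun _ : Fin n => ℝ)).symm.toMonoidHom

/-- The diagonal matrix with `u` at place `i` and `1` elsewhere. -/
def diagUnit (i : Fin n) : ℝˣ →* GL (Fin n) ℝ :=
  diagGL.comp (MonoidHom.mulSingle (fun _ => ℝˣ) i)

lemma coe_diagUnit (i : Fin n) (u : ℝˣ) :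
    (diagUnit i u : Matrix (Fin n) (Fin n) ℝ) =
      Matrix.diagonal fun j => ((Pi.mulSingle i u : Fin n → ℝˣ) j : ℝ) := rfl

/-- The invertible matrix of a permutation. -/
def permGL (σ : Equiv.Perm (Fin n)) : GL (Fin n) ℝ :=
  Matrix.GeneralLinearGroup.mkOfDetNeZero (σ.permMatrix ℝ) (by
    rw [Matrix.det_permutation]; exact_mod_cast (Equiv.Perm.sign σ).isUnit.ne_zero)

/-- A transposition conjugates one diagonal place into another, so a character with commutative
values takes the same value at u in every place. -/
lemma permGL_mul_diagUnit (i j : Fin n) (u : ℝˣ) :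
    permGL (Equiv.swap i j) * diagUnit i u = diagUnit j u * permGL (Equiv.swap i j) := by
  ext a b
  simp only [Units.val_mul, coe_diagUnit, Matrix.mul_diagonal, Matrix.diagonal_mul]
  have hp : (permGL (Equiv.swap i j) : Matrix (Fin n) (Fin n) ℝ) =
      (Equiv.swap i j).permMatrix ℝ := rfl
  simp only [hp, Equiv.Perm.permMatrix, PEquiv.toMatrix_apply, Equiv.toPEquiv_apply,
    Option.mem_some_iff, Pi.mulSingle_apply]
  by_cases h : Equiv.swap i j a = b
  · have : (b = i) ↔ (a = j) := by
      rw [← h, Equiv.swap_apply_eq_iff, Equiv.swap_apply_left]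
    simp [h, this]
  · simp [h]

/-- Conjugation by a diagonal 2 doubles the off-diagonal entry, which is also what squaring does. A
positive character therefore satisfies χ(g) = χ(g)², so χ(g) = 1 on transvections. -/
lemma transvection_conj (t : Matrix.TransvectionStruct (Fin n) ℝ) (g : GL (Fin n) ℝ)
    (hg : (g : Matrix (Fin n) (Fin n) ℝ) = t.toMatrix) :
    diagUnit t.i (Units.mk0 2 two_ne_zero) * g =
      g * g * diagUnit t.i (Units.mk0 2 two_ne_zero) := by
  ext a b
  have h2 : (g : Matrix (Fin n) (Fin n) ℝ) * g = Matrix.transvection t.i t.j (t.c + t.c) := by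
    rw [hg, Matrix.TransvectionStruct.toMatrix, Matrix.transvection_mul_transvection_same _ _ t.hij]
  rw [Units.val_mul, Units.val_mul, Units.val_mul, h2, hg, coe_diagUnit, Matrix.mul_diagonal,
    Matrix.diagonal_mul]
  have h3 := t.hij
  simp only [Matrix.TransvectionStruct.toMatrix, Matrix.transvection, Matrix.add_apply,
    Matrix.one_apply, Matrix.single_apply, Pi.mulSingle_apply, apply_ite Units.val, Units.val_mk0,
    Units.val_one]
  grind

/-- A positive character of `GL_n(ℝ)` is trivial on matrices of determinant `±1`. -/
theorem map_eq_one_of_mem_GLpm (χ : GL (Fin n) ℝ →* ℝ) (hχ : ∀ g, 0 < χ g)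
    {g : GL (Fin n) ℝ} (hg : g ∈ GLpm n) : χ g = 1 := by
  rcases Nat.eq_zero_or_pos n with rfl | hn
  · rw [Subsingleton.elim g 1, map_one]
  let i₀ : Fin n := ⟨0, hn⟩
  have hswap (i : Fin n) (u : ℝˣ) : χ (diagUnit i u) = χ (diagUnit i₀ u) := by
    have h := congrArg χ (permGL_mul_diagUnit i i₀ u)
    rw [map_mul, map_mul, mul_comm] at h
    exact mul_right_cancel₀ (hχ _).ne' h
  -- Diagonal matrices and transvections generate the group, so χ depends only on the determinant.
  have key : ∀ g : GL (Fin n) ℝ, χ g = χ (diagUnit i₀ g.det) := by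
    intro g
    refine Matrix.diagonal_transvection_induction_of_det_ne_zero
      (fun M => ∀ g : GL (Fin n) ℝ, (g : Matrix (Fin n) (Fin n) ℝ) = M →
        χ g = χ (diagUnit i₀ g.det)) g g.det_ne_zero ?_ ?_ ?_ g rfl
    · intro D hD g hg
      rw [Matrix.det_diagonal, Finset.prod_ne_zero_iff] at hD
      let d : Fin n → ℝˣ := fun i => Units.mk0 (D i) (hD i (Finset.mem_univ i))
      have hgd : g = diagGL d := Units.ext hg
      have hdet : g.det = ∏ i, d i := by
        apply Units.ext
        rw [Matrix.GeneralLinearGroup.val_det_apply, hg, Matrix.det_diagonal, Units.coe_prod]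
        rfl
      have hprod : χ (diagGL d) = ∏ i, χ (diagUnit i (d i)) := by
        conv_lhs => rw [← Finset.univ_prod_mulSingle d]
        exact map_prod (χ.comp diagGL) _ _
      rw [hgd, hprod, ← hgd, hdet]
      rw [Finset.prod_congr rfl fun i _ => hswap i (d i)]
      exact (map_prod (χ.comp (diagUnit i₀)) d _).symm
    · intro t g hg
      have h := congrArg χ (transvection_conj t g hg)
      rw [map_mul, map_mul, map_mul, mul_comm] at h
      have h1 := mul_right_cancel₀ (hχ _).ne' h
      have h2 : χ g = 1 := by
        have := (hχ g).ne'
        field_simp at h1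
        exact h1.symm
      have h3 : g.det = 1 := by
        apply Units.ext
        rw [Matrix.GeneralLinearGroup.val_det_apply, hg, Matrix.TransvectionStruct.det, Units.val_one]
      rw [h2, h3, map_one, map_one]
    · intro A B hA hB hPA hPB g hg
      have h : g = (Matrix.GeneralLinearGroup.mkOfDetNeZero A hA *
        Matrix.GeneralLinearGroup.mkOfDetNeZero B hB) :=
        Units.ext (by rw [hg]; rfl)
      rw [h, map_mul, hPA (Matrix.GeneralLinearGroup.mkOfDetNeZero A hA) rfl,
        hPB (Matrix.GeneralLinearGroup.mkOfDetNeZero B hB) rfl, map_mul, map_mul, map_mul]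
  -- A determinant ±1 squares to 1, so χ(g) is a positive number with square 1.
  have hsq : g.det ^ 2 = 1 := by
    apply Units.ext
    rw [Units.val_pow_eq_pow_val, Matrix.GeneralLinearGroup.val_det_apply, Units.val_one]
    rcases hg with h | h <;> rw [h] <;> norm_num
  have h := key g
  have h2 : χ g ^ 2 = 1 := by
    rw [h, ← map_pow, ← map_pow, hsq, map_one, map_one]
  exact (pow_eq_one_iff_of_nonneg (hχ g).le two_ne_zero).1 h2

/-- A representation of `GL_n(ℝ)` maps matrices of determinant `±1` to maps of determinant `±1`. -/
theorem abs_det_eq_one_of_mem_GLpm {E : Type*} [AddCommGroup E] [Module ℝ E]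
    (ρ : GL (Fin n) ℝ →* (E →ₗ[ℝ] E)) {g : GL (Fin n) ℝ} (hg : g ∈ GLpm n) :
    |LinearMap.det (ρ g)| = 1 := by
  let χ : GL (Fin n) ℝ →* ℝ :=
    { toFun := fun g => |LinearMap.det (ρ g)|
      map_one' := by simp
      map_mul' := fun a b => by simp [abs_mul] }
  refine map_eq_one_of_mem_GLpm χ (fun g => abs_pos.2 fun h => ?_) hg
  have h1 : LinearMap.det (ρ g) * LinearMap.det (ρ g⁻¹) = 1 := by
    rw [← map_mul, ← map_mul, mul_inv_cancel, map_one, map_one]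
  rw [h, zero_mul] at h1
  exact zero_ne_one h1

end Characters

/-! ### Fundamental domains of discrete subgroups -/

/-- Cover G by countably many right translates A i of a neighbourhood V of 1 with VV⁻¹ ⊆ U. If γg
and δg lie in the same A i, then δγ⁻¹ ∈ U, so δ = γ: each A i meets each orbit at most once. Keeping
from A i only the orbits that meet no earlier A j gives the domain. -/
theorem exists_measurable_fundamentalDomain {G : Type*} [Group G] [TopologicalSpace G]
    [IsTopologicalGroup G] [SecondCountableTopology G] [MeasurableSpace G] [BorelSpace G]
    (Γ : Subgroup G) [Countable Γ] {U : Set G} (hU : U ∈ nhds (1 : G))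
    (hΓ : ∀ γ ∈ Γ, γ ∈ U → γ = 1) :
    ∃ F : Set G, MeasurableSet F ∧ ∀ g : G, ∃! γ : Γ, γ • g ∈ F := by
  have hcont : Filter.Tendsto (fun p : G × G => p.1 * p.2⁻¹) (nhds (1, 1)) (nhds 1) := by
    have : Continuous fun p : G × G => p.1 * p.2⁻¹ := by fun_prop
    simpa using this.tendsto (1, 1)
  obtain ⟨V₁, V₂, hV₁, h1V₁, hV₂, h1V₂, hV⟩ := mem_nhds_prod_iff'.1 (hcont hU)
  let V := V₁ ∩ V₂
  have hVo : IsOpen V := hV₁.inter hV₂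
  have hVg (g : G) : (fun x => x * g⁻¹) ⁻¹' V ∈ nhds g := by
    refine (hVo.preimage (by fun_prop)).mem_nhds ?_
    simp only [Set.mem_preimage, mul_inv_cancel]
    exact ⟨h1V₁, h1V₂⟩
  obtain ⟨s, hs, hsU⟩ := TopologicalSpace.countable_cover_nhds hVg
  have hne : s.Nonempty := by
    by_contra h
    rw [Set.not_nonempty_iff_eq_empty] at h
    have : (1 : G) ∈ ⋃ x ∈ s, (fun y => y * x⁻¹) ⁻¹' V := by rw [hsU]; trivial
    simp [h] at this
  obtain ⟨a, rfl⟩ := hs.exists_eq_range hne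
  let A : ℕ → Set G := fun i => (fun x => x * (a i)⁻¹) ⁻¹' V
  have hAm (i : ℕ) : MeasurableSet (A i) := (hVo.preimage (by fun_prop)).measurableSet
  have hAcov (g : G) : ∃ i, g ∈ A i := by
    have : g ∈ ⋃ x ∈ Set.range a, (fun y => y * x⁻¹) ⁻¹' V := by rw [hsU]; trivial
    simpa [A] using this
  let B : ℕ → Set G := fun i => ⋃ γ : Γ, (fun x => (γ : G) * x) ⁻¹' A i
  have hB (i : ℕ) : MeasurableSet (B i) :=
    MeasurableSet.iUnion fun γ => (hVo.preimage (by fun_prop)).measurableSet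
  have hBinv (i : ℕ) (γ : Γ) (g : G) : γ • g ∈ B i ↔ g ∈ B i := by
    simp only [B, Set.mem_iUnion, Set.mem_preimage, Subgroup.smul_def, smul_eq_mul]
    constructor
    · rintro ⟨δ, h⟩
      exact ⟨δ * γ, by simpa [mul_assoc] using h⟩
    · rintro ⟨δ, h⟩
      exact ⟨δ * γ⁻¹, by simpa [mul_assoc] using h⟩
  have hAB (i : ℕ) (g : G) (h : g ∈ A i) : g ∈ B i :=
    Set.mem_iUnion.2 ⟨1, by simpa using h⟩
  refine ⟨⋃ i, A i \ ⋃ j < i, B j, MeasurableSet.iUnion fun i => (hAm i).diff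
    (MeasurableSet.iUnion fun j => MeasurableSet.iUnion fun _ => hB j), fun g => ?_⟩
  classical
  have hex : ∃ i, g ∈ B i := (hAcov g).imp fun i h => hAB i g h
  obtain ⟨γ, hγ⟩ := Set.mem_iUnion.1 (Nat.find_spec hex)
  have hmem (δ : Γ) (i : ℕ) (h : δ • g ∈ A i \ ⋃ j < i, B j) : i = Nat.find hex := by
    refine le_antisymm (not_lt.1 fun hlt => h.2 ?_)
      (Nat.find_min' hex ((hBinv i δ g).1 (hAB i _ h.1)))
    simp only [Set.mem_iUnion]
    exact ⟨_, hlt, (hBinv _ δ g).2 (Nat.find_spec hex)⟩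
  refine ⟨γ, Set.mem_iUnion.2 ⟨Nat.find hex, hγ, fun h => ?_⟩, fun δ hδ => ?_⟩
  · simp only [Set.mem_iUnion] at h
    obtain ⟨j, hj, h⟩ := h
    exact Nat.find_min hex hj ((hBinv j γ g).1 h)
  · obtain ⟨i, hi⟩ := Set.mem_iUnion.1 hδ
    have h1 := hi.1
    rw [hmem δ i hi] at h1
    have h2 : (((δ * γ⁻¹ : Γ)) : G) ∈ U := by
      have := @hV ((δ • g) * (a (Nat.find hex))⁻¹, (γ : G) * g * (a (Nat.find hex))⁻¹)
        ⟨h1.1, hγ.2⟩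
      simpa [Subgroup.smul_def, mul_assoc] using this
    exact mul_inv_eq_one.1 (Subtype.ext (hΓ _ (δ * γ⁻¹).2 h2))

/-! ### Topology and measure on matrix groups -/

instance (n : ℕ) : MeasureSpace (Matrix (Fin n) (Fin n) ℝ) :=
  inferInstanceAs (MeasureSpace (Fin n → Fin n → ℝ))

instance (n : ℕ) : SecondCountableTopology (Matrix (Fin n) (Fin n) ℝ) :=
  inferInstanceAs (SecondCountableTopology (Fin n → Fin n → ℝ))

instance (n : ℕ) : LocallyCompactSpace (Matrix (Fin n) (Fin n) ℝ) :=
  inferInstanceAs (LocallyCompactSpace (Fin n → Fin n → ℝ))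

instance (n : ℕ) : BorelSpace (Matrix (Fin n) (Fin n) ℝ) :=
  inferInstanceAs (BorelSpace (Fin n → Fin n → ℝ))

instance isAddHaarMeasure_volume_pi_pi {ι κ : Type*} [Fintype ι] [Fintype κ] :
    (volume : Measure (ι → κ → ℝ)).IsAddHaarMeasure :=
  { (inferInstance : IsFiniteMeasureOnCompacts (volume : Measure (ι → κ → ℝ))),
    (inferInstance : (volume : Measure (ι → κ → ℝ)).IsAddLeftInvariant),
    (inferInstance : (volume : Measure (ι → κ → ℝ)).IsOpenPosMeasure) with }

instance (n : ℕ) : (volume : Measure (Matrix (Fin n) (Fin n) ℝ)).IsAddHaarMeasure :=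
  isAddHaarMeasure_volume_pi_pi

instance {M : Type*} [TopologicalSpace M] [Monoid M] [SecondCountableTopology M] :
    SecondCountableTopology Mˣ :=
  haveI : SecondCountableTopology Mᵐᵒᵖ :=
    MulOpposite.opHomeomorph.symm.isEmbedding.secondCountableTopology
  Units.isEmbedding_embedProduct.secondCountableTopology

section
open scoped Matrix.Norms.Operator

/-- Units are open in a complete normed ring. The operator norm serves only here; the conclusion is
purely topological. -/
lemma isOpenEmbedding_val_GL (n : ℕ) :
    Topology.IsOpenEmbedding (Units.val : GL (Fin n) ℝ → Matrix (Fin n) (Fin n) ℝ) :=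
  Units.isOpenEmbedding_val

end

lemma borelSpace_units_of_isInducing {M : Type*} [TopologicalSpace M] [Monoid M]
    [MeasurableSpace M] [BorelSpace M] (h : Topology.IsInducing (Units.val : Mˣ → M)) :
    BorelSpace Mˣ where
  measurable_eq := by
    change MeasurableSpace.comap Units.val _ = _
    rw [BorelSpace.measurable_eq (α := M), h.eq_induced]
    exact borel_comap.symm

instance (n : ℕ) : BorelSpace (GL (Fin n) ℝ) :=
  borelSpace_units_of_isInducing (isOpenEmbedding_val_GL n).isInducing

instance : BorelSpace ℝˣ :=
  borelSpace_units_of_isInducing (Units.isOpenEmbedding_val (R := ℝ)).isInducing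

lemma measurableEmbedding_val_GL (n : ℕ) :
    MeasurableEmbedding (Units.val : GL (Fin n) ℝ → Matrix (Fin n) (Fin n) ℝ) :=
  (isOpenEmbedding_val_GL n).measurableEmbedding

lemma continuous_det_GL (n : ℕ) : Continuous (Matrix.GeneralLinearGroup.det : GL (Fin n) ℝ → ℝˣ) :=
  Continuous.units_map (Matrix.detMonoidHom : Matrix (Fin n) (Fin n) ℝ →* ℝ)
    (continuous_id.matrix_det)

lemma mem_GLpm_iff {n : ℕ} {g : GL (Fin n) ℝ} :
    g ∈ GLpm n ↔ |(g : Matrix (Fin n) (Fin n) ℝ).det| = 1 :=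
  (abs_eq zero_le_one).symm

lemma isClosed_GLpm (n : ℕ) : IsClosed (GLpm n : Set (GL (Fin n) ℝ)) := by
  have : (GLpm n : Set (GL (Fin n) ℝ)) =
      (fun g : GL (Fin n) ℝ => |(g : Matrix (Fin n) (Fin n) ℝ).det|) ⁻¹' {1} :=
    Set.ext fun g => mem_GLpm_iff
  rw [this]
  exact isClosed_singleton.preimage (Units.continuous_val.matrix_det.abs)

instance (n : ℕ) : LocallyCompactSpace (GLpm n) := (isClosed_GLpm n).locallyCompactSpace

/-! ### Haar measure on matrices of determinant `±1` -/

instance (n : ℕ) : SecondCountableTopology (GLpm n) :=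
  inferInstanceAs (SecondCountableTopology (GLpm n : Set (GL (Fin n) ℝ)))

section HaarGLpm

variable {n : ℕ}

/-- The positive scalar `|u| ^ (-1 / n)`. -/
def rootInv (n : ℕ) : ℝˣ →* ℝˣ where
  toFun u := Units.mk0 (|(u : ℝ)| ^ (-(1 / n : ℝ))) (Real.rpow_pos_of_pos (abs_pos.2 u.ne_zero) _).ne'
  map_one' := by ext; simp
  map_mul' u w := by ext; simp [abs_mul, Real.mul_rpow]

lemma continuous_rootInv (n : ℕ) : Continuous (rootInv n) := by
  have h : Continuous fun u : ℝˣ => ((rootInv n u : ℝˣ) : ℝ) :=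
    (Units.continuous_val.abs).rpow_const fun u => Or.inl (abs_pos.2 u.ne_zero).ne'
  rw [Units.isEmbedding_val₀.continuous_iff]
  exact h

/-- Multiplication of a matrix by the positive scalar that makes its determinant `±1`. -/
def unitDetHom (n : ℕ) : GL (Fin n) ℝ →* GL (Fin n) ℝ where
  toFun g := Matrix.GeneralLinearGroup.scalar (Fin n) (rootInv n g.det) * g
  map_one' := by simp
  map_mul' g h := by
    rw [map_mul, map_mul, map_mul, mul_assoc, mul_assoc, ← mul_assoc _ g h, ← mul_assoc g _ h,
      ← Matrix.GeneralLinearGroup.scalar_commute _ g]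

lemma continuous_unitDetHom (n : ℕ) : Continuous (unitDetHom n) := by
  have h : Continuous (Matrix.GeneralLinearGroup.scalar (Fin n) : ℝˣ →* GL (Fin n) ℝ) :=
    Continuous.units_map (Matrix.scalar (Fin n) : ℝ →+* Matrix (Fin n) (Fin n) ℝ).toMonoidHom
      (by
        change Continuous fun r : ℝ => Matrix.diagonal fun _ : Fin n => r
        fun_prop)
  exact (h.comp ((continuous_rootInv n).comp (continuous_det_GL n))).mul continuous_id

lemma coe_unitDetHom (g : GL (Fin n) ℝ) :
    (unitDetHom n g : Matrix (Fin n) (Fin n) ℝ) =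
      (|(g : Matrix (Fin n) (Fin n) ℝ).det| ^ (-(1 / n : ℝ))) • (g : Matrix (Fin n) (Fin n) ℝ) := by
  simp [unitDetHom, rootInv, Matrix.smul_eq_diagonal_mul]

lemma unitDetHom_mem [NeZero n] (g : GL (Fin n) ℝ) : unitDetHom n g ∈ GLpm n := by
  have hn : (n : ℝ) ≠ 0 := Nat.cast_ne_zero.2 (NeZero.ne n)
  have hd : 0 < |(g : Matrix (Fin n) (Fin n) ℝ).det| := abs_pos.2 g.det_ne_zero
  rw [mem_GLpm_iff, coe_unitDetHom, Matrix.det_smul, Fintype.card_fin, abs_mul, abs_pow,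
    abs_of_pos (Real.rpow_pos_of_pos hd _), ← Real.rpow_natCast, ← Real.rpow_mul hd.le]
  have : -(1 / n : ℝ) * n = -1 := by field_simp
  rw [this, Real.rpow_neg_one, inv_mul_cancel₀ hd.ne']

lemma unitDetHom_eq_self {g : GL (Fin n) ℝ} (hg : g ∈ GLpm n) : unitDetHom n g = g := by
  apply Units.ext
  rw [coe_unitDetHom, mem_GLpm_iff.1 hg, Real.one_rpow, one_smul]

/-- The projection of `GL_n(ℝ)` onto `GL_n^{±1}(ℝ)`. -/
def unitDet (n : ℕ) [NeZero n] : GL (Fin n) ℝ →* GLpm n :=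
  (unitDetHom n).codRestrict _ unitDetHom_mem

lemma continuous_unitDet (n : ℕ) [NeZero n] : Continuous (unitDet n) :=
  (continuous_unitDetHom n).subtype_mk _

lemma unitDet_coe [NeZero n] (g : GLpm n) : unitDet n (g : GL (Fin n) ℝ) = g :=
  Subtype.ext (unitDetHom_eq_self g.2)

/-- Lebesgue measure on `GL_n(ℝ)`. -/
def lebesgueGL (n : ℕ) : Measure (GL (Fin n) ℝ) := 
  (volume : Measure (Matrix (Fin n) (Fin n) ℝ)).comap Units.val

lemma lebesgueGL_apply (s : Set (GL (Fin n) ℝ)) :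
    lebesgueGL n s = volume ((Units.val : GL (Fin n) ℝ → Matrix (Fin n) (Fin n) ℝ) '' s) :=
  (measurableEmbedding_val_GL n).comap_apply _ _

/-- The matrices whose determinant has absolute value less than `1`. -/
def smallDet (n : ℕ) : Set (GL (Fin n) ℝ) := {g | |(g : Matrix (Fin n) (Fin n) ℝ).det| < 1}

lemma isOpen_smallDet (n : ℕ) : IsOpen (smallDet n) :=
  isOpen_lt (Units.continuous_val.matrix_det.abs) continuous_const

/-- Haar measure on `GL_n^{±1}(ℝ)`: the measure of `E` is the Lebesgue measure of the cone over
`E`. -/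
def haarGLpm (n : ℕ) [NeZero n] : Measure (GLpm n) :=
  ((lebesgueGL n).restrict (smallDet n)).map (unitDet n)

lemma haarGLpm_apply [NeZero n] {s : Set (GLpm n)} (hs : MeasurableSet s) :
    haarGLpm n s = lebesgueGL n (unitDet n ⁻¹' s ∩ smallDet n) := by
  rw [haarGLpm, Measure.map_apply (continuous_unitDet n).measurable hs,
    Measure.restrict_apply ((continuous_unitDet n).measurable hs)]

lemma measurePreserving_lebesgueGL (T : Matrix (Fin n) (Fin n) ℝ →ₗ[ℝ] Matrix (Fin n) (Fin n) ℝ)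
    (hT : |LinearMap.det T| = 1) (e : GL (Fin n) ℝ ≃ₜ GL (Fin n) ℝ)
    (he : ∀ g, (e g : Matrix (Fin n) (Fin n) ℝ) = T g) :
    MeasurePreserving e (lebesgueGL n) (lebesgueGL n) := by
  refine ⟨e.continuous.measurable, Measure.ext fun s hs => ?_⟩
  have hT0 : LinearMap.det T ≠ 0 := fun h => by simp [h] at hT
  have hinj : Function.Injective T :=
    (LinearMap.equivOfDetNeZero T hT0).injective
  rw [Measure.map_apply e.continuous.measurable hs, lebesgueGL_apply, lebesgueGL_apply]
  have h : (Units.val : GL (Fin n) ℝ → Matrix (Fin n) (Fin n) ℝ) '' (e ⁻¹' s) =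
      T ⁻¹' ((Units.val : GL (Fin n) ℝ → Matrix (Fin n) (Fin n) ℝ) '' s) := by
    ext M
    constructor
    · rintro ⟨g, hg, rfl⟩
      exact ⟨e g, hg, he g⟩
    · rintro ⟨g, hg, hM⟩
      refine ⟨e.symm g, by simpa using hg, hinj ?_⟩
      rw [← hM, ← he, e.apply_symm_apply]
  rw [h]
  have h2 := Measure.addHaar_preimage_linearMap (E := Fin n → Fin n → ℝ) volume (f := T) hT0
    ((Units.val : GL (Fin n) ℝ → Matrix (Fin n) (Fin n) ℝ) '' s)
  have h3 : ENNReal.ofReal |(LinearMap.det T)⁻¹| = 1 := by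
    rw [abs_inv, hT, inv_one, ENNReal.ofReal_one]
  exact h2.trans ((congrArg (· * _) h3).trans (one_mul _))

/-- Left multiplication is a representation of GL_n(ℝ) on matrices, so its determinant at h is ±1 by
the triviality of positive characters. -/
lemma measurePreserving_mul_left_lebesgueGL {h : GL (Fin n) ℝ} (hh : h ∈ GLpm n) :
    MeasurePreserving (h * ·) (lebesgueGL n) (lebesgueGL n) := by
  let ρ : GL (Fin n) ℝ →* (Matrix (Fin n) (Fin n) ℝ →ₗ[ℝ] Matrix (Fin n) (Fin n) ℝ) :=
    (Algebra.lmul ℝ (Matrix (Fin n) (Fin n) ℝ) : _ →* _).comp (Units.coeHom _)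
  exact measurePreserving_lebesgueGL (ρ h) (abs_det_eq_one_of_mem_GLpm ρ hh)
    (Homeomorph.mulLeft h) fun g => rfl

lemma measurePreserving_mul_right_lebesgueGL {h : GL (Fin n) ℝ} (hh : h ∈ GLpm n) :
    MeasurePreserving (· * h) (lebesgueGL n) (lebesgueGL n) := by
  -- Right multiplication reverses products, so the representation uses g⁻¹ and is evaluated at h⁻¹.
  let ρ : GL (Fin n) ℝ →* (Matrix (Fin n) (Fin n) ℝ →ₗ[ℝ] Matrix (Fin n) (Fin n) ℝ) :=
    { toFun := fun g => LinearMap.mulRight ℝ ((g⁻¹ : GL (Fin n) ℝ) : Matrix (Fin n) (Fin n) ℝ)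
      map_one' := by ext; simp
      map_mul' := fun a b => by
        ext1 x
        simp only [mul_inv_rev, Units.val_mul, LinearMap.mulRight_apply, Module.End.mul_apply,
          Matrix.mul_assoc] }
  refine measurePreserving_lebesgueGL (ρ h⁻¹) (abs_det_eq_one_of_mem_GLpm ρ (inv_mem hh))
    (Homeomorph.mulRight h) fun g => ?_
  simp [ρ]

lemma abs_det_mul_of_mem_left {h : GL (Fin n) ℝ} (hh : h ∈ GLpm n) (g : GL (Fin n) ℝ) :
    h * g ∈ smallDet n ↔ g ∈ smallDet n := by
  simp only [smallDet, Set.mem_ofPred_eq, Units.val_mul, Matrix.det_mul, abs_mul,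
    mem_GLpm_iff.1 hh, one_mul]

lemma abs_det_mul_of_mem_right {h : GL (Fin n) ℝ} (hh : h ∈ GLpm n) (g : GL (Fin n) ℝ) :
    g * h ∈ smallDet n ↔ g ∈ smallDet n := by
  simp only [smallDet, Set.mem_ofPred_eq, Units.val_mul, Matrix.det_mul, abs_mul,
    mem_GLpm_iff.1 hh, mul_one]

variable [NeZero n]

/-- The cone over a translate hE is h times the cone over E: `unitDet` is a homomorphism fixing h,
and `smallDet` is stable under h. -/
instance : (haarGLpm n).IsMulLeftInvariant where
  map_mul_left_eq_self h := by
    have hp := (measurePreserving_mul_left_lebesgueGL h.2).restrict_preimage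
      (isOpen_smallDet n).measurableSet
    have hs : ((h : GL (Fin n) ℝ) * ·) ⁻¹' smallDet n = smallDet n :=
      Set.ext fun g => abs_det_mul_of_mem_left h.2 g
    rw [hs] at hp
    conv_rhs => rw [haarGLpm, ← hp.map_eq]
    rw [haarGLpm, Measure.map_map (measurable_const_mul h) (continuous_unitDet n).measurable,
      Measure.map_map (continuous_unitDet n).measurable (measurable_const_mul _)]
    congr 1
    ext1 g
    simp only [Function.comp_apply, map_mul, unitDet_coe]

/-- Right invariance absorbs the integral matrix k when shapes have the form `S2.mk (g * k)`. -/
instance : (haarGLpm n).IsMulRightInvariant where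
  map_mul_right_eq_self h := by
    have hp := (measurePreserving_mul_right_lebesgueGL h.2).restrict_preimage
      (isOpen_smallDet n).measurableSet
    have hs : (· * (h : GL (Fin n) ℝ)) ⁻¹' smallDet n = smallDet n :=
      Set.ext fun g => abs_det_mul_of_mem_right h.2 g
    rw [hs] at hp
    conv_rhs => rw [haarGLpm, ← hp.map_eq]
    rw [haarGLpm, Measure.map_map (measurable_mul_const h) (continuous_unitDet n).measurable,
      Measure.map_map (continuous_unitDet n).measurable (measurable_mul_const _)]
    congr 1
    ext1 g
    simp only [Function.comp_apply, map_mul, unitDet_coe]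

/-- If |det g| < 1, the rescaling factor |det g|^(-1/n) is at least 1. Hence the cone over a compact
set is bounded. -/
lemma entry_le_of_mem_smallDet {g : GL (Fin n) ℝ} (hg : g ∈ smallDet n) (i j : Fin n) :
    |g i j| ≤ |(unitDet n g : GL (Fin n) ℝ) i j| := by
  have hd : 0 < |(g : Matrix (Fin n) (Fin n) ℝ).det| := abs_pos.2 g.det_ne_zero
  have h : (unitDet n g : GL (Fin n) ℝ) i j =
      |(g : Matrix (Fin n) (Fin n) ℝ).det| ^ (-(1 / n : ℝ)) * g i j :=
    congrFun (congrFun (coe_unitDetHom g) i) j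
  rw [h, abs_mul]
  refine le_mul_of_one_le_left (abs_nonneg _) ?_
  rw [abs_of_pos (Real.rpow_pos_of_pos hd _)]
  exact Real.one_le_rpow_of_pos_of_le_one_of_nonpos hd (le_of_lt hg)
    (neg_nonpos.2 (by positivity))

instance : IsFiniteMeasureOnCompacts (haarGLpm n) where
  lt_top_of_isCompact K hK := by
    rw [haarGLpm_apply hK.measurableSet, lebesgueGL_apply]
    have hc (i j : Fin n) : Continuous fun g : GLpm n => |(g : GL (Fin n) ℝ) i j| :=
      ((Units.continuous_val.comp continuous_subtype_val).matrix_elem i j).abs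
    choose R hR using fun p : Fin n × Fin n => hK.bddAbove_image (hc p.1 p.2).continuousOn
    let C : Set (Fin n → Fin n → ℝ) :=
      Set.Icc (fun i j => -R (i, j)) (fun i j => R (i, j))
    have hC : volume C < ∞ := isCompact_Icc.measure_lt_top
    refine lt_of_le_of_lt (measure_mono (t := C) ?_) hC
    rintro _ ⟨g, ⟨hgK, hg⟩, rfl⟩
    have h (i j : Fin n) : |g i j| ≤ R (i, j) :=
      (entry_le_of_mem_smallDet hg i j).trans (hR (i, j) ⟨_, hgK, rfl⟩)
    exact ⟨fun i j => (abs_le.1 (h i j)).1, fun i j => (abs_le.1 (h i j)).2⟩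

instance : (haarGLpm n).IsOpenPosMeasure where
  open_pos U hU hne := by
    rw [haarGLpm_apply hU.measurableSet, lebesgueGL_apply]
    refine IsOpen.measure_ne_zero _ ((isOpenEmbedding_val_GL n).isOpenMap _
      ((hU.preimage (continuous_unitDet n)).inter (isOpen_smallDet n))) (Set.Nonempty.image _ ?_)
    obtain ⟨u, hu⟩ := hne
    have hn : (n : ℝ) ≠ 0 := Nat.cast_ne_zero.2 (NeZero.ne n)
    -- The matrix u / 2 lies in the cone over U, so this open cone is nonempty.
    let t : ℝˣ := Units.mk0 (1 / 2) (by norm_num)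
    let s : GL (Fin n) ℝ := Matrix.GeneralLinearGroup.scalar (Fin n) t
    have hs : (s : Matrix (Fin n) (Fin n) ℝ) = (1 / 2 : ℝ) • 1 := by
      simp [s, t, Matrix.smul_eq_diagonal_mul]
    have hdet : (s : Matrix (Fin n) (Fin n) ℝ).det = (1 / 2) ^ n := by
      rw [hs, Matrix.det_smul, Matrix.det_one, mul_one, Fintype.card_fin]
    have hN : unitDetHom n s = 1 := by
      apply Units.ext
      have : (n : ℝ) * -(1 / n : ℝ) = -1 := by field_simp
      rw [coe_unitDetHom, hdet, abs_of_pos (by positivity), ← Real.rpow_natCast,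
        ← Real.rpow_mul (by norm_num), this, hs, Real.rpow_neg_one, smul_smul]
      norm_num
    refine ⟨s * u, ?_, ?_⟩
    · have : unitDet n (s * u) = u := by
        rw [map_mul, unitDet_coe]
        have : unitDet n s = 1 := Subtype.ext hN
        rw [this, one_mul]
      rwa [Set.mem_preimage, this]
    · rw [abs_det_mul_of_mem_right u.2]
      simp only [smallDet, Set.mem_ofPred_eq]
      rw [hdet, abs_of_pos (by positivity)]
      exact pow_lt_one₀ (by norm_num) (by norm_num) (NeZero.ne n)

instance : (haarGLpm n).IsHaarMeasure where

end HaarGLpm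

/-! ### Integral matrices -/

instance (n : ℕ) : Countable (GL (Fin n) ℤ) :=
  haveI : Countable (Matrix (Fin n) (Fin n) ℤ) := inferInstanceAs (Countable (Fin n → Fin n → ℤ))
  Units.val_injective.countable

instance (n : ℕ) : Countable (GLInt n) :=
  (MonoidHom.rangeRestrict_surjective
    (Matrix.GeneralLinearGroup.map (n := Fin n) (Int.castRingHom ℝ))).countable

lemma mem_GLInt_iff {n : ℕ} {g : GL (Fin n) ℝ} :
    g ∈ GLInt n ↔ ∃ γ : GL (Fin n) ℤ, ∀ i j, g i j = (γ i j : ℤ) := by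
  constructor
  · rintro ⟨γ, rfl⟩
    exact ⟨γ, fun i j => rfl⟩
  · rintro ⟨γ, h⟩
    exact ⟨γ, Units.ext (Matrix.ext fun i j => (h i j).symm)⟩

lemma GLInt_le_GLpm (n : ℕ) : GLInt n ≤ GLpm n := by
  rintro _ ⟨γ, rfl⟩
  rw [mem_GLpm_iff]
  have h : ((Matrix.GeneralLinearGroup.map (Int.castRingHom ℝ) γ : GL (Fin n) ℝ) :
      Matrix (Fin n) (Fin n) ℝ).det = (((γ : Matrix (Fin n) (Fin n) ℤ).det : ℤ) : ℝ) :=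
    (RingHom.map_det (Int.castRingHom ℝ) _).symm
  rw [h]
  rcases Int.isUnit_iff.1 ((Matrix.isUnit_iff_isUnit_det _).1 γ.isUnit) with h | h <;> simp [h]

instance (n : ℕ) : Countable ((GLInt n).subgroupOf (GLpm n)) :=
  Function.Injective.countable
    (f := fun γ : (GLInt n).subgroupOf (GLpm n) => (⟨γ.1.1, γ.2⟩ : GLInt n)) fun _ _ h =>
      Subtype.ext (Subtype.ext (congrArg (fun x : GLInt n => x.1) h))

/-- There is a measurable fundamental domain for `GL_n(ℤ)` in `GL_n^{±1}(ℝ)`. -/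
theorem exists_fundamentalDomain_GLInt (n : ℕ) :
    ∃ F : Set (GLpm n), MeasurableSet F ∧
      ∀ g : GLpm n, ∃! γ : (GLInt n).subgroupOf (GLpm n), γ • g ∈ F := by
  have hc : Continuous fun g : GLpm n => ((g : GL (Fin n) ℝ) : Matrix (Fin n) (Fin n) ℝ) :=
    Units.continuous_val.comp continuous_subtype_val
  -- An integral matrix whose entries are at distance less than 1 from those of the identity is the
  -- identity.
  let U : Set (GLpm n) := ⋂ i, ⋂ j,
    {g | |(g : GL (Fin n) ℝ) i j - (1 : Matrix (Fin n) (Fin n) ℝ) i j| < 1}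
  have hU : IsOpen U := isOpen_iInter_of_finite fun i => isOpen_iInter_of_finite fun j =>
    isOpen_lt ((hc.matrix_elem i j).sub continuous_const).abs continuous_const
  refine exists_measurable_fundamentalDomain _ (hU.mem_nhds (by simp [U])) fun γ hγ hγU => ?_
  obtain ⟨δ, hδ⟩ := mem_GLInt_iff.1 (Subgroup.mem_subgroupOf.1 hγ)
  refine Subtype.ext (Units.ext (Matrix.ext fun i j => ?_))
  have h := Set.mem_iInter.1 (Set.mem_iInter.1 hγU i) j
  rw [Set.mem_ofPred_eq, hδ] at h
  have h1 : ((1 : Matrix (Fin n) (Fin n) ℝ) i j) = (((1 : Matrix (Fin n) (Fin n) ℤ) i j : ℤ) : ℝ) := by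
    simp [Matrix.one_apply]
  rw [hδ]
  rw [h1] at h
  have h2 : δ i j - (1 : Matrix (Fin n) (Fin n) ℤ) i j = 0 := Int.abs_lt_one_iff.1 (by exact_mod_cast h)
  have h3 : ((1 : GLpm n) : GL (Fin n) ℝ) i j = (1 : Matrix (Fin n) (Fin n) ℝ) i j := rfl
  rw [h3, h1, sub_eq_zero.1 h2]

/-! ### Finiteness of the covolume of `GL₃(ℤ)` -/

/-- The dot product in dimension three. -/
def dot3 {R : Type*} [CommRing R] (x y : Fin 3 → R) : R := x 0 * y 0 + x 1 * y 1 + x 2 * y 2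

/-- The cross product. -/
def cross3 {R : Type*} [CommRing R] (x y : Fin 3 → R) : Fin 3 → R :=
  ![x 1 * y 2 - x 2 * y 1, x 2 * y 0 - x 0 * y 2, x 0 * y 1 - x 1 * y 0]

lemma dot3_self_nonneg (x : Fin 3 → ℝ) : 0 ≤ dot3 x x := by
  unfold dot3; nlinarith [mul_self_nonneg (x 0), mul_self_nonneg (x 1), mul_self_nonneg (x 2)]

lemma dot3_self_eq_zero {x : Fin 3 → ℝ} (h : dot3 x x = 0) : x = 0 := by
  unfold dot3 at h
  funext i
  fin_cases i <;> simp <;>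
    nlinarith [mul_self_nonneg (x 0), mul_self_nonneg (x 1), mul_self_nonneg (x 2)]

lemma dot3_sq_le (x y : Fin 3 → ℝ) : dot3 x y ^ 2 ≤ dot3 x x * dot3 y y := by
  unfold dot3
  nlinarith [sq_nonneg (x 0 * y 1 - x 1 * y 0), sq_nonneg (x 0 * y 2 - x 2 * y 0),
    sq_nonneg (x 1 * y 2 - x 2 * y 1)]

@[fun_prop]
lemma Continuous.dot3 {X : Type*} [TopologicalSpace X] {f g : X → Fin 3 → ℝ} (hf : Continuous f)
    (hg : Continuous g) : Continuous fun x => dot3 (f x) (g x) := by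
  unfold _root_.dot3; fun_prop

@[fun_prop]
lemma Continuous.cross3 {X : Type*} [TopologicalSpace X] {f g : X → Fin 3 → ℝ} (hf : Continuous f)
    (hg : Continuous g) : Continuous fun x => cross3 (f x) (g x) := by
  unfold _root_.cross3
  refine continuous_pi fun i => ?_
  fin_cases i <;> simp <;> fun_prop

/-- A Siegel domain of bases of `ℝ³`. -/
def IsSiegel (b : Fin 3 → Fin 3 → ℝ) : Prop :=
  -- Let b₁*, b₂* be the Gram–Schmidt vectors and w = b₀ × b₁. Then w × b₀ = |b₀|² b₁*, |w| =
  -- |b₀||b₁*| and |b₂ · w| = |w||b₂*|. The first three inequalities say that the coefficient of b₁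
  -- along b₀ and those of b₂ along b₀ and b₁* are at most 1/2 in absolute value. For independent
  -- vectors the last two say 3|b₀|² ≤ 4|b₁*|² and 3|b₁*|² ≤ 4|b₂*|². This form avoids divisions.
  2 * |dot3 (b 1) (b 0)| ≤ dot3 (b 0) (b 0) ∧
  2 * |dot3 (b 2) (b 0)| ≤ dot3 (b 0) (b 0) ∧
  2 * |dot3 (b 2) (cross3 (cross3 (b 0) (b 1)) (b 0))| ≤
    dot3 (cross3 (b 0) (b 1)) (cross3 (b 0) (b 1)) ∧
  3 * dot3 (b 0) (b 0) ^ 2 ≤ 4 * dot3 (cross3 (b 0) (b 1)) (cross3 (b 0) (b 1)) ∧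
  3 * dot3 (cross3 (b 0) (b 1)) (cross3 (b 0) (b 1)) ^ 2 ≤
    4 * dot3 (b 2) (cross3 (b 0) (b 1)) ^ 2 * dot3 (b 0) (b 0)

lemma isClosed_isSiegel : IsClosed {b : Fin 3 → Fin 3 → ℝ | IsSiegel b} := by
  simp only [IsSiegel, Set.ofPred_and]
  refine (isClosed_le ?_ ?_).inter ((isClosed_le ?_ ?_).inter ((isClosed_le ?_ ?_).inter
    ((isClosed_le ?_ ?_).inter (isClosed_le ?_ ?_)))) <;> fun_prop

/-- The inequalities are homogeneous, of degrees 2, 2, 4, 4 and 8, so the Siegel condition passes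
from a matrix of determinant ±1 to the cone over it. -/
lemma IsSiegel.of_smul {b : Fin 3 → Fin 3 → ℝ} {t : ℝ} (ht : 0 < t) (h : IsSiegel (t • b)) :
    IsSiegel b := by
  obtain ⟨h1, h2, h3, h4, h5⟩ := h
  have e1 (x y : Fin 3 → ℝ) : dot3 (t • x) (t • y) = t ^ 2 * dot3 x y := by
    simp [dot3]; ring
  have e2 (x y : Fin 3 → ℝ) : cross3 (t • x) (t • y) = t ^ 2 • cross3 x y := by
    funext i; fin_cases i <;> simp [cross3] <;> ring
  have e3 (x y : Fin 3 → ℝ) : cross3 (t ^ 2 • x) (t • y) = t ^ 3 • cross3 x y := by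
    funext i; fin_cases i <;> simp [cross3] <;> ring
  have e4 (x y : Fin 3 → ℝ) (k l : ℕ) : dot3 (t ^ k • x) (t ^ l • y) = t ^ (k + l) * dot3 x y := by
    simp [dot3]; ring
  have e5 (x y : Fin 3 → ℝ) (l : ℕ) : dot3 (t • x) (t ^ l • y) = t ^ (l + 1) * dot3 x y := by
    simp [dot3]; ring
  simp only [Pi.smul_apply, e1, e2, e3, e4, e5, abs_mul, abs_pow, abs_of_pos ht] at h1 h2 h3 h4 h5
  have ht2 : 0 < t ^ 2 := by positivity
  have ht4 : 0 < t ^ 4 := by positivity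
  have ht8 : 0 < t ^ 8 := by positivity
  refine ⟨le_of_mul_le_mul_left (a := t ^ 2) ?_ ht2, le_of_mul_le_mul_left (a := t ^ 2) ?_ ht2,
    le_of_mul_le_mul_left (a := t ^ 4) ?_ ht4, le_of_mul_le_mul_left (a := t ^ 4) ?_ ht4,
    le_of_mul_le_mul_left (a := t ^ 8) ?_ ht8⟩
  · linarith
  · linarith
  · norm_num at h3; linarith
  · norm_num at h4; linarith
  · norm_num at h5; linarith

/-- The volume of a parallelepiped given by three pairs of linear inequalities. -/
lemma volume_abs_dot3_le (x y z : Fin 3 → ℝ) {a b c d : ℝ} (hd : dot3 x (cross3 y z) = d)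
    (hd0 : d ≠ 0) (ha : 0 ≤ a) (hb : 0 ≤ b) :
    volume {v : Fin 3 → ℝ | |dot3 v x| ≤ a ∧ |dot3 v y| ≤ b ∧ |dot3 v z| ≤ c} =
      ENNReal.ofReal (8 * a * b * c / |d|) := by
  let A : Matrix (Fin 3) (Fin 3) ℝ := Matrix.of ![x, y, z]
  have hdet : LinearMap.det (Matrix.toLin' A) = d := by
    rw [LinearMap.det_toLin', Matrix.det_fin_three, ← hd]
    simp [A, dot3, cross3]
    ring
  have hset : {v : Fin 3 → ℝ | |dot3 v x| ≤ a ∧ |dot3 v y| ≤ b ∧ |dot3 v z| ≤ c} =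
      Matrix.toLin' A ⁻¹' Set.Icc ![-a, -b, -c] ![a, b, c] := by
    ext v
    simp only [Set.mem_ofPred_eq, Set.mem_preimage, Set.mem_Icc, Pi.le_def, Fin.forall_fin_succ,
      abs_le, Matrix.toLin'_apply, Matrix.mulVec, dotProduct, Fin.sum_univ_three, A, dot3]
    simp [mul_comm]
    tauto
  rw [hset, Measure.addHaar_preimage_linearMap _ (by rwa [hdet]), hdet, Real.volume_Icc_pi,
    Fin.prod_univ_three]
  simp only [Matrix.cons_val]
  rw [← ENNReal.ofReal_mul (by linarith), ← ENNReal.ofReal_mul (by nlinarith),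
    ← ENNReal.ofReal_mul (by positivity), abs_inv]
  congr 1
  ring

lemma exists_orthogonal (x : Fin 3 → ℝ) : ∃ u : Fin 3 → ℝ, dot3 u x = 0 ∧ 0 < dot3 u u := by
  by_cases h : x 0 = 0 ∧ x 1 = 0
  · exact ⟨![1, 0, 0], by simp [dot3, h], by simp [dot3]⟩
  · refine ⟨![-x 1, x 0, 0], by simp [dot3]; ring, ?_⟩
    rw [not_and_or] at h
    simp only [dot3, Matrix.cons_val]
    rcases h with h | h
    · nlinarith [mul_self_pos.2 h, mul_self_nonneg (x 1)]
    · nlinarith [mul_self_pos.2 h, mul_self_nonneg (x 0)]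

/-- The component of y along x lies in an interval of length |x|. The orthogonal component has
length |x × y|/|x| ≤ √(2/|x|), so it lies in a square of area 8/|x|. The product does not depend on
x. -/
lemma volume_second_row_le (x : Fin 3 → ℝ) (hx : x ≠ 0) :
    volume {y : Fin 3 → ℝ | 2 * |dot3 y x| ≤ dot3 x x ∧
      3 * dot3 (cross3 x y) (cross3 x y) ^ 2 ≤ 4 * dot3 x x} ≤ 8 := by
  obtain ⟨u, hux, hu⟩ := exists_orthogonal x
  have hxx : 0 < dot3 x x :=
    (dot3_self_nonneg x).lt_of_ne fun h => hx (dot3_self_eq_zero h.symm)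
  set r := √(dot3 x x) with hr
  have hr0 : 0 < r := Real.sqrt_pos.2 hxx
  have hr2 : r ^ 2 = dot3 x x := Real.sq_sqrt hxx.le
  set q := √(2 * r * dot3 u u) with hq
  have hq2 : q ^ 2 = 2 * r * dot3 u u := Real.sq_sqrt (by positivity)
  have hdet : dot3 x (cross3 u (cross3 x u)) = dot3 x x * dot3 u u := by
    have : dot3 x (cross3 u (cross3 x u)) = dot3 x x * dot3 u u - dot3 u x ^ 2 := by
      simp [dot3, cross3]; ring
    rw [this, hux]; ring
  have hvol := volume_abs_dot3_le x u (cross3 x u) (a := dot3 x x / 2) (b := q / r) (c := q) hdet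
    (by positivity) (by positivity) (by positivity)
  refine (measure_mono ?_).trans (hvol.le.trans ?_)
  · rintro y ⟨h1, h2⟩
    set w := cross3 x y with hw
    -- The hypothesis gives the constant 2/√3; the cruder 2 suffices.
    have hww : dot3 w w ≤ 2 * r := by
      have : dot3 w w ^ 2 ≤ (2 * r) ^ 2 := by nlinarith
      exact le_of_abs_le (abs_le_of_sq_le_sq this (by positivity))
    refine ⟨by linarith, ?_, ?_⟩
    · have e : dot3 w (cross3 x u) = r ^ 2 * dot3 y u := by
        have : dot3 w (cross3 x u) = dot3 x x * dot3 y u - dot3 u x * dot3 y x := by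
          simp [hw, dot3, cross3]; ring
        rw [this, hux, hr2]; ring
      have e2 : dot3 (cross3 x u) (cross3 x u) = r ^ 2 * dot3 u u := by
        have : dot3 (cross3 x u) (cross3 x u) = dot3 x x * dot3 u u - dot3 u x ^ 2 := by
          simp [dot3, cross3]; ring
        rw [this, hux, hr2]; ring
      have h3 := dot3_sq_le w (cross3 x u)
      rw [e, e2] at h3
      refine abs_le_of_sq_le_sq ?_ (by positivity)
      rw [div_pow, hq2, le_div_iff₀ (by positivity)]
      have h4 : r ^ 2 * (dot3 y u ^ 2 * r ^ 2) ≤ r ^ 2 * (2 * r * dot3 u u) := by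
        nlinarith [mul_le_mul_of_nonneg_right hww (mul_nonneg (sq_nonneg r) hu.le)]
      exact le_of_mul_le_mul_left h4 (by positivity)
    · have e : dot3 y (cross3 x u) = - dot3 w u := by
        simp [hw, dot3, cross3]; ring
      rw [e, abs_neg]
      refine abs_le_of_sq_le_sq ?_ (by positivity)
      rw [hq2]
      exact (dot3_sq_le w u).trans (mul_le_mul_of_nonneg_right hww hu.le)
  · have : 8 * (dot3 x x / 2) * (q / r) * q / |dot3 x x * dot3 u u| = 8 := by
      rw [abs_of_pos (by positivity)]
      field_simp
      rw [hq2]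
    rw [this]
    simp

/-- In the orthogonal directions x, w × x and w, with w = x × y, the vector z ranges over intervals
of lengths |x|, |w|/|x| and 2/|w|, whose product is 2. -/
lemma volume_third_row_le (x y : Fin 3 → ℝ) (h0 : cross3 x y ≠ 0) :
    volume {z : Fin 3 → ℝ | 2 * |dot3 z x| ≤ dot3 x x ∧
      2 * |dot3 z (cross3 (cross3 x y) x)| ≤ dot3 (cross3 x y) (cross3 x y) ∧
      |dot3 z (cross3 x y)| < 1} ≤ 2 := by
  set w := cross3 x y with hw
  have hww : 0 < dot3 w w :=
    (dot3_self_nonneg w).lt_of_ne fun h => h0 (dot3_self_eq_zero h.symm)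
  have hxx : 0 < dot3 x x := by
    refine (dot3_self_nonneg x).lt_of_ne fun h => h0 ?_
    rw [hw, dot3_self_eq_zero h.symm]
    funext i; fin_cases i <;> simp [cross3]
  have hdet : dot3 x (cross3 (cross3 w x) w) = dot3 w w * dot3 x x := by
    have hwx : dot3 w x = 0 := by simp [hw, dot3, cross3]; ring
    have : dot3 x (cross3 (cross3 w x) w) = dot3 w w * dot3 x x - dot3 w x ^ 2 := by
      simp [dot3, cross3]; ring
    rw [this, hwx]; ring
  have hvol := volume_abs_dot3_le x (cross3 w x) w (a := dot3 x x / 2) (b := dot3 w w / 2) (c := 1)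
    hdet (by positivity) (by positivity) (by positivity)
  refine (measure_mono ?_).trans (hvol.le.trans ?_)
  · rintro z ⟨h1, h2, h3⟩
    exact ⟨by linarith, by linarith, h3.le⟩
  · have : 8 * (dot3 x x / 2) * (dot3 w w / 2) * 1 / |dot3 w w * dot3 x x| = 2 := by
      rw [abs_of_pos (by positivity)]
      field_simp; norm_num
    rw [this]
    simp

lemma lintegral_prod_le_of_section_le {X Y : Type*} [MeasurableSpace X] [MeasurableSpace Y]
    {μ : Measure X} {ν : Measure Y} [SFinite ν] {s : Set (X × Y)} (hs : MeasurableSet s)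
    {t : Set X} (ht : MeasurableSet t) {c : ℝ≥0∞} (hst : ∀ p ∈ s, p.1 ∈ t)
    (hc : ∀ x ∈ t, ν (Prod.mk x ⁻¹' s) ≤ c) : (μ.prod ν) s ≤ c * μ t := by
  rw [Measure.prod_apply hs, ← lintegral_indicator_const ht]
  refine lintegral_mono fun x => ?_
  by_cases hx : x ∈ t
  · rw [Set.indicator_of_mem hx]; exact hc x hx
  · rw [Set.indicator_of_notMem hx]
    have : Prod.mk x ⁻¹' s = ∅ := Set.eq_empty_of_forall_notMem fun y hy => hx (hst _ hy)
    simp [this]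

lemma dot3_cross3_self (x y : Fin 3 → ℝ) :
    dot3 (cross3 x y) (cross3 x y) = dot3 x x * dot3 y y - dot3 y x ^ 2 := by
  simp [dot3, cross3]; ring

/-- The pairs of vectors that occur as the first two rows in a Siegel domain. -/
def siegelPairs : Set ((Fin 3 → ℝ) × (Fin 3 → ℝ)) :=
  {p | cross3 p.1 p.2 ≠ 0 ∧ 2 * |dot3 p.2 p.1| ≤ dot3 p.1 p.1 ∧
    3 * dot3 p.1 p.1 ^ 2 ≤ 4 * dot3 (cross3 p.1 p.2) (cross3 p.1 p.2) ∧
    3 * dot3 (cross3 p.1 p.2) (cross3 p.1 p.2) ^ 2 ≤ 4 * dot3 p.1 p.1}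

lemma measurableSet_siegelPairs : MeasurableSet siegelPairs := by
  simp only [siegelPairs, Set.ofPred_and]
  refine MeasurableSet.inter (IsOpen.measurableSet (isOpen_ne_fun ?_ ?_)) ((isClosed_le ?_ ?_).inter
    ((isClosed_le ?_ ?_).inter (isClosed_le ?_ ?_))).measurableSet <;> fun_prop

/-- With A = |x|² and w = |x × y|², the inequalities 3A² ≤ 4w and 3w² ≤ 4A give A⁴ ≤ (64/27)A, so x
is bounded; for each x the possible y have volume at most 8. -/
lemma volume_siegelPairs_lt_top : volume siegelPairs < ∞ := by
  let t : Set (Fin 3 → ℝ) := {x | x ≠ 0 ∧ dot3 x x ≤ 2}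
  have ht : MeasurableSet t := by
    simp only [t, Set.ofPred_and]
    exact (isOpen_ne_fun continuous_id continuous_const).measurableSet.inter
      (isClosed_le (by fun_prop) (by fun_prop)).measurableSet
  have htv : volume t < ∞ := by
    refine lt_of_le_of_lt (measure_mono (t := Set.Icc (fun _ => -2) fun _ => 2) ?_)
      (isCompact_Icc (α := Fin 3 → ℝ)).measure_lt_top
    rintro x ⟨-, h⟩
    unfold dot3 at h
    have (i : Fin 3) : |x i| ≤ 2 := by
      refine abs_le_of_sq_le_sq ?_ zero_le_two
      fin_cases i <;> simp <;>
        nlinarith [mul_self_nonneg (x 0), mul_self_nonneg (x 1), mul_self_nonneg (x 2)]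
    exact ⟨fun i => (abs_le.1 (this i)).1, fun i => (abs_le.1 (this i)).2⟩
  refine (lintegral_prod_le_of_section_le (c := 8) measurableSet_siegelPairs ht ?_ ?_).trans_lt
    (ENNReal.mul_lt_top (by simp) htv)
  · rintro ⟨x, y⟩ ⟨h0, h1, h2, h3⟩
    dsimp only at h0 h1 h2 h3
    refine ⟨?_, ?_⟩
    · rintro rfl
      exact h0 (by funext i; fin_cases i <;> simp [cross3])
    · set A := dot3 x x
      set w := dot3 (cross3 x y) (cross3 x y)
      have hA : 0 ≤ A := dot3_self_nonneg _
      have hw : 0 ≤ w := dot3_self_nonneg _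
      by_contra hlt
      push Not at hlt
      have hw1 : A ^ 2 ≤ 4 / 3 * w := by linarith
      have h4 : A ^ 4 ≤ 64 / 27 * A := by
        calc A ^ 4 = (A ^ 2) ^ 2 := by ring
          _ ≤ (4 / 3 * w) ^ 2 := by gcongr
          _ = 16 / 27 * (3 * w ^ 2) := by ring
          _ ≤ 64 / 27 * A := by linarith
      nlinarith [pow_pos (by linarith : 0 < A) 2, pow_lt_pow_left₀ hlt (by norm_num) three_ne_zero]
  · rintro x ⟨hx, -⟩
    refine (measure_mono fun y (hy : (x, y) ∈ siegelPairs) => ?_).trans (volume_second_row_le x hx)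
    exact ⟨hy.2.1, hy.2.2.2⟩

/-- Siegel bases of nonzero determinant less than `1` have finite volume. -/
theorem volume_isSiegel_lt_top :
    volume {b : Fin 3 → Fin 3 → ℝ | IsSiegel b ∧ dot3 (b 2) (cross3 (b 0) (b 1)) ≠ 0 ∧
      |dot3 (b 2) (cross3 (b 0) (b 1))| < 1} < ∞ := by
  set s := {b : Fin 3 → Fin 3 → ℝ | IsSiegel b ∧ dot3 (b 2) (cross3 (b 0) (b 1)) ≠ 0 ∧
      |dot3 (b 2) (cross3 (b 0) (b 1))| < 1} with hs
  have hsm : MeasurableSet s := by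
    simp only [hs, Set.ofPred_and]
    exact isClosed_isSiegel.measurableSet.inter
      ((isOpen_ne_fun (by fun_prop) (by fun_prop)).measurableSet.inter
        (isOpen_lt (by fun_prop) (by fun_prop)).measurableSet)
  -- The third row is split off, so that its volume, at most 2, is integrated first.
  let e₁ := MeasurableEquiv.piFinSuccAbove (fun _ : Fin 3 => Fin 3 → ℝ) 2
  have he₁ := volume_preserving_piFinSuccAbove (fun _ : Fin 3 => Fin 3 → ℝ) 2
  let e₂ := MeasurableEquiv.finTwoArrow (α := Fin 3 → ℝ)
  have he₂ := volume_preserving_finTwoArrow (Fin 3 → ℝ)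
  let e := (e₁.trans MeasurableEquiv.prodComm).trans
    (e₂.prodCongr (MeasurableEquiv.refl (Fin 3 → ℝ)))
  have he : MeasurePreserving e volume volume :=
    (he₂.prod (MeasurePreserving.id volume)).comp (Measure.measurePreserving_swap.comp he₁)
  have hse : volume s = volume (e.symm ⁻¹' s) :=
    ((he.symm e).measure_preimage_equiv s).symm
  rw [hse]
  have hsym (p : ((Fin 3 → ℝ) × (Fin 3 → ℝ)) × (Fin 3 → ℝ)) : e.symm p = ![p.1.1, p.1.2, p.2] := by
    rw [MeasurableEquiv.symm_apply_eq]
    rfl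
  refine (lintegral_prod_le_of_section_le (c := 2) (hsm.preimage e.symm.measurable)
    measurableSet_siegelPairs ?_ ?_).trans_lt (ENNReal.mul_lt_top (by simp) volume_siegelPairs_lt_top)
  · rintro ⟨⟨x, y⟩, z⟩ h
    rw [Set.mem_preimage, hsym] at h
    obtain ⟨⟨h1, h2, h3, h4, h5⟩, h6, h7⟩ := h
    simp only [Matrix.cons_val] at h1 h2 h3 h4 h5 h6 h7
    refine ⟨?_, h1, h4, h5.trans ?_⟩
    · intro h0
      exact h6 (by simp only at h0; rw [h0]; simp [dot3])
    -- The determinant is less than 1 in absolute value, which frees the last Siegel inequality from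
    -- the third row.
    · have : dot3 z (cross3 x y) ^ 2 ≤ 1 := by
        rw [← sq_abs]; exact pow_le_one₀ (abs_nonneg _) h7.le
      nlinarith [dot3_self_nonneg x]
  · rintro ⟨x, y⟩ ⟨h0, -⟩
    refine (measure_mono fun z h => ?_).trans (volume_third_row_le x y h0)
    rw [Set.mem_preimage, Set.mem_preimage, hsym] at h
    exact ⟨h.1.2.1, h.1.2.2.1, h.2.2⟩

/-- A family of nonzero lattice vectors contains a shortest one. -/
lemma exists_shortest {ι : Type*} [Nonempty ι] (m : ι → Fin 3 → ℤ) (A : GL (Fin 3) ℝ) :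
    ∃ i, ∀ j, dot3 ((fun k => (m i k : ℝ)) ᵥ* A) ((fun k => (m i k : ℝ)) ᵥ* A) ≤
      dot3 ((fun k => (m j k : ℝ)) ᵥ* A) ((fun k => (m j k : ℝ)) ᵥ* A) := by
  let N : (Fin 3 → ℤ) → ℝ := fun n =>
    dot3 ((fun k => (n k : ℝ)) ᵥ* A) ((fun k => (n k : ℝ)) ᵥ* A)
  -- The coordinates are recovered from nA by applying A⁻¹, so Cauchy–Schwarz bounds them in terms
  -- of the length of nA.
  have hfin (R : ℝ) : {n : Fin 3 → ℤ | N n ≤ R}.Finite := by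
    let B := ((A⁻¹ : GL (Fin 3) ℝ) : Matrix (Fin 3) (Fin 3) ℝ)
    let C : Fin 3 → ℝ := fun k => R * dot3 (Bᵀ k) (Bᵀ k)
    refine (Set.finite_Icc (fun k => -⌈C k⌉) (fun k => ⌈C k⌉)).subset fun n hn => ?_
    have h (k : Fin 3) : |n k| ≤ ⌈C k⌉ := by
      have h1 : (n k : ℝ) = dot3 ((fun k => (n k : ℝ)) ᵥ* A) (Bᵀ k) := by
        have h2 : ((fun k => (n k : ℝ)) ᵥ* (A : Matrix (Fin 3) (Fin 3) ℝ)) ᵥ* B =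
            fun k => (n k : ℝ) := by
          rw [Matrix.vecMul_vecMul, ← Units.val_mul, mul_inv_cancel, Units.val_one, Matrix.vecMul_one]
        conv_lhs => rw [← congrFun h2 k]
        simp [Matrix.vecMul, dotProduct, Fin.sum_univ_three, dot3]
      have h3 : (n k : ℝ) ^ 2 ≤ C k := by
        rw [h1]
        exact (dot3_sq_le _ _).trans (mul_le_mul_of_nonneg_right hn (dot3_self_nonneg _))
      -- An integer is bounded by its square, so no square root of the bound is needed.
      have h4 : (|n k| : ℤ) ≤ n k ^ 2 := by
        rw [← sq_abs]
        exact Int.le_self_sq _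
      have h5 : ((|n k| : ℤ) : ℝ) ≤ ⌈C k⌉ :=
        le_trans (by exact_mod_cast h4) (h3.trans (Int.le_ceil _))
      exact_mod_cast h5
    exact ⟨fun k => (abs_le.1 (h k)).1, fun k => (abs_le.1 (h k)).2⟩
  obtain ⟨i₀⟩ := ‹Nonempty ι›
  have hf : (Set.range m ∩ {n | N n ≤ N (m i₀)}).Finite := (hfin _).subset Set.inter_subset_right
  obtain ⟨n, ⟨⟨i, rfl⟩, hi⟩, hmin⟩ := Set.exists_min_image _ N hf ⟨m i₀, ⟨i₀, rfl⟩, le_refl (N (m i₀))⟩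
  refine ⟨i, fun j => ?_⟩
  rcases le_total (N (m j)) (N (m i₀)) with h | h
  · exact hmin _ ⟨⟨j, rfl⟩, h⟩
  · exact le_trans hi h

/-- An integral matrix of determinant `±1` as an element of `GL_n(ℤ)`. -/
def intGL {n : ℕ} (A : Matrix (Fin n) (Fin n) ℤ) (h : A.det = 1 ∨ A.det = -1) : GL (Fin n) ℤ :=
  Matrix.GeneralLinearGroup.mk'' A (Int.isUnit_iff.2 h)

/-- The basis of a lattice obtained from the rows of `g` by an integral change of basis. -/
def latticeBasis (g : GL (Fin 3) ℝ) (γ : GL (Fin 3) ℤ) : Fin 3 → Fin 3 → ℝ :=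
  (Matrix.GeneralLinearGroup.map (Int.castRingHom ℝ) γ * g : GL (Fin 3) ℝ).val

lemma latticeBasis_apply (g : GL (Fin 3) ℝ) (γ : GL (Fin 3) ℤ) (i : Fin 3) :
    latticeBasis g γ i = (fun k => ((γ i k : ℤ) : ℝ)) ᵥ* (g : Matrix (Fin 3) (Fin 3) ℝ) := rfl

lemma latticeBasis_mul (g : GL (Fin 3) ℝ) (A : Matrix (Fin 3) (Fin 3) ℤ)
    (h : A.det = 1 ∨ A.det = -1) (γ : GL (Fin 3) ℤ) (i : Fin 3) :
    latticeBasis g (intGL A h * γ) i = (A i 0 : ℝ) • latticeBasis g γ 0 +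
      (A i 1 : ℝ) • latticeBasis g γ 1 + (A i 2 : ℝ) • latticeBasis g γ 2 := by
  have h1 : latticeBasis g (intGL A h * γ) =
      (A.map (Int.cast : ℤ → ℝ)) * Matrix.of (latticeBasis g γ) := by
    rw [latticeBasis, map_mul, mul_assoc, Units.val_mul]
    rfl
  rw [h1]
  funext j
  simp [Matrix.mul_apply, Fin.sum_univ_three]

lemma det_latticeBasis_ne_zero (g : GL (Fin 3) ℝ) (γ : GL (Fin 3) ℤ) :
    dot3 (latticeBasis g γ 2) (cross3 (latticeBasis g γ 0) (latticeBasis g γ 1)) ≠ 0 := by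
  have h := (Matrix.GeneralLinearGroup.map (Int.castRingHom ℝ) γ * g : GL (Fin 3) ℝ).det_ne_zero
  convert h using 1
  rw [Matrix.det_fin_three]
  simp only [latticeBasis, dot3, cross3, Matrix.cons_val]
  ring

/-- The matrix of cofactors. -/
def cofactor3 (g : GL (Fin 3) ℝ) : GL (Fin 3) ℝ :=
  Matrix.GeneralLinearGroup.mkOfDetNeZero
    (Matrix.of ![cross3 (g.val 1) (g.val 2), cross3 (g.val 2) (g.val 0),
      cross3 (g.val 0) (g.val 1)]) (by
    have h : (Matrix.of ![cross3 (g.val 1) (g.val 2), cross3 (g.val 2) (g.val 0),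
      cross3 (g.val 0) (g.val 1)]).det = g.val.det ^ 2 := by
      simp only [Matrix.det_fin_three, cross3, Matrix.of_apply, Matrix.cons_val]
      ring
    rw [h]
    exact pow_ne_zero _ g.det_ne_zero)

/-- Cross products of lattice vectors are integral combinations of the rows of the cofactor matrix.
Minimizing |b₀ × b₁| is therefore again a shortest vector problem in a lattice. -/
lemma cross3_latticeBasis (g : GL (Fin 3) ℝ) (γ : GL (Fin 3) ℤ) (i j : Fin 3) :
    cross3 (latticeBasis g γ i) (latticeBasis g γ j) =
      (fun k => ((cross3 (γ.val i) (γ.val j) k : ℤ) : ℝ)) ᵥ* (cofactor3 g).val := by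
  have hc : (cofactor3 g).val = Matrix.of ![cross3 (g.val 1) (g.val 2), cross3 (g.val 2) (g.val 0),
      cross3 (g.val 0) (g.val 1)] := rfl
  rw [latticeBasis_apply, latticeBasis_apply, hc]
  funext k
  fin_cases k <;>
    simp [Matrix.vecMul, dotProduct, Fin.sum_univ_three, cross3] <;> ring

/-- Every basis of `ℝ³` is equivalent under `GL₃(ℤ)` to a basis in the Siegel domain. -/
theorem exists_isSiegel (g : GL (Fin 3) ℝ) : ∃ γ : GL (Fin 3) ℤ, IsSiegel (latticeBasis g γ) := by
  -- First minimize |b₀| over all bases, then |b₀ × b₁| over the bases attaining that minimum.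
  obtain ⟨γ₀, h₀⟩ := exists_shortest (fun γ : GL (Fin 3) ℤ => γ.val 0) g
  simp only [← latticeBasis_apply] at h₀
  let T := {γ : GL (Fin 3) ℤ // ∀ δ, dot3 (latticeBasis g γ 0) (latticeBasis g γ 0) ≤
    dot3 (latticeBasis g δ 0) (latticeBasis g δ 0)}
  have : Nonempty T := ⟨⟨γ₀, h₀⟩⟩
  obtain ⟨⟨γ, h₁⟩, h₂⟩ :=
    exists_shortest (fun γ : T => cross3 (γ.1.val 0) (γ.1.val 1)) (cofactor3 g)
  simp only [← cross3_latticeBasis] at h₂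
  set x := latticeBasis g γ 0 with hx
  set y := latticeBasis g γ 1 with hy
  set z := latticeBasis g γ 2 with hz
  have hdet : dot3 z (cross3 x y) ≠ 0 := det_latticeBasis_ne_zero g γ
  have hxx : dot3 x x ≠ 0 := fun h => hdet (by
    rw [dot3_self_eq_zero h]; simp [dot3, cross3])
  have hww : dot3 (cross3 x y) (cross3 x y) ≠ 0 := fun h => hdet (by
    rw [dot3_self_eq_zero h]; simp [dot3])
  have hround (a b : ℝ) (hb : b ≠ 0) (hb' : 0 ≤ b) : 2 * |a - round (a / b) * b| ≤ b := by
    have h := abs_sub_round (a / b)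
    have h1 : a - round (a / b) * b = (a / b - round (a / b)) * b := by field_simp
    rw [h1, abs_mul, abs_of_nonneg hb']
    nlinarith
  -- Rounding makes the Gram–Schmidt coefficients at most 1/2. The coefficient of z along the second
  -- direction is treated before the one along x, because adding multiples of x leaves the former
  -- unchanged.
  let n : ℤ := -round (dot3 y x / dot3 x x)
  set y' := (n : ℝ) • x + y with hy'
  have hw' : cross3 x y' = cross3 x y := by
    rw [hy']; funext i; fin_cases i <;> simp [cross3] <;> ring
  set w := cross3 x y with hw
  let q : ℤ := -round (dot3 z (cross3 w x) / dot3 w w)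
  set z₁ := z + (q : ℝ) • y' with hz₁
  let p : ℤ := -round (dot3 z₁ x / dot3 x x)
  set z' := z₁ + (p : ℝ) • x with hz'
  have c1 : 2 * |dot3 y' x| ≤ dot3 x x := by
    have := hround (dot3 y x) (dot3 x x) hxx (dot3_self_nonneg x)
    convert this using 3
    simp [hy', n, dot3]; ring
  have c2 : 2 * |dot3 z' x| ≤ dot3 x x := by
    have := hround (dot3 z₁ x) (dot3 x x) hxx (dot3_self_nonneg x)
    convert this using 3
    simp [hz', p, dot3]; ring
  have c3 : 2 * |dot3 z' (cross3 w x)| ≤ dot3 w w := by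
    have := hround (dot3 z (cross3 w x)) (dot3 w w) hww (dot3_self_nonneg w)
    convert this using 3
    have e1 : dot3 z' (cross3 w x) = dot3 z (cross3 w x) + q * dot3 y' (cross3 w x) := by
      simp [hz', hz₁, dot3, cross3]; ring
    have e2 : dot3 y' (cross3 w x) = dot3 w (cross3 x y') := by
      simp [dot3, cross3]; ring
    rw [e1, e2, hw']
    simp only [q]; push_cast; ring
  -- A produces the reduced basis x, y', z'. A₁ gives a basis beginning with y', to compare |x| with
  -- |y'|. A₂ gives x, z', y', to compare |x × y'| with |x × z'|.
  let A : Matrix (Fin 3) (Fin 3) ℤ := !![1, 0, 0; n, 1, 0; q * n + p, q, 1]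
  let A₁ : Matrix (Fin 3) (Fin 3) ℤ := !![n, 1, 0; 1, 0, 0; 0, 0, 1]
  let A₂ : Matrix (Fin 3) (Fin 3) ℤ := !![1, 0, 0; q * n + p, q, 1; n, 1, 0]
  have hA : A.det = 1 ∨ A.det = -1 := by left; simp [A, Matrix.det_fin_three]
  have hA₁ : A₁.det = 1 ∨ A₁.det = -1 := by right; simp [A₁, Matrix.det_fin_three]
  have hA₂ : A₂.det = 1 ∨ A₂.det = -1 := by right; simp [A₂, Matrix.det_fin_three]
  have hzz : ((q * n + p : ℤ) : ℝ) • x + (q : ℝ) • y + z = z' := by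
    rw [hz', hz₁, hy']; push_cast; module
  have hb0 : latticeBasis g (intGL A hA * γ) 0 = x := by
    rw [latticeBasis_mul]; simp [A, hx]
  have hb1 : latticeBasis g (intGL A hA * γ) 1 = y' := by
    rw [latticeBasis_mul]; simp [A, hy', hx, hy]
  have hb2 : latticeBasis g (intGL A hA * γ) 2 = z' := by
    rw [latticeBasis_mul, ← hzz]; simp [A, hx, hy, hz]
  have hyx : dot3 x x ≤ dot3 y' y' := by
    have h := h₁ (intGL A₁ hA₁ * γ)
    have e : latticeBasis g (intGL A₁ hA₁ * γ) 0 = y' := by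
      rw [latticeBasis_mul]; simp [A₁, hy', hx, hy]
    rwa [e] at h
  have hzw : dot3 w w ≤ dot3 (cross3 x z') (cross3 x z') := by
    have e0 : latticeBasis g (intGL A₂ hA₂ * γ) 0 = x := by
      rw [latticeBasis_mul]; simp [A₂, hx]
    have e1 : latticeBasis g (intGL A₂ hA₂ * γ) 1 = z' := by
      rw [latticeBasis_mul, ← hzz]; simp [A₂, hx, hy, hz]
    have h := h₂ ⟨intGL A₂ hA₂ * γ, by rw [e0]; exact h₁⟩
    simp only [e0, e1] at h
    exact h
  refine ⟨intGL A hA * γ, ?_⟩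
  rw [IsSiegel, hb0, hb1, hb2, hw']
  refine ⟨c1, c2, c3, ?_, ?_⟩
  -- |w|² = |x|²|y'|² - (y'·x)², with |y'| ≥ |x| and |y'·x| ≤ |x|²/2; hence |w|² ≥ (3/4)|x|⁴.
  · have e : dot3 w w = dot3 x x * dot3 y' y' - dot3 y' x ^ 2 := by
      rw [← hw', dot3_cross3_self]
    have h1 : (2 * |dot3 y' x|) ^ 2 ≤ dot3 x x ^ 2 := by gcongr
    rw [mul_pow, sq_abs] at h1
    rw [e]
    nlinarith [dot3_self_nonneg x]
  -- The same estimate in the cofactor lattice, for w and x × z'. Their cross product is ±det · x,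
  -- and Lagrange's identity turns its square length into the left side here.
  · have e : dot3 w w * dot3 (cross3 x z') (cross3 x z') - dot3 z' (cross3 w x) ^ 2 =
        dot3 z' w ^ 2 * dot3 x x := by
      have e1 : dot3 z' (cross3 w x) = dot3 w (cross3 x z') := by
        simp [dot3, cross3]; ring
      have e2 : dot3 w (cross3 x z') = dot3 (cross3 x z') w := by simp [dot3]; ring
      rw [e1, e2, ← dot3_cross3_self, ← hw']
      simp [dot3, cross3]; ring
    have h1 : (2 * |dot3 z' (cross3 w x)|) ^ 2 ≤ dot3 w w ^ 2 := by gcongr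
    rw [mul_pow, sq_abs] at h1
    rw [mul_assoc, ← e]
    nlinarith [dot3_self_nonneg w]

open scoped Pointwise in
/-- A fundamental domain has measure at most that of any set whose translates cover. -/
lemma measure_fundamentalDomain_le {G α : Type*} [Group G] [Countable G] [MulAction G α]
    [MeasurableSpace α] [MeasurableConstSMul G α] {μ : Measure α} [SMulInvariantMeasure G α μ]
    {F S : Set α} (hF : IsFundamentalDomain G F μ) (hS : ∀ x, ∃ g : G, g • x ∈ S) : μ F ≤ μ S := by
  rw [hF.measure_eq_tsum' S]
  have : F ⊆ ⋃ g : G, g⁻¹ • S ∩ F := fun x hx => by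
    obtain ⟨g, hg⟩ := hS x
    exact Set.mem_iUnion.2 ⟨g, Set.mem_inv_smul_set_iff.2 hg, hx⟩
  refine (measure_mono this).trans ((measure_iUnion_le _).trans (le_of_eq ?_))
  refine tsum_congr fun g => ?_
  rw [← measure_smul μ g]
  simp [Set.smul_set_inter]

/-- The covolume of `GL₃(ℤ)` in `GL₃^{±1}(ℝ)` is finite. -/
theorem haarGLpm_three_lt_top {F : Set (GLpm 3)}
    (hF : IsFundamentalDomain ((GLInt 3).subgroupOf (GLpm 3)) F (haarGLpm 3)) :
    haarGLpm 3 F < ∞ := by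
  have hcont : Continuous fun g : GLpm 3 => (fun i j => g.1 i j : Fin 3 → Fin 3 → ℝ) :=
    continuous_pi fun i => continuous_pi fun j =>
      (Units.continuous_val.comp continuous_subtype_val).matrix_elem i j
  let S : Set (GLpm 3) := {g | IsSiegel fun i j => g.1 i j}
  have hS : MeasurableSet S := (isClosed_isSiegel.preimage hcont).measurableSet
  refine (measure_fundamentalDomain_le hF (S := S) fun g => ?_).trans_lt ?_
  · obtain ⟨γ, hγ⟩ := exists_isSiegel g.1
    have hγm : Matrix.GeneralLinearGroup.map (Int.castRingHom ℝ) γ ∈ GLInt 3 := ⟨γ, rfl⟩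
    exact ⟨⟨⟨_, GLInt_le_GLpm 3 hγm⟩, hγm⟩, hγ⟩
  · rw [haarGLpm_apply hS, lebesgueGL_apply]
    refine lt_of_le_of_lt (measure_mono ?_) volume_isSiegel_lt_top
    rintro _ ⟨g, ⟨hg, hd⟩, rfl⟩
    have hdet : dot3 (g.val 2) (cross3 (g.val 0) (g.val 1)) = g.val.det := by
      rw [Matrix.det_fin_three]
      simp only [dot3, cross3, Matrix.cons_val]
      ring
    refine ⟨?_, ?_⟩
    -- The rescaled matrix is Siegel by assumption, and homogeneity transfers this to g.
    · refine IsSiegel.of_smul (t := |g.val.det| ^ (-(1 / (3 : ℕ) : ℝ)))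
        (Real.rpow_pos_of_pos (abs_pos.2 (Matrix.GeneralLinearGroup.det_ne_zero g)) _) ?_
      have h := coe_unitDetHom g
      have h2 : IsSiegel (fun i j => (unitDetHom 3 g).val i j) := hg
      rw [h] at h2
      exact h2
    · rw [hdet]
      exact ⟨Matrix.GeneralLinearGroup.det_ne_zero g, hd⟩

/-! ### Shapes and the upper half plane -/

lemma S2.mk_eq_mk {a b : GL (Fin 2) ℝ} :
    S2.mk a = S2.mk b ↔ ∃ k ∈ GLInt 2, ∃ h ∈ GO2, b = k * a * h :=
  DoubleCoset.eq (GLInt 2) GO2 a b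

lemma S2.mk_mul_left {k : GL (Fin 2) ℝ} (hk : k ∈ GLInt 2) (g : GL (Fin 2) ℝ) :
    S2.mk (k * g) = S2.mk g :=
  (S2.mk_eq_mk.2 ⟨k, hk, 1, one_mem _, by simp⟩).symm

lemma S2.mk_mul_right {h : GL (Fin 2) ℝ} (hh : h ∈ GO2) (g : GL (Fin 2) ℝ) :
    S2.mk (g * h) = S2.mk g :=
  (S2.mk_eq_mk.2 ⟨1, one_mem _, h, hh, by simp⟩).symm

lemma S2.continuous_mk : Continuous S2.mk := continuous_coinduced_rng

instance : BorelSpace S2 := ⟨rfl⟩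

lemma coe_matrixOfPoint (z : ℍ) : (matrixOfPoint z : Matrix (Fin 2) (Fin 2) ℝ) =
    !![z.im, z.re; 0, 1] := rfl

lemma continuous_matrixOfPoint : Continuous matrixOfPoint := by
  rw [(isOpenEmbedding_val_GL 2).isInducing.continuous_iff]
  refine continuous_matrix fun i j => ?_
  have h1 := UpperHalfPlane.continuous_im
  have h2 := UpperHalfPlane.continuous_re
  fin_cases i <;> fin_cases j <;> simp [coe_matrixOfPoint] <;> fun_prop

/-- The absolute value appears because matrices of negative determinant act through complex
conjugation. -/
lemma coe_smul_I (g : GL (Fin 2) ℝ) :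
    ((g • UpperHalfPlane.I : ℍ) : ℂ) =
      ⟨(g 0 0 * g 1 0 + g 0 1 * g 1 1) / (g 1 0 ^ 2 + g 1 1 ^ 2),
        |g.val.det| / (g 1 0 ^ 2 + g 1 1 ^ 2)⟩ := by
  have hdet := Matrix.det_fin_two g.val
  apply Complex.ext
  · rw [UpperHalfPlane.coe_re, UpperHalfPlane.re_smul]
    simp [UpperHalfPlane.num, UpperHalfPlane.denom, Complex.div_re, Complex.normSq_apply]
    ring
  · rw [UpperHalfPlane.coe_im, UpperHalfPlane.im_smul_eq_div_normSq]
    simp [UpperHalfPlane.denom, Complex.normSq_apply]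
    ring

lemma sq_add_sq_pos (g : GL (Fin 2) ℝ) : 0 < g 1 0 ^ 2 + g 1 1 ^ 2 := by
  have h := Matrix.GeneralLinearGroup.det_ne_zero g
  rw [Matrix.det_fin_two] at h
  by_contra hlt
  have h0 : g 1 0 = 0 := by nlinarith [sq_nonneg (g 1 0), sq_nonneg (g 1 1)]
  have h1 : g 1 1 = 0 := by nlinarith [sq_nonneg (g 1 0), sq_nonneg (g 1 1)]
  exact h (by rw [h0, h1]; ring)

lemma matrixOfPoint_smul_I (z : ℍ) : matrixOfPoint z • UpperHalfPlane.I = z := by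
  apply UpperHalfPlane.ext_re_im
  · rw [← UpperHalfPlane.coe_re, coe_smul_I]
    simp [coe_matrixOfPoint]
  · rw [← UpperHalfPlane.coe_im, coe_smul_I]
    simp [coe_matrixOfPoint, abs_of_pos z.im_pos]

/-- Fixing i says that the rows are orthogonal and that |det| is the square length of the second
row. By Lagrange's identity the first row then has the same length. -/
lemma mem_GO2_of_smul_I {h : GL (Fin 2) ℝ} (hh : h • UpperHalfPlane.I = UpperHalfPlane.I) :
    h ∈ GO2 := by
  have h1 := congrArg UpperHalfPlane.coe hh
  rw [coe_smul_I, UpperHalfPlane.coe_I] at h1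
  have hp := sq_add_sq_pos h
  have hre := congrArg Complex.re h1
  have him := congrArg Complex.im h1
  simp only [Complex.I_re, Complex.I_im] at hre him
  rw [div_eq_iff hp.ne'] at hre him
  rw [zero_mul] at hre
  rw [one_mul] at him
  have hsq : h.val.det ^ 2 = (h 1 0 ^ 2 + h 1 1 ^ 2) ^ 2 := by rw [← him, sq_abs]
  rw [Matrix.det_fin_two] at hsq
  have hn : h 0 0 ^ 2 + h 0 1 ^ 2 = h 1 0 ^ 2 + h 1 1 ^ 2 := by
    have : (h 0 0 ^ 2 + h 0 1 ^ 2) * (h 1 0 ^ 2 + h 1 1 ^ 2) = (h 1 0 ^ 2 + h 1 1 ^ 2) ^ 2 := by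
      linear_combination hsq + (h 0 0 * h 1 0 + h 0 1 * h 1 1) * hre
    exact mul_right_cancel₀ hp.ne' (this.trans (sq _))
  refine ⟨_, hp, ?_⟩
  ext i j
  fin_cases i <;> fin_cases j <;>
    simp [Matrix.mul_apply, Fin.sum_univ_two]
  · linarith
  · linarith
  · linarith
  · ring

/-- The stabilizer of i lies in `GO2`, so the shape of g depends only on the point g • i. -/
lemma S2.mk_eq_mk_matrixOfPoint (g : GL (Fin 2) ℝ) :
    S2.mk g = S2.mk (matrixOfPoint (g • UpperHalfPlane.I)) := by
  set z := g • UpperHalfPlane.I with hz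
  have h : (matrixOfPoint z)⁻¹ * g ∈ GO2 := by
    apply mem_GO2_of_smul_I
    rw [mul_smul, ← hz, inv_smul_eq_iff, matrixOfPoint_smul_I]
  rw [← S2.mk_mul_right h (matrixOfPoint z), mul_inv_cancel_left]

/-! ### The modular group and the half of its fundamental domain -/

/-- The closure of the fundamental domain of `GL₂(ℤ)`. -/
def closedShapeDomain : Set ℍ := {z | 0 ≤ z.re ∧ z.re ≤ 1 / 2 ∧ 1 ≤ z.re ^ 2 + z.im ^ 2}

/-- The interior of the fundamental domain of `GL₂(ℤ)`. -/
def openShapeDomain : Set ℍ := {z | 0 < z.re ∧ z.re < 1 / 2 ∧ 1 < z.re ^ 2 + z.im ^ 2}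

lemma isClosed_closedShapeDomain : IsClosed closedShapeDomain := by
  have h1 := UpperHalfPlane.continuous_im
  have h2 := UpperHalfPlane.continuous_re
  simp only [closedShapeDomain, Set.ofPred_and]
  refine (isClosed_le ?_ ?_).inter ((isClosed_le ?_ ?_).inter (isClosed_le ?_ ?_)) <;> fun_prop

lemma isOpen_openShapeDomain : IsOpen openShapeDomain := by
  have h1 := UpperHalfPlane.continuous_im
  have h2 := UpperHalfPlane.continuous_re
  simp only [openShapeDomain, Set.ofPred_and]
  refine (isOpen_lt ?_ ?_).inter ((isOpen_lt ?_ ?_).inter (isOpen_lt ?_ ?_)) <;> fun_prop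

lemma openShapeDomain_subset_fdo : openShapeDomain ⊆ ModularGroup.fdo := by
  rintro z ⟨h1, h2, h3⟩
  refine ⟨?_, ?_⟩
  · rw [Complex.normSq_apply]; simpa [sq] using h3
  · rw [abs_of_pos h1]; exact h2

lemma J_mem_GLInt : UpperHalfPlane.J ∈ GLInt 2 :=
  mem_GLInt_iff.2 ⟨intGL !![-1, 0; 0, 1] (by right; simp), fun i j => by
    rw [UpperHalfPlane.val_J]
    fin_cases i <;> fin_cases j <;> simp [intGL]⟩

lemma J_smul_re (z : ℍ) : (UpperHalfPlane.J • z).re = -z.re := by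
  rw [← UpperHalfPlane.coe_re, UpperHalfPlane.coe_J_smul]; simp

lemma J_smul_im (z : ℍ) : (UpperHalfPlane.J • z).im = z.im := by
  rw [← UpperHalfPlane.coe_im, UpperHalfPlane.coe_J_smul]; simp

/-- The image of `SL₂(ℤ)` in `GL₂(ℝ)`. -/
def slToGL : Matrix.SpecialLinearGroup (Fin 2) ℤ →* GL (Fin 2) ℝ :=
  (Matrix.GeneralLinearGroup.map (Int.castRingHom ℝ)).comp Matrix.SpecialLinearGroup.toGL

lemma slToGL_mem (g : Matrix.SpecialLinearGroup (Fin 2) ℤ) : slToGL g ∈ GLInt 2 := ⟨_, rfl⟩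

lemma slToGL_smul (g : Matrix.SpecialLinearGroup (Fin 2) ℤ) (z : ℍ) : slToGL g • z = g • z := by
  rw [ModularGroup.sl_moeb]
  exact congrArg (· • z) (Units.ext rfl)

lemma exists_slToGL {g : GL (Fin 2) ℝ} (hg : g ∈ GLInt 2) (hd : g.val.det = 1) :
    ∃ γ, slToGL γ = g := by
  obtain ⟨γ, rfl⟩ := hg
  have h : ((Matrix.GeneralLinearGroup.map (Int.castRingHom ℝ) γ : GL (Fin 2) ℝ) :
      Matrix (Fin 2) (Fin 2) ℝ).det = (((γ : Matrix (Fin 2) (Fin 2) ℤ).det : ℤ) : ℝ) :=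
    (RingHom.map_det (Int.castRingHom ℝ) _).symm
  rw [h] at hd
  exact ⟨⟨γ.val, by exact_mod_cast hd⟩, Units.ext rfl⟩

/-- SL₂(ℤ) moves z into |Re z| ≤ 1/2, |z| ≥ 1; if the real part is negative, the reflection z ↦ -z̄
in GL₂(ℤ) makes it positive. -/
lemma exists_smul_mem_closedShapeDomain (z : ℍ) : ∃ γ ∈ GLInt 2, γ • z ∈ closedShapeDomain := by
  obtain ⟨γ, hγ⟩ := ModularGroup.exists_smul_mem_fd z
  rw [← slToGL_smul] at hγ
  set w := slToGL γ • z with hw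
  have h1 : 1 ≤ w.re ^ 2 + w.im ^ 2 := by
    have := hγ.1
    rw [Complex.normSq_apply] at this
    simpa [sq] using this
  have h2 := hγ.2
  rcases le_total 0 w.re with h | h
  · rw [abs_of_nonneg h] at h2
    exact ⟨_, slToGL_mem γ, h, h2, h1⟩
  · rw [abs_of_nonpos h] at h2
    refine ⟨UpperHalfPlane.J * slToGL γ, mul_mem J_mem_GLInt (slToGL_mem γ), ?_⟩
    rw [mul_smul, ← hw]
    refine ⟨?_, ?_, ?_⟩
    · rw [J_smul_re]; linarith
    · rw [J_smul_re]; linarith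
    · rw [J_smul_re, J_smul_im, neg_sq]; exact h1

lemma slToGL_neg_one : slToGL (-1) = -1 := by
  apply Units.ext
  ext i j
  fin_cases i <;> fin_cases j <;> simp [slToGL]

/-- Determinant 1 is the classical statement for SL₂(ℤ). For determinant -1 compose with the
reflection J: the product lies in SL₂(ℤ), keeps z in the open fundamental domain and so fixes z.
Then γz is the mirror image of z, and both cannot have positive real part. -/
lemma eq_one_or_neg_one_of_mem_openShapeDomain {γ : GL (Fin 2) ℝ} (hγ : γ ∈ GLInt 2) {z : ℍ}
    (hz : z ∈ openShapeDomain) (hγz : γ • z ∈ openShapeDomain) : γ = 1 ∨ γ = -1 := by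
  rcases GLInt_le_GLpm 2 hγ with hd | hd
  · obtain ⟨δ, rfl⟩ := exists_slToGL hγ hd
    rw [slToGL_smul] at hγz
    rcases ModularGroup.eq_one_or_neg_one_of_mem_fdo_mem_fdo (openShapeDomain_subset_fdo hz)
      (openShapeDomain_subset_fdo hγz) with rfl | rfl
    · left; exact map_one _
    · right; exact slToGL_neg_one
  · exfalso
    obtain ⟨δ, hδ⟩ := exists_slToGL (g := UpperHalfPlane.J * γ) (mul_mem J_mem_GLInt hγ) (by
      rw [Units.val_mul, Matrix.det_mul, hd, UpperHalfPlane.val_J]; simp)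
    have h1 : δ • z = UpperHalfPlane.J • γ • z := by rw [← slToGL_smul, hδ, mul_smul]
    have h2 : δ • z ∈ ModularGroup.fdo := by
      have h3 := openShapeDomain_subset_fdo hγz
      rw [h1]
      refine ⟨?_, ?_⟩
      · have := h3.1
        rw [Complex.normSq_apply] at this ⊢
        simpa [J_smul_re, J_smul_im] using this
      · have := h3.2
        rwa [J_smul_re, abs_neg]
    have h4 : δ • z = z := by
      rcases ModularGroup.eq_one_or_neg_one_of_mem_fdo_mem_fdo (openShapeDomain_subset_fdo hz) h2
        with rfl | rfl
      · exact one_smul _ z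
      · rw [ModularGroup.SL_neg_smul, one_smul]
    have h5 := congrArg UpperHalfPlane.re (h1.symm.trans h4)
    rw [J_smul_re] at h5
    linarith [hz.1, hγz.1]

/-! ### The push-forward of Haar measure to the upper half plane -/

/-- The half disc of radius `1 / √y`. -/
def halfDisc (y : ℝ) : Set (Fin 2 → ℝ) := {s | 0 ≤ s 0 ∧ y * (s 0 ^ 2 + s 1 ^ 2) < 1}

/-- The constant comparing Haar measure on `GL₂^{±1}(ℝ)` with hyperbolic measure. -/
def haarShapeConst : ℝ≥0∞ :=
  ∫⁻ s : Fin 2 → ℝ, (halfDisc 1).indicator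
    (fun s => ENNReal.ofReal (s 0 ^ 2 + s 1 ^ 2)) s

lemma measurableSet_halfDisc (y : ℝ) :
    MeasurableSet (halfDisc y) := by
  simp only [halfDisc, Set.ofPred_and]
  exact (isClosed_le (by fun_prop) (by fun_prop)).measurableSet.inter
    (isOpen_lt (by fun_prop) (by fun_prop)).measurableSet

lemma haarShapeConst_ne_zero : haarShapeConst ≠ 0 := by
  have hm := measurableSet_halfDisc 1
  rw [haarShapeConst, lintegral_indicator hm]
  rw [← pos_iff_ne_zero, setLIntegral_pos_iff (by fun_prop)]
  have ho : IsOpen {s : Fin 2 → ℝ | 0 < s 0 ∧ s 0 ^ 2 + s 1 ^ 2 < 1} := by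
    simp only [Set.ofPred_and]
    exact (isOpen_lt (by fun_prop) (by fun_prop)).inter (isOpen_lt (by fun_prop) (by fun_prop))
  refine lt_of_lt_of_le (ho.measure_pos volume ⟨![1 / 2, 0], by norm_num⟩) (measure_mono ?_)
  rintro s ⟨h1, h2⟩
  refine ⟨?_, h1.le, by rwa [one_mul]⟩
  simp only [Function.mem_support, ne_eq, ENNReal.ofReal_eq_zero, not_le]
  positivity

lemma haarShapeConst_lt_top : haarShapeConst < ∞ := by
  have hm := measurableSet_halfDisc 1
  rw [haarShapeConst, lintegral_indicator hm]
  refine lt_of_le_of_lt (setLIntegral_mono (g := fun _ => 1) measurable_const fun s hs => ?_) ?_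
  · simpa [halfDisc] using hs.2.le
  · rw [setLIntegral_one]
    refine lt_of_le_of_lt (measure_mono (t := Set.Icc (fun _ => -1) fun _ => 1) ?_)
      (isCompact_Icc (α := Fin 2 → ℝ)).measure_lt_top
    rintro s ⟨-, h⟩
    rw [one_mul] at h
    have (i : Fin 2) : |s i| ≤ 1 := by
      refine abs_le_of_sq_le_sq ?_ zero_le_one
      rw [one_pow]
      fin_cases i <;> simp only [Fin.zero_eta, Fin.mk_one] <;> nlinarith [sq_nonneg (s 0), sq_nonneg (s 1)]
    exact ⟨fun i => (abs_le.1 (this i)).1, fun i => (abs_le.1 (this i)).2⟩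

/-- Substituting s ↦ √y s gives one factor 1/y from the area and another from the integrand. This is
where the hyperbolic density 1/y² arises. -/
lemma lintegral_halfDisc {y : ℝ} (hy : 0 < y) :
    ∫⁻ s : Fin 2 → ℝ, (halfDisc y).indicator
      (fun s => ENNReal.ofReal (s 0 ^ 2 + s 1 ^ 2)) s =
        haarShapeConst * ENNReal.ofReal ((1 / y) ^ 2) := by
  set r := √y
  have hr : 0 < r := Real.sqrt_pos.2 hy
  have hr2 : r ^ 2 = y := Real.sq_sqrt hy.le
  have h := Measure.map_addHaar_smul (volume : Measure (Fin 2 → ℝ)) hr.ne'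
  have hm := measurableSet_halfDisc 1
  have hG : Measurable ((halfDisc 1).indicator
    (fun s => ENNReal.ofReal (s 0 ^ 2 + s 1 ^ 2))) := Measurable.indicator (by fun_prop) hm
  have h1 := congrArg (fun μ : Measure (Fin 2 → ℝ) => ∫⁻ s, (halfDisc 1).indicator (fun s => ENNReal.ofReal (s 0 ^ 2 + s 1 ^ 2)) s ∂μ) h
  simp only [lintegral_smul_measure] at h1
  rw [lintegral_map hG (by fun_prop)] at h1
  have h2 (s : Fin 2 → ℝ) : (halfDisc 1).indicator
      (fun s => ENNReal.ofReal (s 0 ^ 2 + s 1 ^ 2)) (r • s) = ENNReal.ofReal y *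
      (halfDisc y).indicator
      (fun s => ENNReal.ofReal (s 0 ^ 2 + s 1 ^ 2)) s := by
    have e : (r * s 0) ^ 2 + (r * s 1) ^ 2 = y * (s 0 ^ 2 + s 1 ^ 2) := by rw [← hr2]; ring
    have hiff : r • s ∈ halfDisc 1 ↔ s ∈ halfDisc y := by
      simp only [halfDisc, Set.mem_ofPred_eq, Pi.smul_apply, smul_eq_mul, e, one_mul,
        mul_nonneg_iff_of_pos_left hr]
    by_cases hs : s ∈ halfDisc y
    · rw [Set.indicator_of_mem (hiff.2 hs), Set.indicator_of_mem hs, ← ENNReal.ofReal_mul hy.le]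
      simp [e]
    · rw [Set.indicator_of_notMem (mt hiff.1 hs), Set.indicator_of_notMem hs, mul_zero]
  rw [lintegral_congr h2, lintegral_const_mul _ (Measurable.indicator (by fun_prop)
    (measurableSet_halfDisc y))] at h1
  have h3 : (ENNReal.ofReal y)⁻¹ * ENNReal.ofReal y = 1 :=
    ENNReal.inv_mul_cancel (by simpa using hy) ENNReal.ofReal_ne_top
  calc _ = (ENNReal.ofReal y)⁻¹ * (ENNReal.ofReal y * ∫⁻ s : Fin 2 → ℝ, (halfDisc y).indicator (fun s => ENNReal.ofReal (s 0 ^ 2 + s 1 ^ 2)) s) := by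
        rw [← mul_assoc, h3, one_mul]
    _ = _ := by
        rw [h1, smul_eq_mul, ← haarShapeConst, ← ENNReal.ofReal_inv_of_pos hy, ← mul_assoc,
          ← ENNReal.ofReal_mul (by positivity), mul_comm]
        congr 2
        rw [Module.finrank_fin_fun, hr2, abs_of_pos (by positivity)]
        ring

/-- The point `M • i` for an invertible matrix `M`, as a function of its entries. -/
def moebiusPoint (M : Fin 2 → Fin 2 → ℝ) : ℂ :=
  ⟨(M 0 0 * M 1 0 + M 0 1 * M 1 1) / (M 1 0 ^ 2 + M 1 1 ^ 2),
    |M 0 0 * M 1 1 - M 0 1 * M 1 0| / (M 1 0 ^ 2 + M 1 1 ^ 2)⟩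

lemma measurable_moebiusPoint : Measurable moebiusPoint := by
  refine Complex.measurableEquivRealProd.symm.measurable.comp
    (f := fun M : Fin 2 → Fin 2 → ℝ => ((M 0 0 * M 1 0 + M 0 1 * M 1 1) / (M 1 0 ^ 2 + M 1 1 ^ 2),
      |M 0 0 * M 1 1 - M 0 1 * M 1 0| / (M 1 0 ^ 2 + M 1 1 ^ 2))) ?_
  fun_prop

/-- The matrices `M` of small determinant and nonnegative lower left entry with `M • i ∈ E`. -/
def halfCone (E : Set ℂ) : Set (Fin 2 → Fin 2 → ℝ) :=
  {M | M 0 0 * M 1 1 - M 0 1 * M 1 0 ≠ 0 ∧ |M 0 0 * M 1 1 - M 0 1 * M 1 0| < 1 ∧ 0 ≤ M 1 0 ∧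
    moebiusPoint M ∈ E}

lemma measurableSet_halfCone {E : Set ℂ} (hE : MeasurableSet E) : MeasurableSet (halfCone E) := by
  simp only [halfCone, Set.ofPred_and]
  exact (isOpen_ne_fun (by fun_prop) (by fun_prop)).measurableSet.inter
    ((isOpen_lt (by fun_prop) (by fun_prop)).measurableSet.inter
      ((isClosed_le (by fun_prop) (by fun_prop)).measurableSet.inter (measurable_moebiusPoint hE)))

lemma volume_reflect {B : Set (Fin 2 → ℝ)} :
    volume {v : Fin 2 → ℝ | ![v 0, -v 1] ∈ B} = volume B := by
  let A : Matrix (Fin 2) (Fin 2) ℝ := !![1, 0; 0, -1]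
  have hdet : LinearMap.det (Matrix.toLin' A) = -1 := by
    rw [LinearMap.det_toLin', Matrix.det_fin_two]; simp [A]
  have h := Measure.addHaar_preimage_linearMap volume (f := Matrix.toLin' A) (by simp [hdet]) B
  rw [hdet] at h
  have hset : {v : Fin 2 → ℝ | ![v 0, -v 1] ∈ B} = Matrix.toLin' A ⁻¹' B := by
    ext v
    have : Matrix.toLin' A v = ![v 0, -v 1] := by
      funext i; fin_cases i <;> simp [A, Matrix.mulVec, dotProduct, Fin.sum_univ_two]
    rw [Set.mem_preimage, this]; rfl
  rw [hset, h]
  norm_num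

/-- For a fixed second row s, write the first row as v₀ s + v₁ s^⊥. Then M • i = v₀ + |v₁| i and det
M = v₁|s|², and the substitution has Jacobian |s|². The factor 2 counts the two signs of v₁. -/
lemma volume_halfCone_section {E : Set ℂ} (hE : MeasurableSet E) (hE0 : ∀ z ∈ E, 0 < z.im)
    (s : Fin 2 → ℝ) :
    volume {r : Fin 2 → ℝ | ![r, s] ∈ halfCone E} =
      ∫⁻ z in E, 2 * (halfDisc z.im).indicator (fun s => ENNReal.ofReal (s 0 ^ 2 + s 1 ^ 2)) s := by
  set ρ := s 0 ^ 2 + s 1 ^ 2 with hρ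
  by_cases hs : 0 ≤ s 0 ∧ 0 < ρ
  · obtain ⟨hs0, hρ0⟩ := hs
    set A := {r : Fin 2 → ℝ | ![r, s] ∈ halfCone E} with hA
    let L : Matrix (Fin 2) (Fin 2) ℝ := !![s 0, s 1; s 1, -s 0]
    have hdet : LinearMap.det (Matrix.toLin' L) = -ρ := by
      rw [LinearMap.det_toLin', Matrix.det_fin_two]; simp [L, hρ]; ring
    have hL := Measure.addHaar_preimage_linearMap volume (f := Matrix.toLin' L)
      (by rw [hdet]; exact neg_ne_zero.2 hρ0.ne') A
    have hLv (v : Fin 2 → ℝ) : Matrix.toLin' L v = ![v 0 * s 0 + v 1 * s 1, v 0 * s 1 - v 1 * s 0] := by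
      funext i
      fin_cases i <;> simp [L, Matrix.mulVec, dotProduct, Fin.sum_univ_two] <;> ring
    let B : Set (Fin 2 → ℝ) := {v | (⟨v 0, v 1⟩ : ℂ) ∈ E ∧ v 1 * ρ < 1}
    have hpi : ⇑Complex.measurableEquivPi.symm = fun v : Fin 2 → ℝ => (⟨v 0, v 1⟩ : ℂ) := by
      funext v
      rw [MeasurableEquiv.symm_apply_eq]
      funext i
      fin_cases i <;> rfl
    have hmk : Measurable fun v : Fin 2 → ℝ => (⟨v 0, v 1⟩ : ℂ) :=
      hpi ▸ Complex.measurableEquivPi.symm.measurable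
    have hB : MeasurableSet B := by
      simp only [B, Set.ofPred_and]
      exact (hmk hE).inter (isOpen_lt (by fun_prop) (by fun_prop)).measurableSet
    -- The two pieces are the matrices of positive and of negative determinant.
    have hset : Matrix.toLin' L ⁻¹' A = B ∪ {v | ![v 0, -v 1] ∈ B} := by
      ext v
      have e1 : (v 0 * s 0 + v 1 * s 1) * s 1 - (v 0 * s 1 - v 1 * s 0) * s 0 = v 1 * ρ := by
        rw [hρ]; ring
      have e2 : moebiusPoint ![![v 0 * s 0 + v 1 * s 1, v 0 * s 1 - v 1 * s 0], s] = ⟨v 0, |v 1|⟩ := by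
        simp only [moebiusPoint, Matrix.cons_val]
        rw [e1, ← hρ, abs_mul, abs_of_pos hρ0, mul_div_cancel_right₀ _ hρ0.ne']
        congr 1
        rw [div_eq_iff hρ0.ne', hρ]; ring
      rw [Set.mem_preimage, hLv]
      simp only [hA, halfCone, Set.mem_ofPred_eq, Matrix.cons_val, e2, e1, Set.mem_union, B, hs0,
        true_and, abs_mul, abs_of_pos hρ0]
      constructor
      · rintro ⟨-, h2, h3⟩
        rcases le_total 0 (v 1) with h | h
        · rw [abs_of_nonneg h] at h2 h3; exact Or.inl ⟨h3, h2⟩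
        · rw [abs_of_nonpos h] at h2 h3; exact Or.inr ⟨h3, h2⟩
      · rintro (⟨h1, h2⟩ | ⟨h1, h2⟩)
        · have h := hE0 _ h1
          simp only at h
          rw [abs_of_pos h]
          exact ⟨(mul_pos h hρ0).ne', h2, h1⟩
        · have h := hE0 _ h1
          simp only at h
          rw [abs_of_neg (by linarith)]
          exact ⟨mul_ne_zero (by linarith) hρ0.ne', h2, h1⟩
    have hdisj : Disjoint B {v | ![v 0, -v 1] ∈ B} := by
      rw [Set.disjoint_left]
      rintro v ⟨h1, -⟩ ⟨h2, -⟩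
      have h3 := hE0 _ h1
      have h4 := hE0 _ h2
      simp only [Matrix.cons_val] at h3 h4
      linarith
    have hBv : volume B = volume (E ∩ {z | z.im * ρ < 1}) := by
      have h := Complex.volume_preserving_equiv_pi.symm.measure_preimage_equiv
        (E ∩ {z | z.im * ρ < 1})
      rw [← h, hpi]
      rfl
    have hA2 : volume A = ENNReal.ofReal ρ * (2 * volume (E ∩ {z | z.im * ρ < 1})) := by
      have h1 : volume (Matrix.toLin' L ⁻¹' A) = 2 * volume (E ∩ {z | z.im * ρ < 1}) := by
        rw [hset, measure_union' hdisj hB, volume_reflect, hBv, two_mul]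
      rw [← h1, hL, hdet, ← mul_assoc, ← ENNReal.ofReal_mul hρ0.le, abs_inv, abs_neg,
        abs_of_pos hρ0, mul_inv_cancel₀ hρ0.ne', ENNReal.ofReal_one, one_mul]
    have hEm : MeasurableSet {z : ℂ | z.im * ρ < 1} :=
      (isOpen_lt (by fun_prop) (by fun_prop)).measurableSet
    rw [hA2]
    have hint (z : ℂ) : 2 * (halfDisc z.im).indicator
        (fun s => ENNReal.ofReal (s 0 ^ 2 + s 1 ^ 2)) s =
        {z : ℂ | z.im * ρ < 1}.indicator (fun _ => 2 * ENNReal.ofReal ρ) z := by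
      by_cases hz : z.im * ρ < 1
      · rw [Set.indicator_of_mem (show s ∈ halfDisc z.im from ⟨hs0, hz⟩),
          Set.indicator_of_mem (show z ∈ {z : ℂ | z.im * ρ < 1} from hz)]
      · rw [Set.indicator_of_notMem (fun h : s ∈ halfDisc z.im => hz h.2),
          Set.indicator_of_notMem (fun h : z ∈ {z : ℂ | z.im * ρ < 1} => hz h), mul_zero]
    rw [lintegral_congr hint, lintegral_indicator_const hEm, Measure.restrict_apply hEm,
      Set.inter_comm]
    ring
  -- Here s has negative first coordinate or is zero. Either no matrix qualifies or it would be
  -- singular, and the integrand on the right vanishes too.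
  · have hempty : {r : Fin 2 → ℝ | ![r, s] ∈ halfCone E} = ∅ := by
      refine Set.eq_empty_of_forall_notMem fun r hr => hs ⟨hr.2.2.1, ?_⟩
      by_contra hlt
      have h0 : s 0 = 0 := by nlinarith [sq_nonneg (s 0), sq_nonneg (s 1)]
      have h1 : s 1 = 0 := by nlinarith [sq_nonneg (s 0), sq_nonneg (s 1)]
      exact hr.1 (by simp [h0, h1])
    rw [hempty, measure_empty]
    symm
    rw [lintegral_eq_zero_of_ae_eq_zero]
    refine Filter.Eventually.of_forall fun z => ?_
    by_cases hz : s ∈ halfDisc z.im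
    · have : ρ = 0 := le_antisymm (not_lt.1 fun h => hs ⟨hz.1, h⟩) (by positivity)
      simp [Set.indicator_of_mem hz, ← hρ, this]
    · simp [Set.indicator_of_notMem hz]

/-- Integrate the section formula over s and exchange the integrals: for fixed z the integral over s
is `lintegral_halfDisc`. -/
theorem volume_halfCone {E : Set ℂ} (hE : MeasurableSet E) (hE0 : ∀ z ∈ E, 0 < z.im) :
    volume (halfCone E) =
      2 * haarShapeConst * ∫⁻ z in E, ENNReal.ofReal ((1 / z.im) ^ 2) := by
  have h1 : volume (halfCone E) = ∫⁻ s : Fin 2 → ℝ, volume {r : Fin 2 → ℝ | ![r, s] ∈ halfCone E} := by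
    have h := (volume_preserving_finTwoArrow (Fin 2 → ℝ)).symm.measure_preimage_equiv (halfCone E)
    rw [← h, Measure.volume_eq_prod, Measure.prod_apply_symm
      ((measurableSet_halfCone hE).preimage (MeasurableEquiv.measurable _))]
    rfl
  have hmeas : Measurable fun p : (Fin 2 → ℝ) × ℂ =>
      2 * (halfDisc p.2.im).indicator (fun s => ENNReal.ofReal (s 0 ^ 2 + s 1 ^ 2)) p.1 := by
    refine Measurable.const_mul ?_ _
    have hs : MeasurableSet {p : (Fin 2 → ℝ) × ℂ | p.1 ∈ halfDisc p.2.im} := by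
      simp only [halfDisc, Set.ofPred_and]
      exact (isClosed_le (by fun_prop) (by fun_prop)).measurableSet.inter
        (isOpen_lt (by fun_prop) (by fun_prop)).measurableSet
    exact Measurable.indicator (f := fun p : (Fin 2 → ℝ) × ℂ =>
      ENNReal.ofReal (p.1 0 ^ 2 + p.1 1 ^ 2)) (by fun_prop) hs
  rw [h1, lintegral_congr fun s => volume_halfCone_section hE hE0 s,
    lintegral_lintegral_swap hmeas.aemeasurable, ← lintegral_const_mul _ (by fun_prop)]
  refine setLIntegral_congr_fun hE fun z hz => ?_
  have hm : Measurable ((halfDisc z.im).indicator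
      fun s : Fin 2 → ℝ => ENNReal.ofReal (s 0 ^ 2 + s 1 ^ 2)) :=
    Measurable.indicator (by fun_prop) (measurableSet_halfDisc _)
  rw [lintegral_const_mul _ hm, lintegral_halfDisc (hE0 z hz), mul_assoc]

/-- The push-forward of Haar measure on half of `GL₂^{±1}(ℝ)` under `g ↦ g • i`. -/
theorem haarGLpm_two_apply {E : Set ℍ} (hE : MeasurableSet E) :
    haarGLpm 2 {g | 0 ≤ g.1 1 0 ∧ g.1 • UpperHalfPlane.I ∈ E} =
      2 * haarShapeConst * volume E := by
  have hcont : Continuous fun g : GLpm 2 => g.1 • UpperHalfPlane.I :=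
    continuous_subtype_val.smul continuous_const
  have hcont2 : Continuous fun g : GLpm 2 => g.1 1 0 :=
    (Units.continuous_val.comp continuous_subtype_val).matrix_elem 1 0
  have hm : MeasurableSet {g : GLpm 2 | 0 ≤ g.1 1 0 ∧ g.1 • UpperHalfPlane.I ∈ E} := by
    simp only [Set.ofPred_and]
    exact (isClosed_le continuous_const hcont2).measurableSet.inter (hcont.measurable hE)
  have hE' : MeasurableSet (UpperHalfPlane.coe '' E) :=
    UpperHalfPlane.measurableEmbedding_coe.measurableSet_image.2 hE
  have h0 : ∀ z ∈ UpperHalfPlane.coe '' E, 0 < z.im := by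
    rintro _ ⟨z, -, rfl⟩; exact z.im_pos
  rw [haarGLpm_apply hm, lebesgueGL_apply, UpperHalfPlane.volume_eq_lintegral]
  have hset : (Units.val : GL (Fin 2) ℝ → Matrix (Fin 2) (Fin 2) ℝ) ''
      (unitDet 2 ⁻¹' {g : GLpm 2 | 0 ≤ g.1 1 0 ∧ g.1 • UpperHalfPlane.I ∈ E} ∩ smallDet 2) =
      halfCone (UpperHalfPlane.coe '' E) := by
    -- Both conditions are invariant under positive scalars, so they describe the cone as well.
    have hN (g : GL (Fin 2) ℝ) : g ∈ unitDet 2 ⁻¹' {g : GLpm 2 | 0 ≤ g.1 1 0 ∧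
        g.1 • UpperHalfPlane.I ∈ E} ↔ 0 ≤ g 1 0 ∧ g • UpperHalfPlane.I ∈ E := by
      have h1 : (unitDet 2 g).1 1 0 = |g.val.det| ^ (-(1 / (2 : ℕ) : ℝ)) * g 1 0 :=
        congrFun (congrFun (coe_unitDetHom g) 1) 0
      have h2 : (unitDet 2 g).1 • UpperHalfPlane.I = g • UpperHalfPlane.I := by
        change (Matrix.GeneralLinearGroup.scalar (Fin 2) (rootInv 2 g.det) * g) • _ = _
        rw [mul_smul, UpperHalfPlane.glScalar_smul]
      rw [Set.mem_preimage, Set.mem_ofPred_eq, h1, h2, mul_nonneg_iff_of_pos_left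
        (Real.rpow_pos_of_pos (abs_pos.2 (Matrix.GeneralLinearGroup.det_ne_zero g)) _)]
    ext M
    constructor
    · rintro ⟨g, ⟨hg, hd⟩, rfl⟩
      rw [hN] at hg
      have hdet := Matrix.det_fin_two g.val
      refine ⟨?_, ?_, hg.1, ?_⟩
      · rw [← hdet]; exact Matrix.GeneralLinearGroup.det_ne_zero g
      · rw [← hdet]; exact hd
      · refine ⟨_, hg.2, ?_⟩
        rw [coe_smul_I, hdet]; rfl
    · rintro ⟨h1, h2, h3, w, hw, h4⟩
      have hdet := Matrix.det_fin_two (M : Matrix (Fin 2) (Fin 2) ℝ)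
      let g : GL (Fin 2) ℝ := Matrix.GeneralLinearGroup.mkOfDetNeZero M (by rw [hdet]; exact h1)
      refine ⟨g, ⟨(hN g).2 ⟨h3, ?_⟩, ?_⟩, rfl⟩
      · have : g • UpperHalfPlane.I = w := by
          apply UpperHalfPlane.ext
          rw [h4, coe_smul_I]
          have hg : g.val = M := rfl
          rw [hg, hdet]; rfl
        rwa [this]
      · change |Matrix.det M| < 1
        rw [hdet]; exact h2
  rw [hset]
  refine (volume_halfCone hE' h0).trans ?_
  congr 1
  refine setLIntegral_congr_fun hE' fun z hz => ?_
  have hz0 := h0 z hz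
  rw [ENNReal.ofReal, ENNReal.coe_inj]
  ext
  rw [Real.coe_toNNReal _ (by positivity)]
  simp

/-! ### The measure of the space of shapes -/

lemma volume_upperHalfPlane_eq_zero {E : Set ℍ} (h : volume (UpperHalfPlane.coe '' E) = 0) :
    volume E = 0 := by
  rw [UpperHalfPlane.volume_eq_lintegral, setLIntegral_measure_zero _ _ h]

lemma volume_re_eq (c : ℝ) : volume {z : ℍ | z.re = c} = 0 := by
  apply volume_upperHalfPlane_eq_zero
  refine measure_mono_null (t := Complex.measurableEquivRealProd ⁻¹' ({c} ×ˢ Set.univ)) ?_ ?_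
  · rintro _ ⟨z, hz, rfl⟩
    exact ⟨hz, trivial⟩
  · rw [Complex.volume_preserving_equiv_real_prod.measure_preimage_equiv, Measure.volume_eq_prod,
      Measure.prod_prod]
    simp

lemma volume_unit_circle : volume {z : ℍ | z.re ^ 2 + z.im ^ 2 = 1} = 0 := by
  apply volume_upperHalfPlane_eq_zero
  refine measure_mono_null (t := Metric.sphere 0 1) ?_ (Measure.addHaar_sphere _ _ _)
  rintro _ ⟨z, hz, rfl⟩
  rw [mem_sphere_zero_iff_norm, ← sq_eq_sq₀ (norm_nonneg _) zero_le_one, ← Complex.normSq_eq_norm_sq,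
    Complex.normSq_apply, one_pow, ← sq, ← sq]
  exact hz

lemma volume_closedShapeDomain_diff : volume (closedShapeDomain \ openShapeDomain) = 0 := by
  refine measure_mono_null (t := {z : ℍ | z.re = 0} ∪ ({z : ℍ | z.re = 1 / 2} ∪
    {z : ℍ | z.re ^ 2 + z.im ^ 2 = 1})) ?_
    (measure_union_null (volume_re_eq _) (measure_union_null (volume_re_eq _) volume_unit_circle))
  rintro z ⟨⟨h1, h2, h3⟩, h4⟩
  by_contra h
  simp only [Set.mem_union, Set.mem_ofPred_eq, not_or] at h
  exact h4 ⟨h1.lt_of_ne (Ne.symm h.1), h2.lt_of_ne h.2.1, h3.lt_of_ne (Ne.symm h.2.2)⟩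

lemma openShapeDomain_subset : openShapeDomain ⊆ shapeDomain :=
  fun _ ⟨h1, h2, h3⟩ => ⟨h1.le, h2, h3.le⟩

lemma shapeDomain_subset : shapeDomain ⊆ closedShapeDomain :=
  fun _ ⟨h1, h2, h3⟩ => ⟨h1, h2.le, h3⟩

lemma shapeDomain_ae_eq : shapeDomain =ᵐ[volume] closedShapeDomain := by
  refine (LE.le.eventuallyLE shapeDomain_subset).antisymm (ae_le_set.2 ?_)
  exact measure_mono_null (Set.sdiff_subset_sdiff_right openShapeDomain_subset)
    volume_closedShapeDomain_diff

lemma measurable_mk_matrixOfPoint : Measurable fun z : ℍ => S2.mk (matrixOfPoint z) :=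
  (S2.continuous_mk.comp continuous_matrixOfPoint).measurable

/-- The boundary is null, so the closed domain, for which the covering property holds, can replace
the half-open one. -/
lemma shapeMeasure_apply {W : Set S2} (hW : MeasurableSet W) :
    shapeMeasure W = volume (closedShapeDomain ∩ {z | S2.mk (matrixOfPoint z) ∈ W}) := by
  rw [shapeMeasure, Measure.map_apply measurable_mk_matrixOfPoint hW,
    Measure.restrict_congr_set shapeDomain_ae_eq,
    Measure.restrict_apply (measurable_mk_matrixOfPoint hW), Set.inter_comm]
  rfl

lemma shapeMeasure_univ : shapeMeasure Set.univ = volume closedShapeDomain := by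
  rw [shapeMeasure_apply MeasurableSet.univ]
  simp

lemma shapeMeasure_univ_pos : 0 < shapeMeasure Set.univ := by
  rw [shapeMeasure_univ]
  have hv : (UpperHalfPlane.coe '' openShapeDomain).Nonempty :=
    ⟨_, ⟨⟨1 / 4, 2⟩, by norm_num⟩, by norm_num [openShapeDomain], rfl⟩
  have ho := UpperHalfPlane.isOpenEmbedding_coe.isOpenMap _ isOpen_openShapeDomain
  refine lt_of_lt_of_le ?_ (measure_mono (openShapeDomain_subset.trans shapeDomain_subset))
  rw [UpperHalfPlane.volume_eq_lintegral, setLIntegral_pos_iff (by fun_prop)]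
  refine lt_of_lt_of_le (ho.measure_pos volume hv) (measure_mono ?_)
  intro z hz
  refine ⟨?_, hz⟩
  obtain ⟨w, -, rfl⟩ := hz
  have := w.im_ne_zero
  simp [this]

/-- From 0 ≤ x ≤ 1/2 and x² + y² ≥ 1 it follows that y > 1/2, and 1/y² is integrable on the strip of
width 1/2 above that height. -/
lemma shapeMeasure_univ_lt_top : shapeMeasure Set.univ < ∞ := by
  rw [shapeMeasure_univ, UpperHalfPlane.volume_eq_lintegral]
  let S : Set (ℝ × ℝ) := Set.Icc 0 (1 / 2) ×ˢ Set.Ioi (1 / 2)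
  have hsub : UpperHalfPlane.coe '' closedShapeDomain ⊆ Complex.measurableEquivRealProd ⁻¹' S := by
    rintro _ ⟨z, ⟨h1, h2, h3⟩, rfl⟩
    refine ⟨⟨h1, h2⟩, ?_⟩
    have := z.im_pos
    change 1 / 2 < z.im
    nlinarith
  refine (lintegral_mono_set hsub).trans_lt ?_
  have h := Complex.volume_preserving_equiv_real_prod.setLIntegral_comp_preimage_emb
    (MeasurableEquiv.measurableEmbedding _)
    (fun p : ℝ × ℝ => (((1 / ‖p.2‖₊) ^ 2 : NNReal) : ℝ≥0∞)) S
  refine h.trans_lt ?_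
  have hfin : ∫⁻ y in Set.Ioi (1 / 2 : ℝ), (((1 / ‖y‖₊) ^ 2 : NNReal) : ℝ≥0∞) < ∞ := by
    have hi := (integrableOn_Ioi_rpow_of_lt (a := -2) (by norm_num)
      (by norm_num : (0 : ℝ) < 1 / 2)).lintegral_lt_top
    refine lt_of_le_of_lt (setLIntegral_mono' measurableSet_Ioi fun y hy => ?_) hi
    have hy0 : 0 < y := lt_trans (by norm_num) (Set.mem_Ioi.1 hy)
    rw [ENNReal.ofReal, ENNReal.coe_le_coe, ← NNReal.coe_le_coe,
      Real.coe_toNNReal _ (by positivity)]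
    rw [Real.rpow_neg hy0.le]
    simp
  rw [Measure.volume_eq_prod, ← Measure.prod_restrict,
    lintegral_prod _ (by fun_prop)]
  dsimp only
  rw [lintegral_const]
  exact ENNReal.mul_lt_top hfin (by simp)

/-! ### A fundamental domain for GL₂(ℤ) lying over the space of shapes -/

/-- The fundamental domain of `GL₂(ℤ)` in `GL₂^{±1}(ℝ)` that lies over the fundamental domain in the
upper half plane. -/
def shapeFundamentalDomain : Set (GLpm 2) :=
  {g | 0 ≤ g.1 1 0 ∧ g.1 • UpperHalfPlane.I ∈ closedShapeDomain}

lemma continuous_smul_I : Continuous fun g : GLpm 2 => g.1 • UpperHalfPlane.I :=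
  continuous_subtype_val.smul continuous_const

lemma continuous_lowerLeft : Continuous fun g : GLpm 2 => g.1 1 0 :=
  (Units.continuous_val.comp continuous_subtype_val).matrix_elem 1 0

lemma measurableSet_shapeFundamentalDomain : MeasurableSet shapeFundamentalDomain := by
  simp only [shapeFundamentalDomain, Set.ofPred_and]
  exact (isClosed_le continuous_const continuous_lowerLeft).measurableSet.inter
    (continuous_smul_I.measurable isClosed_closedShapeDomain.measurableSet)

lemma haarGLpm_lowerLeft_eq_zero : haarGLpm 2 {g : GLpm 2 | g.1 1 0 = 0} = 0 := by
  have hm : MeasurableSet {g : GLpm 2 | g.1 1 0 = 0} :=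
    (isClosed_eq continuous_lowerLeft continuous_const).measurableSet
  rw [haarGLpm_apply hm, lebesgueGL_apply]
  let p : Submodule ℝ (Fin 2 → Fin 2 → ℝ) :=
    LinearMap.ker ((LinearMap.proj 0 : (Fin 2 → ℝ) →ₗ[ℝ] ℝ).comp
      (LinearMap.proj 1 : (Fin 2 → Fin 2 → ℝ) →ₗ[ℝ] Fin 2 → ℝ))
  have hp : p ≠ ⊤ := by
    intro h
    have h1 : (fun _ _ => 1 : Fin 2 → Fin 2 → ℝ) ∈ p := by rw [h]; trivial
    simp [p] at h1
  refine measure_mono_null ?_ (Measure.addHaar_submodule (volume : Measure (Fin 2 → Fin 2 → ℝ)) p hp)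
  rintro _ ⟨g, ⟨hg, -⟩, rfl⟩
  have h1 : (unitDet 2 g).1 1 0 = |g.val.det| ^ (-(1 / (2 : ℕ) : ℝ)) * g 1 0 :=
    congrFun (congrFun (coe_unitDetHom g) 1) 0
  have hg' : (unitDet 2 g).1 1 0 = 0 := hg
  rw [h1] at hg'
  exact (mul_eq_zero.1 hg').resolve_left
    (Real.rpow_pos_of_pos (abs_pos.2 (Matrix.GeneralLinearGroup.det_ne_zero g)) _).ne'

lemma neg_one_mem_GLInt : (-1 : GL (Fin 2) ℝ) ∈ GLInt 2 := slToGL_neg_one ▸ slToGL_mem (-1)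

open scoped Pointwise in
-- Since -1 acts trivially on the upper half plane, the sign of the lower left entry selects one of
-- ±g. The exceptional set N, where this entry is 0 or g • i is on the boundary, is null; off N,
-- uniqueness is `eq_one_or_neg_one_of_mem_openShapeDomain`.
theorem isFundamentalDomain_shapeFundamentalDomain :
    IsFundamentalDomain ((GLInt 2).subgroupOf (GLpm 2)) shapeFundamentalDomain (haarGLpm 2) := by
  set N : Set (GLpm 2) := {g | g.1 1 0 = 0} ∪
    {g | 0 ≤ g.1 1 0 ∧ g.1 • UpperHalfPlane.I ∈ closedShapeDomain \ openShapeDomain} with hN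
  have hN0 : haarGLpm 2 N = 0 := by
    refine measure_union_null haarGLpm_lowerLeft_eq_zero ?_
    rw [haarGLpm_two_apply (isClosed_closedShapeDomain.measurableSet.diff
      isOpen_openShapeDomain.measurableSet), volume_closedShapeDomain_diff, mul_zero]
  refine IsFundamentalDomain.mk'' measurableSet_shapeFundamentalDomain.nullMeasurableSet
    (Filter.Eventually.of_forall fun g => ?_) (fun η hη => ?_)
    fun η => (measurePreserving_smul η (haarGLpm 2)).quasiMeasurePreserving
  · obtain ⟨γ, hγ, h⟩ := exists_smul_mem_closedShapeDomain (g.1 • UpperHalfPlane.I)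
    rcases le_total 0 ((γ * g.1) 1 0) with h0 | h0
    · exact ⟨⟨⟨γ, GLInt_le_GLpm 2 hγ⟩, hγ⟩, h0, by rwa [smul_smul] at h⟩
    · have hγ' : -γ ∈ GLInt 2 := by
        rw [← neg_one_mul]; exact mul_mem neg_one_mem_GLInt hγ
      refine ⟨⟨⟨-γ, GLInt_le_GLpm 2 hγ'⟩, hγ'⟩, ?_, ?_⟩
      · change 0 ≤ (-γ * g.1) 1 0
        rw [neg_mul]
        simpa using h0
      · change (-γ * g.1) • UpperHalfPlane.I ∈ closedShapeDomain
        rw [neg_mul, UpperHalfPlane.neg_smul, mul_smul]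
        exact h
  · refine measure_mono_null (t := N ∪ η • N) ?_
      (measure_union_null hN0 (by rw [measure_smul, hN0]))
    rintro x ⟨⟨y, hy, rfl⟩, hx⟩
    by_contra hxN
    simp only [Set.mem_union, Set.smul_mem_smul_set_iff, not_or] at hxN
    obtain ⟨hxN, hyN⟩ := hxN
    have key (g : GLpm 2) (hg : g ∈ shapeFundamentalDomain) (hgN : g ∉ N) :
        0 < g.1 1 0 ∧ g.1 • UpperHalfPlane.I ∈ openShapeDomain := by
      simp only [hN, Set.mem_union, Set.mem_ofPred_eq, not_or, Set.mem_sdiff, not_and, not_not] at hgN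
      exact ⟨hg.1.lt_of_ne (Ne.symm hgN.1), hgN.2 hg.1 hg.2⟩
    obtain ⟨hx0, hxo⟩ := key _ hx hxN
    obtain ⟨hy0, hyo⟩ := key _ hy hyN
    have he : (η • y).1 = η.1.1 * y.1 := rfl
    dsimp only at hx0 hxo
    rw [he, mul_smul] at hxo
    rw [he] at hx0
    rcases eq_one_or_neg_one_of_mem_openShapeDomain η.2 hyo hxo with h | h
    · exact hη (Subtype.ext (Subtype.ext h))
    · have h' : η.1.1 = -1 := h
      rw [h', neg_one_mul] at hx0
      have : (-y.1 : GL (Fin 2) ℝ) 1 0 = -(y.1 1 0) := rfl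
      linarith

/-- The Haar measure of the part of a fundamental domain of `GL₂(ℤ)` with shapes in `W`. -/
theorem haarGLpm_two_shape {F : Set (GLpm 2)} (hFm : MeasurableSet F)
    (hF : ∀ g : GLpm 2, ∃! γ : (GLInt 2).subgroupOf (GLpm 2), γ • g ∈ F) {k : GL (Fin 2) ℝ}
    (hk : k ∈ GLInt 2) {W : Set S2} (hW : MeasurableSet W) :
    haarGLpm 2 (F ∩ {g | S2.mk (g.1 * k) ∈ W}) = 2 * haarShapeConst * shapeMeasure W := by
  let κ : GLpm 2 := ⟨k, GLInt_le_GLpm 2 hk⟩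
  set A : Set (GLpm 2) := {g | S2.mk g.1 ∈ W} with hA
  have hAm : MeasurableSet A := (S2.continuous_mk.comp continuous_subtype_val).measurable hW
  -- Right translation commutes with the left action, so F' = Fκ is again a fundamental domain, and
  -- right invariance of Haar measure removes k.
  let F' : Set (GLpm 2) := (· * κ⁻¹) ⁻¹' F
  have hF'm : MeasurableSet F' := (measurable_mul_const κ⁻¹) hFm
  have hF' : IsFundamentalDomain ((GLInt 2).subgroupOf (GLpm 2)) F' (haarGLpm 2) :=
    IsFundamentalDomain.mk' hF'm.nullMeasurableSet fun g => by
      obtain ⟨γ, h1, h2⟩ := hF (g * κ⁻¹)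
      refine ⟨γ, ?_, fun δ hδ => h2 δ ?_⟩
      · simpa [F', Subgroup.smul_def, mul_assoc] using h1
      · simpa [F', Subgroup.smul_def, mul_assoc] using hδ
  have h1 : F ∩ {g : GLpm 2 | S2.mk (g.1 * k) ∈ W} = (· * κ) ⁻¹' (A ∩ F') := by
    ext g
    simp only [Set.mem_inter_iff, Set.mem_preimage, F', hA, Set.mem_ofPred_eq, mul_inv_cancel_right]
    exact and_comm
  -- A is GL₂(ℤ)-invariant, so its part in F' has the same measure as its part in the explicit
  -- domain.
  rw [h1, measure_preimage_mul_right, hF'.measure_set_eq isFundamentalDomain_shapeFundamentalDomain hAm]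
  · rw [shapeMeasure_apply hW, ← haarGLpm_two_apply
      (E := closedShapeDomain ∩ {z | S2.mk (matrixOfPoint z) ∈ W})
      (isClosed_closedShapeDomain.measurableSet.inter (measurable_mk_matrixOfPoint hW))]
    congr 1
    ext g
    simp only [hA, shapeFundamentalDomain, Set.mem_inter_iff, Set.mem_ofPred_eq,
      S2.mk_eq_mk_matrixOfPoint g.1]
    tauto
  · intro γ
    ext g
    change S2.mk (γ.1.1 * g.1) ∈ W ↔ S2.mk g.1 ∈ W
    have h : γ.1.1 ∈ GLInt 2 := γ.2
    rw [S2.mk_mul_left h]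

/-! ### Trace form, changes of variables and Gram matrices of cubic rings -/

namespace CubicRing

section General

variable {T : Type*} [CommRing T]

/-- The basis `1, ω, θ` of a cubic ring. -/
def basis (f : Cubic T) : Module.Basis (Fin 3) T (CubicRing f) :=
  Module.Basis.ofEquivFun
    { toFun := fun u => ![u.c0, u.c1, u.c2]
      invFun := fun w => ⟨w 0, w 1, w 2⟩
      map_add' := fun u w => by ext i; fin_cases i <;> rfl
      map_smul' := fun t u => by ext i; fin_cases i <;> rfl
      left_inv := fun u => rfl
      right_inv := fun w => by ext i; fin_cases i <;> rfl }

instance (f : Cubic T) : Module.Finite T (CubicRing f) := Module.Finite.of_basis (basis f)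

instance (f : Cubic T) : Module.Free T (CubicRing f) := Module.Free.of_basis (basis f)

variable {f : Cubic T}

lemma basis_repr (u : CubicRing f) (i : Fin 3) : (basis f).repr u i = ![u.c0, u.c1, u.c2] i := rfl

lemma basis_apply (i : Fin 3) :
    basis f i = ![(⟨1, 0, 0⟩ : CubicRing f), ⟨0, 1, 0⟩, ⟨0, 0, 1⟩] i := by
  apply (basis f).repr.injective
  ext j
  rw [Module.Basis.repr_self, basis_repr]
  fin_cases i <;> fin_cases j <;> simp

lemma trace_apply (u : CubicRing f) :
    Algebra.trace T (CubicRing f) u = 3 * u.c0 + f.b * u.c1 - f.c * u.c2 := by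
  rw [Algebra.trace_eq_matrix_trace (basis f), Matrix.trace_fin_three]
  simp only [Algebra.leftMulMatrix_eq_repr_mul, basis_repr, basis_apply]
  simp
  ring

@[simp] lemma c0_algebraMap (t : T) : (algebraMap T (CubicRing f) t).c0 = t := rfl
@[simp] lemma c1_algebraMap (t : T) : (algebraMap T (CubicRing f) t).c1 = 0 := rfl
@[simp] lemma c2_algebraMap (t : T) : (algebraMap T (CubicRing f) t).c2 = 0 := rfl

lemma perp_add (u w : CubicRing f) : perp (u + w) = perp u + perp w := by
  simp only [perp, map_add, smul_add]
  abel

lemma perp_smul (t : T) (u : CubicRing f) : perp (t • u) = t • perp u := by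
  ext <;> simp [perp, sub_eq_add_neg] <;> ring

lemma perp_algebraMap (t : T) : perp (algebraMap T (CubicRing f) t) = 0 := by
  ext <;> simp [perp, sub_eq_add_neg, trace_apply]

lemma perp_map {f' : Cubic T} (e : CubicRing f' ≃ₐ[T] CubicRing f) (u : CubicRing f') :
    e (perp u) = perp (e u) := by
  simp [perp, Algebra.trace_eq_of_algEquiv]

/-- An element in the radical of the trace form of a cubic ring is killed by the discriminant. -/
lemma discr_smul_eq_zero {u : CubicRing f}
    (hu : ∀ w, Algebra.trace T (CubicRing f) (u * w) = 0) : f.discr • u = 0 := by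
  have h0 := hu 1
  have h1 := hu ⟨0, 1, 0⟩
  have h2 := hu ⟨0, 0, 1⟩
  simp only [trace_apply, c0_mul, c1_mul, c2_mul, c0_one, c1_one, c2_one] at h0 h1 h2
  -- The coefficients are the rows of the adjugate of the Gram matrix of the trace form in the basis
  -- 1, ω, θ; its determinant is the discriminant.
  ext
  · simp only [c0_smul, c0_zero, Cubic.discr]
    linear_combination
      ((f.b ^ 2 - 2 * f.a * f.c) * (f.c ^ 2 - 2 * f.b * f.d) - 9 * f.a ^ 2 * f.d ^ 2) * h0
      - (f.b * (f.c ^ 2 - 2 * f.b * f.d) - 3 * f.a * f.c * f.d) * h1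
      + (-3 * f.a * f.b * f.d + f.c * (f.b ^ 2 - 2 * f.a * f.c)) * h2
  · simp only [c1_smul, c1_zero, Cubic.discr]
    linear_combination
      -(f.b * (f.c ^ 2 - 2 * f.b * f.d) - 3 * f.a * f.c * f.d) * h0
      + (3 * (f.c ^ 2 - 2 * f.b * f.d) - f.c ^ 2) * h1
      - (-9 * f.a * f.d + f.b * f.c) * h2
  · simp only [c2_smul, c2_zero, Cubic.discr]
    linear_combination
      (-3 * f.a * f.b * f.d + f.c * (f.b ^ 2 - 2 * f.a * f.c)) * h0
      - (-9 * f.a * f.d + f.b * f.c) * h1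
      + (3 * (f.b ^ 2 - 2 * f.a * f.c) - f.b ^ 2) * h2

/-- The binary cubic form `l f(r x + t y, s x + u y)` for `γ = (r, s; t, u)`. -/
def twist (l : T) (γ : Matrix (Fin 2) (Fin 2) T) (f : Cubic T) : Cubic T where
  a := l * (f.a * γ 0 0 ^ 3 + f.b * γ 0 0 ^ 2 * γ 0 1 + f.c * γ 0 0 * γ 0 1 ^ 2 + f.d * γ 0 1 ^ 3)
  b := l * (3 * f.a * γ 0 0 ^ 2 * γ 1 0 + f.b * (γ 0 0 ^ 2 * γ 1 1 + 2 * γ 0 0 * γ 1 0 * γ 0 1)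
    + f.c * (2 * γ 0 0 * γ 0 1 * γ 1 1 + γ 1 0 * γ 0 1 ^ 2) + 3 * f.d * γ 0 1 ^ 2 * γ 1 1)
  c := l * (3 * f.a * γ 0 0 * γ 1 0 ^ 2 + f.b * (2 * γ 0 0 * γ 1 0 * γ 1 1 + γ 1 0 ^ 2 * γ 0 1)
    + f.c * (γ 0 0 * γ 1 1 ^ 2 + 2 * γ 1 0 * γ 0 1 * γ 1 1) + 3 * f.d * γ 0 1 * γ 1 1 ^ 2)
  d := l * (f.a * γ 1 0 ^ 3 + f.b * γ 1 0 ^ 2 * γ 1 1 + f.c * γ 1 0 * γ 1 1 ^ 2 + f.d * γ 1 1 ^ 3)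

lemma discr_twist (l : T) (γ : Matrix (Fin 2) (Fin 2) T) (f : Cubic T) :
    (twist l γ f).discr = l ^ 4 * γ.det ^ 6 * f.discr := by
  simp only [Cubic.discr, twist, Matrix.det_fin_two]
  ring

/-- The linear map of cubic rings induced by a linear change of variables. -/
def twistLin (l : T) (γ : Matrix (Fin 2) (Fin 2) T) (f : Cubic T) :
    CubicRing (twist l γ f) →ₗ[T] CubicRing f where
  -- The scalar terms are the translations after which the images of ω and θ have a scalar product,
  -- as a normal basis must.
  toFun w :=
    ⟨w.c0 + w.c1 * (l * (γ 0 0 ^ 2 * γ 1 0 * f.a + γ 0 0 * γ 0 1 * γ 1 0 * f.b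
          + γ 0 0 * γ 0 1 * γ 1 1 * f.c + γ 0 1 ^ 2 * γ 1 1 * f.d))
        - w.c2 * (l * (γ 0 0 * γ 1 0 ^ 2 * f.a + γ 0 0 * γ 1 0 * γ 1 1 * f.b
          + γ 0 1 * γ 1 0 * γ 1 1 * f.c + γ 0 1 * γ 1 1 ^ 2 * f.d)),
      l * γ.det * (γ 0 0 * w.c1 + γ 1 0 * w.c2),
      l * γ.det * (γ 0 1 * w.c1 + γ 1 1 * w.c2)⟩
  map_add' u w := by ext <;> simp <;> ring
  map_smul' t u := by ext <;> simp <;> ring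

section

variable (l : T) (γ : Matrix (Fin 2) (Fin 2) T) (f : Cubic T) (w : CubicRing (twist l γ f))

lemma c0_twistLin : (twistLin l γ f w).c0 =
    w.c0 + w.c1 * (l * (γ 0 0 ^ 2 * γ 1 0 * f.a + γ 0 0 * γ 0 1 * γ 1 0 * f.b
          + γ 0 0 * γ 0 1 * γ 1 1 * f.c + γ 0 1 ^ 2 * γ 1 1 * f.d))
        - w.c2 * (l * (γ 0 0 * γ 1 0 ^ 2 * f.a + γ 0 0 * γ 1 0 * γ 1 1 * f.b
          + γ 0 1 * γ 1 0 * γ 1 1 * f.c + γ 0 1 * γ 1 1 ^ 2 * f.d)) := rfl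

lemma c1_twistLin : (twistLin l γ f w).c1 = l * γ.det * (γ 0 0 * w.c1 + γ 1 0 * w.c2) := rfl

lemma c2_twistLin : (twistLin l γ f w).c2 = l * γ.det * (γ 0 1 * w.c1 + γ 1 1 * w.c2) := rfl

end

lemma twistLin_mul (l : T) (γ : Matrix (Fin 2) (Fin 2) T) (f : Cubic T)
    (u w : CubicRing (twist l γ f)) :
    twistLin l γ f (u * w) = twistLin l γ f u * twistLin l γ f w := by
  ext
  · simp only [c0_twistLin, c1_twistLin, c2_twistLin, c0_mul, c1_mul, c2_mul]
    simp only [twist, Matrix.det_fin_two]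
    ring
  · simp only [c0_twistLin, c1_twistLin, c2_twistLin, c1_mul, c2_mul]
    simp only [twist, Matrix.det_fin_two]
    ring
  · simp only [c0_twistLin, c1_twistLin, c2_twistLin, c1_mul, c2_mul]
    simp only [twist, Matrix.det_fin_two]
    ring

/-- The homomorphism of cubic rings induced by a linear change of variables. -/
def twistHom (l : T) (γ : Matrix (Fin 2) (Fin 2) T) (f : Cubic T) :
    CubicRing (twist l γ f) →ₐ[T] CubicRing f :=
  AlgHom.ofLinearMap (twistLin l γ f)
    (by ext <;> simp [twistLin]) (twistLin_mul l γ f)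

lemma c1_twistHom (l : T) (γ : Matrix (Fin 2) (Fin 2) T) (f : Cubic T)
    (w : CubicRing (twist l γ f)) :
    (twistHom l γ f w).c1 = l * γ.det * (γ 0 0 * w.c1 + γ 1 0 * w.c2) := rfl

lemma c2_twistHom (l : T) (γ : Matrix (Fin 2) (Fin 2) T) (f : Cubic T)
    (w : CubicRing (twist l γ f)) :
    (twistHom l γ f w).c2 = l * γ.det * (γ 0 1 * w.c1 + γ 1 1 * w.c2) := rfl

/-- The projection α ↦ α^⊥ kills the scalar translations, so the projected basis transforms purely
linearly. -/
lemma perp_twistHom_gen (l : T) (γ : Matrix (Fin 2) (Fin 2) T) (f : Cubic T) (i : Fin 2) :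
    perp (twistHom l γ f (gen _ i))
      = (l * γ.det) • (γ i 0 • perp (gen f 0) + γ i 1 • perp (gen f 1)) := by
  have h : twistHom l γ f (gen _ i) = algebraMap T _ (twistHom l γ f (gen _ i)).c0
      + (l * γ.det) • (γ i 0 • gen f 0 + γ i 1 • gen f 1) := by
    ext
    · simp [gen]
    · fin_cases i <;> simp [c1_twistHom, gen]
    · fin_cases i <;> simp [c2_twistHom, gen]
  rw [h, perp_add, perp_algebraMap, zero_add, perp_smul, perp_add, perp_smul, perp_smul]

end General

section Field

variable {K : Type*} [Field K]

lemma twistHom_injective {l : K} (hl : l ≠ 0) {γ : Matrix (Fin 2) (Fin 2) K} (hγ : γ.det ≠ 0)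
    (f : Cubic K) : Function.Injective (twistHom l γ f) := by
  rw [injective_iff_map_eq_zero]
  intro w hw
  have h1 := congrArg c1 hw
  have h2 := congrArg c2 hw
  have h0 := congrArg c0 hw
  rw [c1_twistHom, c1_zero, mul_eq_zero, or_iff_right (mul_ne_zero hl hγ)] at h1
  rw [c2_twistHom, c2_zero, mul_eq_zero, or_iff_right (mul_ne_zero hl hγ)] at h2
  have hd : γ 0 0 * γ 1 1 - γ 0 1 * γ 1 0 ≠ 0 := by rwa [Matrix.det_fin_two] at hγ
  have e1 : w.c1 = 0 := (mul_eq_zero.1 (show (γ 0 0 * γ 1 1 - γ 0 1 * γ 1 0) * w.c1 = 0 by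
    linear_combination γ 1 1 * h1 - γ 1 0 * h2)).resolve_left hd
  have e2 : w.c2 = 0 := (mul_eq_zero.1 (show (γ 0 0 * γ 1 1 - γ 0 1 * γ 1 0) * w.c2 = 0 by
    linear_combination γ 0 0 * h2 - γ 0 1 * h1)).resolve_left hd
  refine CubicRing.ext ?_ e1 e2
  simpa [twistHom, c0_twistLin, e1, e2] using h0

/-- An invertible change of variables induces an isomorphism of cubic rings. -/
def twistEquiv {l : K} (hl : l ≠ 0) {γ : Matrix (Fin 2) (Fin 2) K} (hγ : γ.det ≠ 0)
    (f : Cubic K) : CubicRing (twist l γ f) ≃ₐ[K] CubicRing f :=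
  AlgEquiv.ofBijective (twistHom l γ f) ⟨twistHom_injective hl hγ f,
    (LinearMap.injective_iff_surjective_of_finrank_eq_finrank (f := (twistHom l γ f).toLinearMap)
      (by rw [Module.finrank_eq_card_basis (basis _), Module.finrank_eq_card_basis (basis _)])).1
      (twistHom_injective hl hγ f)⟩

/-- Elements killed by all homomorphisms to an algebraically closed field are nilpotent. -/
lemma isNilpotent_of_forall_algHom {L : Type*} [Field L] [IsAlgClosed L] [Algebra K L]
    {f : Cubic K} {u : CubicRing f} (hu : ∀ σ : CubicRing f →ₐ[K] L, σ u = 0) :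
    IsNilpotent u := by
  rw [nilpotent_iff_mem_prime]
  intro J hJ
  -- The quotient by a prime is a domain algebraic over K, hence a field, and embeds in L.
  have : Algebra.IsAlgebraic K (CubicRing f ⧸ J) := inferInstance
  let τ : CubicRing f ⧸ J →ₐ[K] L := IsAlgClosed.lift
  have hF : IsField (CubicRing f ⧸ J) :=
    isField_of_isIntegral_of_isField' (Field.toIsField K)
  let _ := hF.toField
  have h := hu (τ.comp (Ideal.Quotient.mkₐ K J))
  have h1 : τ (Ideal.Quotient.mkₐ K J u) = 0 := h
  exact Ideal.Quotient.eq_zero_iff_mem.1 ((map_eq_zero_iff τ τ.toRingHom.injective).1 h1)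

/-- Such a u is nilpotent, so all traces tr(uw) vanish, and u lies in the radical of a trace form
that is nondegenerate when the discriminant is nonzero. This makes the Minkowski form definite. -/
lemma eq_zero_of_forall_algHom {L : Type*} [Field L] [IsAlgClosed L] [Algebra K L]
    {f : Cubic K} (hf : f.discr ≠ 0) {u : CubicRing f}
    (hu : ∀ σ : CubicRing f →ₐ[K] L, σ u = 0) : u = 0 := by
  refine (smul_eq_zero.1 (discr_smul_eq_zero (u := u) fun w => ?_)).resolve_left hf
  exact (Algebra.isNilpotent_trace_of_isNilpotent
    ((Commute.all u w).isNilpotent_mul_right (isNilpotent_of_forall_algHom hu))).eq_zero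

end Field

section Real

variable {f f' : Cubic ℝ}

lemma minkowskiInner_eq_sum [Fintype (CubicRing f →ₐ[ℝ] ℂ)] (u w : CubicRing f) :
    minkowskiInner u w = ∑ σ : CubicRing f →ₐ[ℝ] ℂ, (σ u * (starRingEnd ℂ) (σ w)).re := by
  rw [minkowskiInner, finsum_eq_sum_of_fintype, Complex.re_sum]

lemma minkowskiInner_comm (u w : CubicRing f) : minkowskiInner u w = minkowskiInner w u := by
  have := Fintype.ofFinite (CubicRing f →ₐ[ℝ] ℂ)
  simp only [minkowskiInner_eq_sum]
  refine Finset.sum_congr rfl fun σ _ => ?_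
  simp
  ring

lemma minkowskiInner_add_left (u u' w : CubicRing f) :
    minkowskiInner (u + u') w = minkowskiInner u w + minkowskiInner u' w := by
  have := Fintype.ofFinite (CubicRing f →ₐ[ℝ] ℂ)
  simp only [minkowskiInner_eq_sum, ← Finset.sum_add_distrib]
  refine Finset.sum_congr rfl fun σ _ => ?_
  simp
  ring

lemma minkowskiInner_smul_left (t : ℝ) (u w : CubicRing f) :
    minkowskiInner (t • u) w = t * minkowskiInner u w := by
  have := Fintype.ofFinite (CubicRing f →ₐ[ℝ] ℂ)
  simp only [minkowskiInner_eq_sum, Finset.mul_sum]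
  refine Finset.sum_congr rfl fun σ _ => ?_
  simp
  ring

lemma minkowskiInner_add_right (u w w' : CubicRing f) :
    minkowskiInner u (w + w') = minkowskiInner u w + minkowskiInner u w' := by
  rw [minkowskiInner_comm, minkowskiInner_add_left, minkowskiInner_comm w, minkowskiInner_comm w']

lemma minkowskiInner_smul_right (t : ℝ) (u w : CubicRing f) :
    minkowskiInner u (t • w) = t * minkowskiInner u w := by
  rw [minkowskiInner_comm, minkowskiInner_smul_left, minkowskiInner_comm w]

lemma minkowskiInner_self_pos (hf : f.discr ≠ 0) {u : CubicRing f} (hu : u ≠ 0) :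
    0 < minkowskiInner u u := by
  have := Fintype.ofFinite (CubicRing f →ₐ[ℝ] ℂ)
  have h (σ : CubicRing f →ₐ[ℝ] ℂ) : (σ u * (starRingEnd ℂ) (σ u)).re = Complex.normSq (σ u) := by
    rw [Complex.mul_conj, Complex.ofReal_re]
  simp only [minkowskiInner_eq_sum, h]
  by_contra hn
  refine hu (eq_zero_of_forall_algHom (L := ℂ) hf fun σ => ?_)
  have h0 := (Finset.sum_eq_zero_iff_of_nonneg fun σ _ => Complex.normSq_nonneg (σ u)).1
    (le_antisymm (not_lt.1 hn) (Finset.sum_nonneg fun σ _ => Complex.normSq_nonneg (σ u)))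
  exact Complex.normSq_eq_zero.1 (h0 σ (Finset.mem_univ σ))

lemma minkowskiInner_map (e : CubicRing f' ≃ₐ[ℝ] CubicRing f) (u w : CubicRing f') :
    minkowskiInner (e u) (e w) = minkowskiInner u w := by
  rw [minkowskiInner, minkowskiInner]
  congr 1
  refine finsum_eq_of_bijective (fun σ : CubicRing f →ₐ[ℝ] ℂ => σ.comp e.toAlgHom) ?_ fun σ => rfl
  refine ⟨fun σ τ h => ?_, fun σ => ⟨σ.comp e.symm.toAlgHom, ?_⟩⟩
  · ext x
    simpa using congrArg (fun ρ : CubicRing f' →ₐ[ℝ] ℂ => ρ (e.symm x)) h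
  · ext x
    simp

/-- A ring isomorphism only permutes the homomorphisms to ℂ, so it preserves the Minkowski form, and
the projected basis transforms by (l det γ)γ. -/
lemma gram_twist {l : ℝ} (hl : l ≠ 0) {γ : Matrix (Fin 2) (Fin 2) ℝ} (hγ : γ.det ≠ 0)
    (f : Cubic ℝ) : gram (twist l γ f) = (l * γ.det) ^ 2 • (γ * gram f * γᵀ) := by
  ext i j
  have h (k : Fin 2) : twistEquiv hl hγ f (perp (gen _ k))
      = (l * γ.det) • (γ k 0 • perp (gen f 0) + γ k 1 • perp (gen f 1)) := by
    rw [perp_map]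
    exact perp_twistHom_gen l γ f k
  simp only [gram, Matrix.of_apply]
  rw [← minkowskiInner_map (twistEquiv hl hγ f), h, h]
  simp only [minkowskiInner_smul_left, minkowskiInner_smul_right, minkowskiInner_add_left,
    minkowskiInner_add_right, Matrix.smul_apply, Matrix.mul_apply, Fin.sum_univ_two,
    Matrix.transpose_apply, Matrix.of_apply, smul_eq_mul]
  ring

lemma gram_pos (hf : f.discr ≠ 0) {p q : ℝ} (hpq : p ≠ 0 ∨ q ≠ 0) :
    0 < p ^ 2 * gram f 0 0 + 2 * p * q * gram f 0 1 + q ^ 2 * gram f 1 1 := by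
  have hu : p • perp (gen f 0) + q • perp (gen f 1) ≠ 0 := by
    intro h
    have h1 := congrArg c1 h
    have h2 := congrArg c2 h
    simp [perp, gen, sub_eq_add_neg] at h1 h2
    tauto
  have h := minkowskiInner_self_pos hf hu
  simp only [minkowskiInner_smul_left, minkowskiInner_smul_right, minkowskiInner_add_left,
    minkowskiInner_add_right] at h
  rw [minkowskiInner_comm (perp (gen f 1)) (perp (gen f 0))] at h
  simp only [gram, Matrix.of_apply]
  linarith

/-- A Cholesky factorization. Positivity at the vector (G₁₁, -G₀₁), where the form takes the value
G₁₁ det G, makes the first square root real. -/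
lemma exists_gram_eq (hf : f.discr ≠ 0) : ∃ M : GL (Fin 2) ℝ, gram f = M.1 * M.1ᵀ := by
  have h11 : 0 < gram f 1 1 := by simpa using gram_pos hf (p := 0) (q := 1) (by simp)
  have h := gram_pos hf (p := gram f 1 1) (q := -gram f 0 1) (Or.inl h11.ne')
  have hd : 0 < gram f 0 0 - gram f 0 1 ^ 2 / gram f 1 1 := by
    have : gram f 0 0 - gram f 0 1 ^ 2 / gram f 1 1 = (gram f 1 1 ^ 2 * gram f 0 0 +
        2 * gram f 1 1 * -gram f 0 1 * gram f 0 1 + (-gram f 0 1) ^ 2 * gram f 1 1)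
        / gram f 1 1 ^ 2 := by
      field_simp
      ring
    rw [this]
    positivity
  have h10 : gram f 1 0 = gram f 0 1 := minkowskiInner_comm _ _
  refine ⟨Matrix.GeneralLinearGroup.mkOfDetNeZero
    !![√(gram f 0 0 - gram f 0 1 ^ 2 / gram f 1 1), gram f 0 1 / √(gram f 1 1);
      0, √(gram f 1 1)] ?_, ?_⟩
  · rw [Matrix.det_fin_two_of]
    have := Real.sqrt_pos.2 h11
    have := Real.sqrt_pos.2 hd
    simp only [mul_zero, sub_zero]
    positivity
  · have hs := Real.sqrt_pos.2 h11
    have h00 : gram f 0 0 = √(gram f 0 0 - gram f 0 1 ^ 2 / gram f 1 1) ^ 2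
        + (gram f 0 1 / √(gram f 1 1)) ^ 2 := by
      rw [Real.sq_sqrt hd.le, div_pow, Real.sq_sqrt h11.le]
      ring
    have h01 : gram f 0 1 = gram f 0 1 / √(gram f 1 1) * √(gram f 1 1) :=
      (div_mul_cancel₀ _ hs.ne').symm
    have h11' : gram f 1 1 = √(gram f 1 1) * √(gram f 1 1) := (Real.mul_self_sqrt h11.le).symm
    rw [Matrix.GeneralLinearGroup.val_mkOfDetNeZero]
    ext i j
    rw [Matrix.mul_apply, Fin.sum_univ_two]
    fin_cases i <;> fin_cases j
    · simpa [← pow_two] using h00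
    · simpa using h01
    · simpa [h10, mul_comm] using h01
    · simpa using h11'

end Real

end CubicRing

/-! ### Shapes under a change of variables -/

lemma S2.mk_eq_mk_of_smul {c : ℝ} (hc : c ≠ 0) {M N : GL (Fin 2) ℝ}
    (h : M.1 = c • N.1) : S2.mk M = S2.mk N := by
  let u : GL (Fin 2) ℝ := Matrix.GeneralLinearGroup.mkOfDetNeZero (c • 1) (by simp [hc])
  have hu : u ∈ GO2 := ⟨c ^ 2, by positivity, by
    simp [u, Matrix.GeneralLinearGroup.mkOfDetNeZero, smul_smul, pow_two]⟩
  have : M = N * u := by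
    ext i j
    simp [u, Matrix.GeneralLinearGroup.mkOfDetNeZero, h]
  rw [this, S2.mk_mul_right hu]

/-- The shape attached to a binary cubic form after a linear change of variables. -/
theorem exists_shapeOfGram_twist {f : Cubic ℝ} (hf : f.discr ≠ 0)
    (hs : shapeOfGram (CubicRing.gram f) = S2.mk 1) :
    ∃ k ∈ GLInt 2, ∀ (l : ℝ) (γ : GL (Fin 2) ℝ), l ≠ 0 →
      shapeOfGram (CubicRing.gram (CubicRing.twist l γ.1 f)) = S2.mk (γ * k) := by
  obtain ⟨M, hM⟩ := CubicRing.exists_gram_eq hf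
  rw [hM, shapeOfGram_mul_transpose] at hs
  -- Triviality of the shape gives M = kh with k integral and h ∈ `GO2`, so γM has the class of γk.
  obtain ⟨k, hk, h, hh, hkh⟩ := (S2.mk_eq_mk).1 hs.symm
  refine ⟨k, hk, fun l γ hl => ?_⟩
  have hγ : γ.1.det ≠ 0 := Matrix.GeneralLinearGroup.det_ne_zero γ
  let N : GL (Fin 2) ℝ := Matrix.GeneralLinearGroup.mkOfDetNeZero ((l * γ.1.det) • (γ * M).1)
    (by
      rw [Matrix.det_smul]
      exact mul_ne_zero (pow_ne_zero _ (mul_ne_zero hl hγ))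
        (Matrix.GeneralLinearGroup.det_ne_zero (γ * M)))
  have hN : N.1 = (l * γ.1.det) • (γ * M).1 := rfl
  have : CubicRing.gram (CubicRing.twist l γ.1 f) = N.1 * N.1ᵀ := by
    rw [CubicRing.gram_twist hl hγ, hM, hN, Units.val_mul]
    simp only [Matrix.transpose_smul, Matrix.transpose_mul, Matrix.smul_mul, Matrix.mul_smul,
      smul_smul, ← pow_two, Matrix.mul_assoc]
  rw [this, shapeOfGram_mul_transpose, S2.mk_eq_mk_of_smul (mul_ne_zero hl hγ) hN]
  rw [hkh, mul_one, ← mul_assoc, S2.mk_mul_right hh]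

/-! ### The group action on pairs of ternary quadratic forms -/

lemma symMat_injective : Function.Injective symMat := by
  intro a b h
  ext z
  induction z with
  | _ i j => exact congrFun (congrFun h i) j

lemma symMat_add (a b : Sym2 (Fin 3) → ℝ) : symMat (a + b) = symMat a + symMat b := rfl

lemma symMat_sub (a b : Sym2 (Fin 3) → ℝ) : symMat (a - b) = symMat a - symMat b := rfl

lemma symMat_neg (a : Sym2 (Fin 3) → ℝ) : symMat (-a) = -symMat a := rfl

lemma symMat_smul (t : ℝ) (a : Sym2 (Fin 3) → ℝ) : symMat (t • a) = t • symMat a := rfl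

lemma symMat_actGL3 (g : GL (Fin 3) ℝ) (v : VR) (k : Fin 2) :
    symMat (actGL3 g v k) = g.1 * symMat (v k) * g.1ᵀ := rfl

lemma actGL2_zero (γ : GL (Fin 2) ℝ) (v : VR) : actGL2 γ v 0 = γ 0 0 • v 0 - γ 0 1 • v 1 := rfl

lemma actGL2_one (γ : GL (Fin 2) ℝ) (v : VR) : actGL2 γ v 1 = -(γ 1 0 • v 0) + γ 1 1 • v 1 := rfl

lemma VR.ext {v w : VR} (h0 : v 0 = w 0) (h1 : v 1 = w 1) : v = w := by
  ext k
  fin_cases k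
  · exact congrFun h0 _
  · exact congrFun h1 _

/-- The action of `GL₃(ℝ)` as a representation. -/
def actGL3Hom : GL (Fin 3) ℝ →* (VR →ₗ[ℝ] VR) where
  toFun g :=
    { toFun := actGL3 g
      map_add' := fun v w => by
        ext k : 1
        apply symMat_injective
        simp only [symMat_actGL3, Pi.add_apply, symMat_add, Matrix.mul_add, Matrix.add_mul]
      map_smul' := fun t v => by
        ext k : 1
        apply symMat_injective
        simp only [symMat_actGL3, Pi.smul_apply, symMat_smul, Matrix.mul_smul, Matrix.smul_mul,
          RingHom.id_apply] }
  map_one' := by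
    refine LinearMap.ext fun v => ?_
    ext k : 1
    apply symMat_injective
    change symMat (actGL3 1 v k) = symMat (v k)
    simp [symMat_actGL3]
  map_mul' g h := by
    refine LinearMap.ext fun v => ?_
    ext k : 1
    apply symMat_injective
    change symMat (actGL3 (g * h) v k) = symMat (actGL3 g (actGL3 h v) k)
    simp only [symMat_actGL3, Units.val_mul, Matrix.transpose_mul, Matrix.mul_assoc]

/-- The action of `GL₂(ℝ)` as a representation. -/
def actGL2Hom : GL (Fin 2) ℝ →* (VR →ₗ[ℝ] VR) where
  toFun γ :=
    { toFun := actGL2 γ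
      map_add' := fun v w => by
        apply VR.ext
        · simp only [actGL2_zero, Pi.add_apply, smul_add]
          abel
        · simp only [actGL2_one, Pi.add_apply, smul_add]
          abel
      map_smul' := fun t v => by
        apply VR.ext
        · simp only [actGL2_zero, Pi.smul_apply, RingHom.id_apply, smul_sub, smul_comm t]
        · simp only [actGL2_one, Pi.smul_apply, RingHom.id_apply, smul_add, smul_neg,
            smul_comm t] }
  map_one' := by
    refine LinearMap.ext fun v => ?_
    change actGL2 1 v = v
    apply VR.ext
    · simp [actGL2_zero]
    · simp [actGL2_one]
  map_mul' g h := by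
    refine LinearMap.ext fun v => ?_
    change actGL2 (g * h) v = actGL2 g (actGL2 h v)
    have e (i j : Fin 2) : (g * h) i j = g i 0 * h 0 j + g i 1 * h 1 j := by
      change (g.1 * h.1) i j = _
      rw [Matrix.mul_apply, Fin.sum_univ_two]
    apply VR.ext
    · simp only [actGL2_zero, actGL2_one, e]
      module
    · simp only [actGL2_zero, actGL2_one, e]
      module

lemma actGL3_actGL2 (g : GL (Fin 3) ℝ) (γ : GL (Fin 2) ℝ) (v : VR) :
    actGL3 g (actGL2 γ v) = actGL2 γ (actGL3 g v) := by
  apply VR.ext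
  · apply symMat_injective
    simp only [symMat_actGL3, actGL2_zero, symMat_sub, symMat_smul, Matrix.mul_sub, Matrix.sub_mul,
      Matrix.mul_smul, Matrix.smul_mul]
  · apply symMat_injective
    simp only [symMat_actGL3, actGL2_one, symMat_add, symMat_neg, symMat_smul, Matrix.mul_add,
      Matrix.add_mul, Matrix.mul_smul, Matrix.smul_mul, Matrix.mul_neg, Matrix.neg_mul]

/-- The action of an element of `G'_ℝ` as a linear map. -/
def actLin (g : GR) : VR →ₗ[ℝ] VR :=
  (g.1 : ℝ) • (actGL3Hom g.2.1.1 ∘ₗ actGL2Hom g.2.2.1)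

lemma GR.fst_mul (g h : GR) : (g * h).1 = g.1 * h.1 := rfl
lemma GR.snd_fst_mul (g h : GR) : (g * h).2.1 = g.2.1 * h.2.1 := rfl
lemma GR.snd_snd_mul (g h : GR) : (g * h).2.2 = g.2.2 * h.2.2 := rfl

lemma act_mul (g h : GR) (v : VR) : act (g * h) v = act g (act h v) := by
  have h3 (a b : GL (Fin 3) ℝ) (w : VR) : actGL3 (a * b) w = actGL3 a (actGL3 b w) :=
    LinearMap.congr_fun (actGL3Hom.map_mul a b) w
  have h2 (a b : GL (Fin 2) ℝ) (w : VR) : actGL2 (a * b) w = actGL2 a (actGL2 b w) :=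
    LinearMap.congr_fun (actGL2Hom.map_mul a b) w
  have hs (a : GL (Fin 3) ℝ) (b : GL (Fin 2) ℝ) (t : ℝ) (w : VR) :
      actGL3 a (actGL2 b (t • w)) = t • actGL3 a (actGL2 b w) :=
    (actGL3Hom a ∘ₗ actGL2Hom b).map_smul t w
  simp only [act, GR.fst_mul, GR.snd_fst_mul, GR.snd_snd_mul, Subgroup.coe_mul, Units.val_mul, h3,
    h2, hs, smul_smul, actGL3_actGL2 _ (g.2.2 : GL (Fin 2) ℝ)]

lemma act_one (v : VR) : act 1 v = v := by
  have h3 : actGL3 1 = fun v => v := funext fun w => LinearMap.congr_fun actGL3Hom.map_one w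
  have h2 : actGL2 1 = fun v => v := funext fun w => LinearMap.congr_fun actGL2Hom.map_one w
  change (((1 : ℝˣ) : ℝ)) • actGL3 (1 : GL (Fin 3) ℝ) (actGL2 (1 : GL (Fin 2) ℝ) v) = v
  rw [h3, h2, Units.val_one, one_smul]

lemma act_inv_act (g : GR) (v : VR) : act g⁻¹ (act g v) = v := by
  rw [← act_mul, inv_mul_cancel, act_one]

lemma act_act_inv (g : GR) (v : VR) : act g (act g⁻¹ v) = v := by
  rw [← act_mul, mul_inv_cancel, act_one]

lemma continuous_act_right (g : GR) : Continuous (act g) :=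
  (actLin g).continuous_of_finiteDimensional

/-- The two matrix factors act through representations of the full linear groups, hence with
determinant ±1; only the scalar on a twelve-dimensional space contributes. -/
lemma abs_det_actLin (g : GR) : |LinearMap.det (actLin g)| = |(g.1 : ℝ)| ^ 12 := by
  have h : Module.finrank ℝ VR = 12 := by
    rw [Module.finrank_pi_fintype]
    simp [Sym2.card, Nat.choose]
  rw [actLin, LinearMap.det_smul, LinearMap.det_comp, abs_mul, abs_mul,
    abs_det_eq_one_of_mem_GLpm actGL3Hom g.2.1.2, abs_det_eq_one_of_mem_GLpm actGL2Hom g.2.2.2, h,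
    abs_pow, mul_one, mul_one]

lemma Cubic.ext_of_eval {f g : Cubic ℝ} (h : ∀ x y : ℝ,
    f.a * x ^ 3 + f.b * x ^ 2 * y + f.c * x * y ^ 2 + f.d * y ^ 3
      = g.a * x ^ 3 + g.b * x ^ 2 * y + g.c * x * y ^ 2 + g.d * y ^ 3) : f = g := by
  have h1 := h 1 0
  have h2 := h 0 1
  have h3 := h 1 1
  have h4 := h 1 (-1)
  norm_num at h1 h2 h3 h4
  ext <;> linarith

lemma binaryCubic_act (g : GR) (v : VR) : binaryCubic (act g v) =
    CubicRing.twist ((g.1 : ℝ) ^ 3 * g.2.1.1.1.det ^ 2) g.2.2.1.1 (binaryCubic v) := by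
  apply Cubic.ext_of_eval
  intro x y
  rw [← binaryCubic_spec]
  set γ := g.2.2.1.1 with hγ
  have h0 : symMat (act g v 0) = (g.1 : ℝ) •
      (g.2.1.1.1 * (γ 0 0 • symMat (v 0) - γ 0 1 • symMat (v 1)) * g.2.1.1.1ᵀ) := rfl
  have h1 : symMat (act g v 1) = (g.1 : ℝ) •
      (g.2.1.1.1 * (-(γ 1 0 • symMat (v 0)) + γ 1 1 • symMat (v 1)) * g.2.1.1.1ᵀ) := rfl
  have h : x • symMat (act g v 0) - y • symMat (act g v 1) = (g.1 : ℝ) • (g.2.1.1.1 *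
      ((γ 0 0 * x + γ 1 0 * y) • symMat (v 0) - (γ 0 1 * x + γ 1 1 * y) • symMat (v 1))
        * g.2.1.1.1ᵀ) := by
    rw [h0, h1]
    simp only [Matrix.mul_sub, Matrix.sub_mul, Matrix.mul_add, Matrix.add_mul, Matrix.mul_neg,
      Matrix.neg_mul, Matrix.mul_smul, Matrix.smul_mul]
    module
  rw [h, Matrix.det_smul, Matrix.det_mul, Matrix.det_mul, Matrix.det_transpose, binaryCubic_spec]
  simp only [CubicRing.twist, Fintype.card_fin]
  ring

lemma sq_det_of_mem_GLpm {n : ℕ} (g : GLpm n) : g.1.1.det ^ 2 = 1 := by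
  rcases g.2 with h | h <;> rw [h] <;> norm_num

/-- The cubic form is multiplied by λ³, up to a unimodular substitution, and the discriminant has
degree 4. The exponent equals that of the Jacobian on V_ℝ. -/
lemma disc_act (g : GR) (v : VR) : disc (act g v) = (g.1 : ℝ) ^ 12 * disc v := by
  rw [disc, binaryCubic_act, CubicRing.discr_twist, sq_det_of_mem_GLpm]
  have : g.2.2.1.1.det ^ 6 = 1 := by
    rw [show 6 = 2 * 3 from rfl, pow_mul, sq_det_of_mem_GLpm, one_pow]
  rw [this, disc]
  ring

/-- The shape of the points of an orbit. -/
lemma exists_shape_act {v : VR} (hv : disc v ≠ 0) (hs : shape v = S2.mk 1) :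
    ∃ k ∈ GLInt 2, ∀ g : GR, shape (act g v) = S2.mk (g.2.2.1 * k) := by
  obtain ⟨k, hk, h⟩ := exists_shapeOfGram_twist hv hs
  refine ⟨k, hk, fun g => ?_⟩
  rw [shape, binaryCubic_act, sq_det_of_mem_GLpm, mul_one, h]
  exact pow_ne_zero _ g.1.ne_zero

lemma continuous_symMat : Continuous symMat :=
  continuous_matrix fun i j => continuous_apply s(i, j)

lemma continuous_disc : Continuous disc := by
  have h0 : Continuous fun v : VR => symMat (v 0) := continuous_symMat.comp (continuous_apply 0)
  have h1 : Continuous fun v : VR => symMat (v 1) := continuous_symMat.comp (continuous_apply 1)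
  have ha : Continuous fun v : VR => (binaryCubic v).a := h0.matrix_det
  have hb : Continuous fun v : VR => (binaryCubic v).b := (h0.matrix_adjugate.mul h1).matrix_trace.neg
  have hc : Continuous fun v : VR => (binaryCubic v).c := (h0.mul h1.matrix_adjugate).matrix_trace
  have hd : Continuous fun v : VR => (binaryCubic v).d := h1.matrix_det.neg
  unfold disc Cubic.discr
  fun_prop

/-! ### The invariant measure on V_ℝ -/

/-- The measure `|Disc(x)|⁻¹ dx` on `V_ℝ`. -/
def discMeasure : Measure VR := volume.withDensity fun x => ENNReal.ofReal |disc x|⁻¹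

lemma measurable_discDensity : Measurable fun x : VR => ENNReal.ofReal |disc x|⁻¹ :=
  (continuous_disc.measurable.abs.inv).ennreal_ofReal

/-- The factor |λ|¹² of the Jacobian cancels the one by which the discriminant scales. -/
lemma measurePreserving_act (g : GR) : MeasurePreserving (act g) discMeasure discMeasure := by
  have hm : Measurable (act g) := (continuous_act_right g).measurable
  refine ⟨hm, ?_⟩
  have hg : |(g.1 : ℝ)| ^ 12 ≠ 0 := pow_ne_zero _ (abs_ne_zero.2 g.1.ne_zero)
  have hdet : LinearMap.det (actLin g) ≠ 0 := by
    rw [← abs_ne_zero, abs_det_actLin]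
    exact hg
  have hmap : Measure.map (act g) volume
      = ENNReal.ofReal (|(g.1 : ℝ)| ^ 12)⁻¹ • (volume : Measure VR) := by
    have := Measure.map_linearMap_addHaar_eq_smul_addHaar (volume : Measure VR) hdet
    rwa [abs_inv, abs_det_actLin] at this
  ext s hs
  rw [Measure.map_apply hm hs, discMeasure, withDensity_apply _ (hm hs), withDensity_apply _ hs]
  have h1 (x : VR) : ENNReal.ofReal |disc x|⁻¹
      = ENNReal.ofReal (|(g.1 : ℝ)| ^ 12) * ENNReal.ofReal |disc (act g x)|⁻¹ := by
    rw [← ENNReal.ofReal_mul (by positivity), disc_act, abs_mul, mul_inv, abs_pow,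
      mul_inv_cancel_left₀ hg]
  have hm' : Measurable fun x : VR => ENNReal.ofReal |disc (act g x)|⁻¹ :=
    measurable_discDensity.comp hm
  refine (lintegral_congr h1).trans ?_
  rw [lintegral_const_mul _ hm',
    ← setLIntegral_map hs measurable_discDensity hm, hmap, Measure.restrict_smul,
    lintegral_smul_measure, smul_eq_mul, ← mul_assoc, ← ENNReal.ofReal_mul (by positivity),
    mul_inv_cancel₀ hg, ENNReal.ofReal_one, one_mul]

/-! ### Triviality of the infinitesimal stabilizer -/

/-- Jacobi's formula: this is the derivative of f(x, y) = det(Ax - By) in the direction (α, β),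
namely α ∂f/∂x + β ∂f/∂y. -/
lemma trace_adjugate_pencil (v : VR) (x y α β : ℝ) :
    ((x • symMat (v 0) - y • symMat (v 1)).adjugate
        * (α • symMat (v 0) - β • symMat (v 1))).trace =
      α * (3 * (binaryCubic v).a * x ^ 2 + 2 * (binaryCubic v).b * x * y + (binaryCubic v).c * y ^ 2)
      + β * ((binaryCubic v).b * x ^ 2 + 2 * (binaryCubic v).c * x * y
        + 3 * (binaryCubic v).d * y ^ 2) := by
  simp [binaryCubic, Matrix.det_fin_three, Matrix.trace_fin_three, Matrix.adjugate_fin_three,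
    Matrix.vecMul, dotProduct, Matrix.mul_apply, Fin.sum_univ_three]
  ring

/-- The infinitesimal stabilizer of a binary cubic form with nonzero discriminant is trivial. -/
lemma cubic_infinitesimal {f : Cubic ℝ} (hf : f.discr ≠ 0) {l p q t u : ℝ} (hpu : p + u = 0)
    (h : ∀ x y : ℝ, 3 * l * (f.a * x ^ 3 + f.b * x ^ 2 * y + f.c * x * y ^ 2 + f.d * y ^ 3)
      + ((p * x + t * y) * (3 * f.a * x ^ 2 + 2 * f.b * x * y + f.c * y ^ 2)
        + (q * x + u * y) * (f.b * x ^ 2 + 2 * f.c * x * y + 3 * f.d * y ^ 2)) = 0) :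
    l = 0 ∧ p = 0 ∧ q = 0 ∧ t = 0 ∧ u = 0 := by
  obtain rfl : u = -p := by linarith
  have h1 := h 1 0
  have h2 := h 0 1
  have h3 := h 1 1
  have h4 := h 1 (-1)
  have e1 : 3 * f.a * l + 3 * f.a * p + f.b * q = 0 := by linear_combination h1
  have e2 : 3 * f.b * l + f.b * p + 2 * f.c * q + 3 * f.a * t = 0 := by
    linear_combination (1 / 2) * h3 - (1 / 2) * h4 - h2
  have e3 : 3 * f.c * l - f.c * p + 3 * f.d * q + 2 * f.b * t = 0 := by
    linear_combination (1 / 2) * h3 + (1 / 2) * h4 - h1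
  have e4 : 3 * f.d * l - 3 * f.d * p + f.c * t = 0 := by linear_combination h2
  have key {z : ℝ} (hz : f.discr * z = 0) : z = 0 := (mul_eq_zero.1 hz).resolve_left hf
  -- Cramer's rule for the linear system e1–e4 in l, p, q, t, whose determinant is a constant
  -- multiple of the discriminant.
  have hl : l = 0 := key (by
    rw [Cubic.discr]
    linear_combination (-1 / 6) * (2 * f.c ^ 3 - 9 * f.b * f.c * f.d + 27 * f.a * f.d ^ 2) * e1
      - (1 / 6) * (-f.b * f.c ^ 2 + 6 * f.b ^ 2 * f.d - 9 * f.a * f.c * f.d) * e2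
      - (1 / 6) * (-f.b ^ 2 * f.c + 6 * f.a * f.c ^ 2 - 9 * f.a * f.b * f.d) * e3
      - (1 / 6) * (2 * f.b ^ 3 - 9 * f.a * f.b * f.c + 27 * f.a ^ 2 * f.d) * e4)
  have hp : p = 0 := key (by
    rw [Cubic.discr]
    linear_combination (-1 / 6) * (6 * f.c ^ 3 - 21 * f.b * f.c * f.d + 27 * f.a * f.d ^ 2) * e1
      - (1 / 6) * (-3 * f.b * f.c ^ 2 + 6 * f.b ^ 2 * f.d + 9 * f.a * f.c * f.d) * e2
      - (1 / 6) * (3 * f.b ^ 2 * f.c - 6 * f.a * f.c ^ 2 - 9 * f.a * f.b * f.d) * e3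
      - (1 / 6) * (-6 * f.b ^ 3 + 21 * f.a * f.b * f.c - 27 * f.a ^ 2 * f.d) * e4)
  have hq : q = 0 := key (by
    rw [Cubic.discr]
    linear_combination (-1 / 6) * (-6 * f.b * f.c ^ 2 + 24 * f.b ^ 2 * f.d - 18 * f.a * f.c * f.d) * e1
      - (1 / 6) * (12 * f.a * f.c ^ 2 - 36 * f.a * f.b * f.d) * e2
      - (1 / 6) * (-6 * f.a * f.b * f.c + 54 * f.a ^ 2 * f.d) * e3
      - (1 / 6) * (12 * f.a * f.b ^ 2 - 36 * f.a ^ 2 * f.c) * e4)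
  have ht : t = 0 := key (by
    rw [Cubic.discr]
    linear_combination (-1 / 6) * (12 * f.c ^ 2 * f.d - 36 * f.b * f.d ^ 2) * e1
      - (1 / 6) * (-6 * f.b * f.c * f.d + 54 * f.a * f.d ^ 2) * e2
      - (1 / 6) * (12 * f.b ^ 2 * f.d - 36 * f.a * f.c * f.d) * e3
      - (1 / 6) * (-6 * f.b ^ 2 * f.c + 24 * f.a * f.c ^ 2 - 18 * f.a * f.b * f.d) * e4)
  exact ⟨hl, hp, hq, ht, by rw [hp, neg_zero]⟩

lemma dot3_mul_eq_of_cross3_eq_zero {s y : Fin 3 → ℝ} (h : cross3 s y = 0) (i : Fin 3) :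
    dot3 s s * y i = dot3 s y * s i := by
  have h0 := congrFun h 0
  have h1 := congrFun h 1
  have h2 := congrFun h 2
  simp only [cross3, Matrix.cons_val_zero, Matrix.cons_val_one, Matrix.cons_val, Pi.zero_apply]
    at h0 h1 h2
  fin_cases i <;> simp only [dot3, Fin.mk_zero, Fin.mk_one, Fin.reduceFinMk]
  · linear_combination s 2 * h1 - s 1 * h2
  · linear_combination s 0 * h2 - s 2 * h0
  · linear_combination s 1 * h0 - s 0 * h1

/-- A matrix that is symmetric with respect to a nonzero alternating form on a three-dimensional
space is a scalar plus a matrix of rank one. -/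
lemma exists_eq_scalar_add_rank_one {s : Fin 3 → ℝ} (hs : s ≠ 0) {C : Matrix (Fin 3) (Fin 3) ℝ}
    (h : (!![0, -s 2, s 1; s 2, 0, -s 0; -s 1, s 0, 0] * C)ᵀ
      = -(!![0, -s 2, s 1; s 2, 0, -s 0; -s 1, s 0, 0] * C)) :
    ∃ (c : ℝ) (r : Fin 3 → ℝ), C = c • (1 : Matrix (Fin 3) (Fin 3) ℝ) + Matrix.vecMulVec s r := by
  have hN : dot3 s s ≠ 0 := fun h => hs (dot3_self_eq_zero h)
  have e (i j : Fin 3) := congrFun (congrFun h i) j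
  have e00 := e 0 0
  have e01 := e 0 1
  have e02 := e 0 2
  have e11 := e 1 1
  have e12 := e 1 2
  have e22 := e 2 2
  simp [Matrix.vecMul, dotProduct, Fin.sum_univ_three] at e00 e01 e02 e11 e12 e22
  -- For S = [s]×, the hypothesis reads CᵀS = SC. Combined with the identity CᵀS + SC = [tr(C)s -
  -- Cs]× it gives 2SC = [w]×, which is `key` column by column.
  set w : Fin 3 → ℝ := fun i => C.trace * s i - dot3 (C i) s with hw
  have key (j : Fin 3) : cross3 s (fun i => C i j) = (1 / 2 : ℝ) • cross3 w (Pi.single j 1) := by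
    ext i
    fin_cases j <;> fin_cases i <;>
      simp [cross3, hw, dot3, Matrix.trace_fin_three] <;> linarith
  -- s is orthogonal to every column of [s]×C, so w is parallel to s, say w = 2cs. Then the columns
  -- of C - c are parallel to s too.
  have hsw : cross3 s w = 0 := by
    have h1 (j : Fin 3) : dot3 s (cross3 w (Pi.single j 1)) = 0 := by
      have h2 : dot3 s ((2 : ℝ) • cross3 s (fun i => C i j)) = 0 := by
        simp [dot3, cross3]
        ring
      rwa [key, smul_smul, show (2 : ℝ) * (1 / 2) = 1 by norm_num, one_smul] at h2
    have h10 := h1 0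
    have h11 := h1 1
    have h12 := h1 2
    simp [dot3, cross3] at h10 h11 h12
    ext i
    fin_cases i <;> simp [cross3] <;> linarith
  set c : ℝ := dot3 s w / (2 * dot3 s s) with hc
  have hcw (i : Fin 3) : w i = 2 * c * s i := by
    have := dot3_mul_eq_of_cross3_eq_zero hsw i
    rw [hc]
    field_simp
    linarith
  refine ⟨c, fun j => dot3 s (fun i => C i j - c * (1 : Matrix (Fin 3) (Fin 3) ℝ) i j) / dot3 s s,
    ?_⟩
  ext i j
  have h1 : cross3 s (fun i => C i j - c * (1 : Matrix (Fin 3) (Fin 3) ℝ) i j) = 0 := by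
    have h2 : cross3 s (fun i => C i j - c * (1 : Matrix (Fin 3) (Fin 3) ℝ) i j)
        = cross3 s (fun i => C i j) - c • cross3 s (Pi.single j 1) := by
      ext k
      fin_cases j <;> fin_cases k <;> simp [cross3, Matrix.one_apply] <;> ring
    have h3 : w = (2 * c) • s := funext hcw
    rw [h2, key, h3]
    ext k
    fin_cases j <;> fin_cases k <;> simp [cross3] <;> ring
  have h2 := dot3_mul_eq_of_cross3_eq_zero h1 i
  simp only [Matrix.add_apply, Matrix.smul_apply, Matrix.vecMulVec_apply, smul_eq_mul]
  field_simp
  linarith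

lemma Matrix.exists_eq_cross_of_transpose_eq_neg {S : Matrix (Fin 3) (Fin 3) ℝ} (h : Sᵀ = -S) :
    ∃ s : Fin 3 → ℝ, S = !![0, -s 2, s 1; s 2, 0, -s 0; -s 1, s 0, 0] := by
  have e (i j : Fin 3) : S j i = -S i j := congrFun (congrFun h i) j
  have d (i : Fin 3) : S i i = 0 := by linarith [e i i]
  refine ⟨![S 2 1, S 0 2, S 1 0], ?_⟩
  ext i j
  fin_cases i <;> fin_cases j <;> simp [d]
  · exact e 1 0
  · exact e 2 1
  · exact e 0 2

/-- The determinant of the pencil becomes det(A)(x - cy)²(x - cy - ρy), which has a double root. -/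
lemma discr_eq_zero_of_rank_one {v : VR} {c : ℝ} {s r : Fin 3 → ℝ}
    (h : symMat (v 1)
      = symMat (v 0) * (c • (1 : Matrix (Fin 3) (Fin 3) ℝ) + Matrix.vecMulVec s r)) :
    disc v = 0 := by
  set a := (symMat (v 0)).det
  set ρ := dot3 s r with hρ
  have h1 : binaryCubic v = ⟨a, a * (-3 * c - ρ), a * (3 * c ^ 2 + 2 * c * ρ),
      -(a * (c ^ 3 + c ^ 2 * ρ))⟩ := by
    apply Cubic.ext_of_eval
    intro x y
    rw [← binaryCubic_spec]
    have h2 : x • symMat (v 0) - y • symMat (v 1) = symMat (v 0) *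
        ((x - y * c) • (1 : Matrix (Fin 3) (Fin 3) ℝ) - y • Matrix.vecMulVec s r) := by
      rw [h]
      simp only [Matrix.mul_add, Matrix.mul_sub, Matrix.mul_smul, mul_one]
      module
    have h3 : ((x - y * c) • (1 : Matrix (Fin 3) (Fin 3) ℝ) - y • Matrix.vecMulVec s r).det
        = (x - y * c) ^ 3 - (x - y * c) ^ 2 * y * ρ := by
      simp [Matrix.det_fin_three, Matrix.vecMulVec_apply, hρ, dot3]
      ring
    rw [h2, Matrix.det_mul, h3]
    ring
  rw [disc, h1, Cubic.discr]
  ring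

/-- XA and XB = XA · A⁻¹B are both alternating. If XA ≠ 0, then A⁻¹B is a scalar plus a matrix of
rank at most one, which contradicts the nonvanishing of the discriminant. -/
lemma eq_zero_of_mul_add_mul_transpose {v : VR} (hv : disc v ≠ 0)
    (ha : (symMat (v 0)).det ≠ 0) {X : Matrix (Fin 3) (Fin 3) ℝ}
    (h0 : X * symMat (v 0) + symMat (v 0) * Xᵀ = 0)
    (h1 : X * symMat (v 1) + symMat (v 1) * Xᵀ = 0) : X = 0 := by
  set A := symMat (v 0) with hA
  set B := symMat (v 1) with hB
  have hu : IsUnit A.det := isUnit_iff_ne_zero.2 ha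
  have hAt : Aᵀ = A := symMat_isSymm _
  have hBt : Bᵀ = B := symMat_isSymm _
  have hS : (X * A)ᵀ = -(X * A) := by
    rw [Matrix.transpose_mul, hAt]
    exact eq_neg_of_add_eq_zero_right h0
  obtain ⟨s, hs⟩ := Matrix.exists_eq_cross_of_transpose_eq_neg hS
  have hXB : X * A * (A⁻¹ * B) = X * B := by
    rw [Matrix.mul_assoc, Matrix.mul_nonsing_inv_cancel_left _ _ hu]
  rcases eq_or_ne s 0 with rfl | hs0
  · have h2 : X * A = 0 := by
      rw [hs]
      ext i j
      fin_cases i <;> fin_cases j <;> simp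
    rw [← Matrix.mul_nonsing_inv_cancel_right A X hu, h2, Matrix.zero_mul]
  · exfalso
    obtain ⟨c, r, hC⟩ := exists_eq_scalar_add_rank_one hs0 (C := A⁻¹ * B) (by
      rw [← hs, hXB, Matrix.transpose_mul, hBt]
      exact eq_neg_of_add_eq_zero_right h1)
    refine hv (discr_eq_zero_of_rank_one (c := c) (s := s) (r := r) ?_)
    rw [← hA, ← hB, ← hC, Matrix.mul_nonsing_inv_cancel_left _ _ hu]

/-- A nondegenerate pencil contains a nonsingular form after a unimodular change of variables. -/
lemma exists_pencil_det_ne_zero {v : VR} (hv : disc v ≠ 0) :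
    ∃ γ : GLpm 2, (symMat (actGL2 γ.1 v 0)).det ≠ 0 := by
  by_contra! h
  have key (γ : GLpm 2) : (CubicRing.twist 1 γ.1.1 (binaryCubic v)).a = 0 := by
    have h1 := binaryCubic_act ((1, 1, γ) : ℝˣ × GLpm 3 × GLpm 2) v
    have h2 : act ((1, 1, γ) : ℝˣ × GLpm 3 × GLpm 2) v = actGL2 γ.1 v := by
      change (((1 : ℝˣ) : ℝ)) • actGL3Hom (1 : GL (Fin 3) ℝ) (actGL2 γ.1 v) = _
      rw [map_one, Units.val_one, one_smul]
      rfl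
    have h3 : (((1, 1, γ) : ℝˣ × GLpm 3 × GLpm 2).1 : ℝ) ^ 3
        * ((1, 1, γ) : ℝˣ × GLpm 3 × GLpm 2).2.1.1.1.det ^ 2 = 1 := by simp
    rw [h2] at h1
    have h4 := congrArg Cubic.a h1
    rw [h3] at h4
    exact h4.symm.trans (h γ)
  have mk (x y z w : ℝ) (hd : (!![x, y; z, w] : Matrix (Fin 2) (Fin 2) ℝ).det = 1) :
      (binaryCubic v).a * x ^ 3 + (binaryCubic v).b * x ^ 2 * y + (binaryCubic v).c * x * y ^ 2
        + (binaryCubic v).d * y ^ 3 = 0 := by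
    have := key ⟨Matrix.GeneralLinearGroup.mkOfDetNeZero !![x, y; z, w] (by rw [hd]; simp),
      Or.inl hd⟩
    simpa [CubicRing.twist, Matrix.GeneralLinearGroup.mkOfDetNeZero] using this
  -- A cubic form vanishing at (1, 0), (0, 1), (1, 1) and (1, -1) has discriminant zero.
  have h1 := mk 1 0 0 1 (by simp)
  have h2 := mk 0 1 (-1) 0 (by simp)
  have h3 := mk 1 1 0 1 (by simp)
  have h4 := mk 1 (-1) 0 1 (by simp)
  norm_num at h1 h2 h3 h4
  have hb : (binaryCubic v).b = 0 := by linarith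
  have hc : (binaryCubic v).c = 0 := by linarith
  refine hv ?_
  rw [disc, Cubic.discr, h1, h2, hb, hc]
  ring

/-- The infinitesimal stabilizer of a point with nonzero discriminant is trivial. -/
theorem infinitesimal_stabilizer {v : VR} (hv : disc v ≠ 0) {l : ℝ}
    {X : Matrix (Fin 3) (Fin 3) ℝ} {Y : Matrix (Fin 2) (Fin 2) ℝ}
    (h0 : l • symMat (v 0) + X * symMat (v 0) + symMat (v 0) * Xᵀ
      + (Y 0 0 • symMat (v 0) - Y 0 1 • symMat (v 1)) = 0)
    (h1 : l • symMat (v 1) + X * symMat (v 1) + symMat (v 1) * Xᵀ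
      + (-(Y 1 0 • symMat (v 0)) + Y 1 1 • symMat (v 1)) = 0)
    (hX : X.trace = 0) (hY : Y.trace = 0) : l = 0 ∧ X = 0 ∧ Y = 0 := by
  have hlY : l = 0 ∧ Y 0 0 = 0 ∧ Y 0 1 = 0 ∧ Y 1 0 = 0 ∧ Y 1 1 = 0 := by
    refine cubic_infinitesimal hv (by rwa [Matrix.trace_fin_two] at hY) fun x y => ?_
    rw [← trace_adjugate_pencil, ← binaryCubic_spec]
    set M := x • symMat (v 0) - y • symMat (v 1) with hM
    have h2 : l • M + X * M + M * Xᵀ + ((Y 0 0 * x + Y 1 0 * y) • symMat (v 0)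
        - (Y 0 1 * x + Y 1 1 * y) • symMat (v 1)) = 0 := by
      have h3 : x • (0 : Matrix (Fin 3) (Fin 3) ℝ) - y • (0 : Matrix (Fin 3) (Fin 3) ℝ) = 0 := by simp
      rw [← h3]
      nth_rewrite 1 [← h0]
      rw [← h1, hM]
      simp only [Matrix.mul_sub, Matrix.sub_mul, Matrix.mul_smul, Matrix.smul_mul]
      module
    -- Pairing with the adjugate of M eliminates X because tr X = 0, and leaves an equation for the
    -- cubic form alone.
    have h4 := congrArg (fun N => (M.adjugate * N).trace) h2
    have h5 : (M.adjugate * (X * M)).trace = 0 := by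
      rw [Matrix.trace_mul_comm, Matrix.mul_assoc, Matrix.mul_adjugate, Matrix.mul_smul, mul_one,
        Matrix.trace_smul, hX, smul_zero]
    have h6 : (M.adjugate * (M * Xᵀ)).trace = 0 := by
      rw [← Matrix.mul_assoc, Matrix.adjugate_mul, Matrix.smul_mul, one_mul, Matrix.trace_smul,
        Matrix.trace_transpose, hX, smul_zero]
    have h7 : (M.adjugate * (l • M)).trace = 3 * l * M.det := by
      rw [Matrix.mul_smul, Matrix.adjugate_mul, Matrix.trace_smul, Matrix.trace_smul,
        Matrix.trace_one]
      simp
      ring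
    simp only [Matrix.mul_add, Matrix.trace_add, h5, h6, h7, add_zero, Matrix.mul_zero,
      Matrix.trace_zero] at h4
    exact h4
  obtain ⟨rfl, h00, h01, h10, h11⟩ := hlY
  have hY0 : Y = 0 := by
    ext i j
    fin_cases i <;> fin_cases j <;> assumption
  refine ⟨rfl, ?_, hY0⟩
  simp only [h00, h01, h10, h11, zero_smul, sub_zero, add_zero, zero_add, neg_zero] at h0 h1
  -- The remaining equations for X are linear in the pencil, so its first form may be assumed
  -- nonsingular.
  obtain ⟨γ, hγ⟩ := exists_pencil_det_ne_zero hv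
  have hd : disc (actGL2 γ.1 v) ≠ 0 := by
    have h1 := disc_act ((1, 1, γ) : ℝˣ × GLpm 3 × GLpm 2) v
    have h2 : act ((1, 1, γ) : ℝˣ × GLpm 3 × GLpm 2) v = actGL2 γ.1 v := by
      change (((1 : ℝˣ) : ℝ)) • actGL3Hom (1 : GL (Fin 3) ℝ) (actGL2 γ.1 v) = _
      rw [map_one, Units.val_one, one_smul]
      rfl
    rw [h2] at h1
    rw [h1]
    simpa using hv
  have hlin (α β : ℝ) : X * (α • symMat (v 0) + β • symMat (v 1))
      + (α • symMat (v 0) + β • symMat (v 1)) * Xᵀ = 0 := by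
    have : X * (α • symMat (v 0) + β • symMat (v 1))
        + (α • symMat (v 0) + β • symMat (v 1)) * Xᵀ
        = α • (X * symMat (v 0) + symMat (v 0) * Xᵀ)
          + β • (X * symMat (v 1) + symMat (v 1) * Xᵀ) := by
      simp only [Matrix.mul_add, Matrix.add_mul, Matrix.mul_smul, Matrix.smul_mul]
      module
    rw [this, h0, h1, smul_zero, smul_zero, add_zero]
  refine eq_zero_of_mul_add_mul_transpose hd hγ ?_ ?_
  · have := hlin (γ.1 0 0) (-γ.1 0 1)
    rwa [neg_smul, ← sub_eq_add_neg] at this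
  · have := hlin (-γ.1 1 0) (γ.1 1 1)
    rwa [neg_smul] at this

/-! ### The orbit map as a local homeomorphism -/

/-- The normed space that contains `G'_ℝ`. -/
abbrev AmbientG : Type := ℝ × (Fin 3 → Fin 3 → ℝ) × (Fin 2 → Fin 2 → ℝ)

/-- The inclusion of `G'_ℝ` into the normed space of triples. -/
def GR.toAmbient (g : GR) : AmbientG := ((g.1 : ℝ), g.2.1.1.1, g.2.2.1.1)

/-- The image of `v` under a linear change of variables in `ℝ²`. -/
def pencilMap (v : VR) (Y : Fin 2 → Fin 2 → ℝ) : VR :=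
  ![Y 0 0 • v 0 - Y 0 1 • v 1, -(Y 1 0 • v 0) + Y 1 1 • v 1]

/-- The orbit map, extended to all triples of matrices. -/
def ambientAct (v : VR) (p : AmbientG) : VR := fun k => p.1 • symCoord
  (Matrix.of p.2.1 * symMat (pencilMap v p.2.2 k) * (Matrix.of p.2.1)ᵀ) (by
    unfold Matrix.IsSymm
    rw [Matrix.transpose_mul, Matrix.transpose_mul, Matrix.transpose_transpose,
      (symMat_isSymm _).eq, Matrix.mul_assoc])

/-- The orbit map together with the determinants. -/
def ambientMap (v : VR) (p : AmbientG) : VR × ℝ × ℝ :=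
  (ambientAct v p, (Matrix.of p.2.1).det, (Matrix.of p.2.2).det)

lemma ambientAct_apply (v : VR) (p : AmbientG) (k : Fin 2) (i j : Fin 3) :
    ambientAct v p k s(i, j)
      = p.1 * (Matrix.of p.2.1 * symMat (pencilMap v p.2.2 k) * (Matrix.of p.2.1)ᵀ) i j := rfl

lemma contDiff_ambientMap (v : VR) : ContDiff ℝ 1 (ambientMap v) := by
  refine ContDiff.prodMk ?_ (ContDiff.prodMk ?_ ?_)
  · refine contDiff_pi.2 fun k => contDiff_pi.2 fun z => ?_
    induction z with
    | _ i j =>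
      simp only [ambientAct_apply, Matrix.mul_apply, Fin.sum_univ_three, Matrix.of_apply,
        Matrix.transpose_apply]
      have h (a b : Fin 3) : ContDiff ℝ 1 fun p : AmbientG => symMat (pencilMap v p.2.2 k) a b := by
        fin_cases k
        · change ContDiff ℝ 1 fun p : AmbientG =>
            p.2.2 0 0 * v 0 s(a, b) - p.2.2 0 1 * v 1 s(a, b)
          fun_prop
        · change ContDiff ℝ 1 fun p : AmbientG =>
            -(p.2.2 1 0 * v 0 s(a, b)) + p.2.2 1 1 * v 1 s(a, b)
          fun_prop
      fun_prop
  · simp only [Matrix.det_fin_three, Matrix.of_apply]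
    fun_prop
  · simp only [Matrix.det_fin_two, Matrix.of_apply]
    fun_prop

lemma hasDerivAt_of_eq_add_sq {φ : ℝ → ℝ} {c₀ c₁ r₀ r₁ r₂ : ℝ}
    (h : ∀ t, φ t = c₀ + t * c₁ + t ^ 2 * (r₀ + t * r₁ + t ^ 2 * r₂)) : HasDerivAt φ c₁ 0 := by
  rw [show φ = fun t => c₀ + t * c₁ + t ^ 2 * (r₀ + t * r₁ + t ^ 2 * r₂) from funext h]
  have h1 := hasDerivAt_id (0 : ℝ)
  have h2 := ((h1.mul_const c₁).const_add c₀).add ((h1.pow 2).mul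
    (((h1.mul_const r₁).const_add r₀).add ((h1.pow 2).mul_const r₂)))
  exact h2.congr_deriv (by simp)

/-- The identity of `G'_ℝ` in the ambient space. -/
def ambientOne : AmbientG := GR.toAmbient 1

lemma ambientAct_line (v : VR) (h : AmbientG) (k : Fin 2) (i j : Fin 3) :
    HasDerivAt (fun t : ℝ => ambientAct v (ambientOne + t • h) k s(i, j))
      ((h.1 • symMat (v k) + Matrix.of h.2.1 * symMat (v k) + symMat (v k) * (Matrix.of h.2.1)ᵀ
        + symMat (pencilMap v h.2.2 k)) i j) 0 := by
  set X := Matrix.of h.2.1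
  set M := symMat (v k)
  set N := symMat (pencilMap v h.2.2 k)
  have hN (t : ℝ) : symMat (pencilMap v (ambientOne + t • h).2.2 k) = M + t • N := by
    have h1 (a b : Fin 2) : ambientOne.2.2 a b = (1 : Matrix (Fin 2) (Fin 2) ℝ) a b := rfl
    ext a b
    change pencilMap v (ambientOne + t • h).2.2 k s(a, b)
      = v k s(a, b) + t * pencilMap v h.2.2 k s(a, b)
    fin_cases k <;> simp [pencilMap, h1] <;> ring
  have hX (t : ℝ) : Matrix.of (ambientOne + t • h).2.1 = 1 + t • X := rfl
  have hl (t : ℝ) : (ambientOne + t • h).1 = 1 + t * h.1 := rfl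
  simp only [ambientAct_apply, hN, hX, hl]
  have key (t : ℝ) : (1 + t * h.1) • ((1 + t • X) * (M + t • N) * (1 + t • X)ᵀ) =
      M + t • (h.1 • M + X * M + M * Xᵀ + N) + t ^ 2 •
        ((h.1 • (X * M + M * Xᵀ + N) + X * N + X * M * Xᵀ + N * Xᵀ)
          + t • (h.1 • (X * N + X * M * Xᵀ + N * Xᵀ) + X * N * Xᵀ)
          + t ^ 2 • (h.1 • (X * N * Xᵀ))) := by
    rw [Matrix.transpose_add, Matrix.transpose_one, Matrix.transpose_smul]
    simp only [Matrix.mul_add, Matrix.add_mul, Matrix.mul_smul, Matrix.smul_mul, one_mul, mul_one]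
    module
  refine hasDerivAt_of_eq_add_sq (c₀ := M i j)
    (r₀ := (h.1 • (X * M + M * Xᵀ + N) + X * N + X * M * Xᵀ + N * Xᵀ) i j)
    (r₁ := (h.1 • (X * N + X * M * Xᵀ + N * Xᵀ) + X * N * Xᵀ) i j)
    (r₂ := (h.1 • (X * N * Xᵀ)) i j) fun t => ?_
  have := congrFun (congrFun (key t) i) j
  simpa only [Matrix.smul_apply, Matrix.add_apply, smul_eq_mul] using this

lemma hasDerivAt_det_line_three (X : Matrix (Fin 3) (Fin 3) ℝ) :
    HasDerivAt (fun t : ℝ => (1 + t • X).det) X.trace 0 := by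
  refine hasDerivAt_of_eq_add_sq (c₀ := 1)
    (r₀ := X 0 0 * X 1 1 - X 0 1 * X 1 0 + X 0 0 * X 2 2 - X 0 2 * X 2 0 + X 1 1 * X 2 2
      - X 1 2 * X 2 1) (r₁ := X.det) (r₂ := 0) fun t => ?_
  simp [Matrix.det_fin_three, Matrix.trace_fin_three]
  ring

lemma hasDerivAt_det_line_two (X : Matrix (Fin 2) (Fin 2) ℝ) :
    HasDerivAt (fun t : ℝ => (1 + t • X).det) X.trace 0 := by
  refine hasDerivAt_of_eq_add_sq (c₀ := 1) (r₀ := X.det) (r₁ := 0) (r₂ := 0) fun t => ?_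
  simp [Matrix.det_fin_two, Matrix.trace_fin_two]
  ring

/-- The two determinant components force trace zero on a kernel vector, and the orbit component says
that it stabilizes v infinitesimally. -/
lemma fderiv_ambientMap_injective {v : VR} (hv : disc v ≠ 0) :
    Function.Injective (fderiv ℝ (ambientMap v) ambientOne) := by
  rw [injective_iff_map_eq_zero]
  intro h hh
  have h1 : HasDerivAt (fun t : ℝ => ambientMap v (ambientOne + t • h)) 0 0 := by
    have h2 : HasDerivAt (fun t : ℝ => ambientOne + t • h) h 0 := by
      simpa using ((hasDerivAt_id (0 : ℝ)).smul_const h).const_add ambientOne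
    have h3 : HasFDerivAt (ambientMap v) (fderiv ℝ (ambientMap v) ambientOne)
        (ambientOne + (0 : ℝ) • h) := by
      rw [zero_smul, add_zero]
      exact ((contDiff_ambientMap v).differentiable one_ne_zero _).hasFDerivAt
    have := h3.comp_hasDerivAt (0 : ℝ) h2
    rwa [hh] at this
  have hact : HasDerivAt (fun t : ℝ => ambientAct v (ambientOne + t • h)) 0 0 := h1.fst
  have hd3 : HasDerivAt (fun t : ℝ => (1 + t • Matrix.of h.2.1).det) 0 0 := h1.snd.fst
  have hd2 : HasDerivAt (fun t : ℝ => (1 + t • Matrix.of h.2.2).det) 0 0 := h1.snd.snd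
  have hk (k : Fin 2) : h.1 • symMat (v k) + Matrix.of h.2.1 * symMat (v k)
      + symMat (v k) * (Matrix.of h.2.1)ᵀ + symMat (pencilMap v h.2.2 k) = 0 := by
    ext i j
    exact (ambientAct_line v h k i j).unique
      (hasDerivAt_pi.1 (hasDerivAt_pi.1 hact k) s(i, j))
  obtain ⟨e1, e2, e3⟩ := infinitesimal_stabilizer hv (l := h.1) (X := Matrix.of h.2.1)
    (Y := Matrix.of h.2.2) (hk 0) (hk 1)
    ((hasDerivAt_det_line_three _).unique hd3) ((hasDerivAt_det_line_two _).unique hd2)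
  exact Prod.ext e1 (Prod.ext e2 e3)

/-- The orbit map, extended to the ambient space, is a local homeomorphism. -/
lemma exists_openPartialHomeomorph_ambientMap {v : VR} (hv : disc v ≠ 0) :
    ∃ e : OpenPartialHomeomorph AmbientG (VR × ℝ × ℝ), ambientOne ∈ e.source ∧
      ∀ p, e p = ambientMap v p := by
  -- 1 + 9 + 4 = 12 + 1 + 1.
  have hrank : Module.finrank ℝ AmbientG = Module.finrank ℝ (VR × ℝ × ℝ) := by
    have h1 : Module.finrank ℝ VR = 12 := by
      rw [Module.finrank_pi_fintype]
      simp [Sym2.card, Nat.choose]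
    have h2 (n : ℕ) : Module.finrank ℝ (Fin n → Fin n → ℝ) = n * n := by
      rw [Module.finrank_pi_fintype]
      simp
    simp only [Module.finrank_prod, h1, h2, Module.finrank_self]
  let L : AmbientG ≃L[ℝ] VR × ℝ × ℝ := (LinearEquiv.ofInjectiveOfFinrankEq
    (fderiv ℝ (ambientMap v) ambientOne).toLinearMap (fderiv_ambientMap_injective hv)
      hrank).toContinuousLinearEquiv
  have hL : (L : AmbientG →L[ℝ] VR × ℝ × ℝ) = fderiv ℝ (ambientMap v) ambientOne := by
    exact ContinuousLinearMap.ext fun x => rfl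
  have hs : HasStrictFDerivAt (ambientMap v) (L : AmbientG →L[ℝ] VR × ℝ × ℝ) ambientOne := by
    rw [hL]
    exact (contDiff_ambientMap v).contDiffAt.hasStrictFDerivAt one_ne_zero
  exact ⟨hs.toOpenPartialHomeomorph (ambientMap v), hs.mem_toOpenPartialHomeomorph_source,
    fun p => rfl⟩

instance : IsTopologicalGroup GR := inferInstanceAs (IsTopologicalGroup (ℝˣ × GLpm 3 × GLpm 2))

instance : SecondCountableTopology GR :=
  inferInstanceAs (SecondCountableTopology (ℝˣ × GLpm 3 × GLpm 2))

instance : LocallyCompactSpace GR :=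
  inferInstanceAs (LocallyCompactSpace (ℝˣ × GLpm 3 × GLpm 2))

instance : BorelSpace GR := ⟨rfl⟩

lemma isInducing_toAmbient : Topology.IsInducing GR.toAmbient := by
  have h1 : Topology.IsInducing (Units.val : ℝˣ → ℝ) := Units.isEmbedding_val₀.isInducing
  have h (n : ℕ) : Topology.IsInducing (fun g : GLpm n => (g.1.1 : Fin n → Fin n → ℝ)) :=
    (isOpenEmbedding_val_GL n).isInducing.comp Topology.IsInducing.subtypeVal
  exact h1.prodMap ((h 3).prodMap (h 2))

lemma GR.toAmbient_injective : Function.Injective GR.toAmbient := by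
  intro g h hgh
  have h1 : g.1 = h.1 := Units.ext (congrArg Prod.fst hgh)
  have h2 : g.2.1 = h.2.1 := Subtype.ext (Units.ext (congrArg (fun p : AmbientG => p.2.1) hgh))
  have h3 : g.2.2 = h.2.2 := Subtype.ext (Units.ext (congrArg (fun p : AmbientG => p.2.2) hgh))
  exact Prod.ext h1 (Prod.ext h2 h3)

lemma continuous_act_left (v : VR) : Continuous fun g : GR => act g v :=
  (contDiff_ambientMap v).continuous.fst.comp isInducing_toAmbient.continuous

lemma mem_range_toAmbient {p : AmbientG} (h1 : p.1 ≠ 0) (h3 : (Matrix.of p.2.1).det = 1)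
    (h2 : (Matrix.of p.2.2).det = 1) : p ∈ Set.range GR.toAmbient :=
  ⟨((Units.mk0 p.1 h1, ⟨Matrix.GeneralLinearGroup.mkOfDetNeZero (Matrix.of p.2.1) (by simp [h3]),
    Or.inl h3⟩, ⟨Matrix.GeneralLinearGroup.mkOfDetNeZero (Matrix.of p.2.2) (by simp [h2]),
    Or.inl h2⟩) : ℝˣ × GLpm 3 × GLpm 2), rfl⟩

lemma ambientMap_toAmbient (v : VR) (g : GR) :
    ambientMap v g.toAmbient = (act g v, g.2.1.1.1.det, g.2.2.1.1.det) := rfl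

lemma disc_act_ne_zero {v : VR} (hv : disc v ≠ 0) (g : GR) : disc (act g v) ≠ 0 := by
  rw [disc_act]
  exact mul_ne_zero (pow_ne_zero _ g.1.ne_zero) hv

/-- The orbit map of a point with nonzero discriminant is a local homeomorphism. -/
theorem exists_nhds_one_orbit {v : VR} (hv : disc v ≠ 0) :
    ∃ U : Set GR, IsOpen U ∧ 1 ∈ U ∧ U.InjOn (fun g => act g v) ∧
      (∀ O ⊆ U, IsOpen O → IsOpen ((fun g => act g v) '' O)) ∧
      discMeasure ((fun g => act g v) '' U) < ∞ := by
  obtain ⟨e, he1, he⟩ := exists_openPartialHomeomorph_ambientMap hv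
  -- On S the determinants of a group element are exactly 1, so `ambientMap` is determined there by
  -- the orbit map.
  let S : Set AmbientG := {p | p.1 ≠ 0 ∧ 0 < (Matrix.of p.2.1).det ∧ 0 < (Matrix.of p.2.2).det}
  have hS : IsOpen S := by
    have h := (contDiff_ambientMap v).continuous.snd
    exact (isOpen_ne_fun continuous_fst continuous_const).inter
      ((isOpen_lt continuous_const h.fst).inter (isOpen_lt continuous_const h.snd))
  -- Bounded, with discriminant away from zero: N has finite measure for |Disc(x)|⁻¹ dx.
  let N : Set VR := Metric.ball v 1 ∩ {y | |disc v| / 2 < |disc y|}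
  have hN : IsOpen N :=
    Metric.isOpen_ball.inter (isOpen_lt continuous_const continuous_disc.abs)
  have hvN : v ∈ N := ⟨Metric.mem_ball_self one_pos, half_lt_self (abs_pos.2 hv)⟩
  have hdet (g : GR) (hg : g.toAmbient ∈ S) : g.2.1.1.1.det = 1 ∧ g.2.2.1.1.det = 1 := by
    have h3 : 0 < g.2.1.1.1.det := hg.2.1
    have h2 : 0 < g.2.2.1.1.det := hg.2.2
    exact ⟨g.2.1.2.resolve_right fun h => by linarith, g.2.2.2.resolve_right fun h => by linarith⟩
  have hπ := continuous_act_left v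
  refine ⟨GR.toAmbient ⁻¹' (e.source ∩ S) ∩ (fun g => act g v) ⁻¹' N,
    ((e.open_source.inter hS).preimage isInducing_toAmbient.continuous).inter (hN.preimage hπ),
    ⟨⟨he1, ?_⟩, ?_⟩, ?_, ?_, ?_⟩
  · refine ⟨one_ne_zero, ?_, ?_⟩
    · change 0 < (1 : Matrix (Fin 3) (Fin 3) ℝ).det
      simp
    · change 0 < (1 : Matrix (Fin 2) (Fin 2) ℝ).det
      simp
  · simpa only [Set.mem_preimage, act_one] using hvN
  · rintro g ⟨⟨hg1, hg2⟩, -⟩ h ⟨⟨hh1, hh2⟩, -⟩ hgh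
    refine GR.toAmbient_injective (e.injOn hg1 hh1 ?_)
    rw [he, he, ambientMap_toAmbient, ambientMap_toAmbient, (hdet g hg2).1, (hdet g hg2).2,
      (hdet h hh2).1, (hdet h hh2).2]
    exact Prod.ext hgh rfl
  · intro O hO hOo
    obtain ⟨O', hO', rfl⟩ := isInducing_toAmbient.isOpen_iff.1 hOo
    have h1 : IsOpen (e '' (e.source ∩ (O' ∩ S))) :=
      e.isOpen_image_source_inter (hO'.inter hS)
    -- The image is the slice, at determinants (1, 1), of an open set.
    have h2 : (fun g => act g v) '' (GR.toAmbient ⁻¹' O')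
        = (fun y : VR => (y, (1 : ℝ), (1 : ℝ))) ⁻¹' (e '' (e.source ∩ (O' ∩ S))) := by
      ext y
      constructor
      · rintro ⟨g, hg, rfl⟩
        obtain ⟨⟨hg1, hg2⟩, -⟩ := hO hg
        refine ⟨g.toAmbient, ⟨hg1, hg, hg2⟩, ?_⟩
        rw [he, ambientMap_toAmbient, (hdet g hg2).1, (hdet g hg2).2]
      · rintro ⟨p, ⟨hp1, hp2, hp3⟩, hp⟩
        rw [he, ambientMap] at hp
        obtain ⟨hp4, hp5, hp6⟩ := Prod.ext_iff.1 hp |>.imp_right Prod.ext_iff.1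
        obtain ⟨g, rfl⟩ := mem_range_toAmbient hp3.1 hp5 hp6
        exact ⟨g, hp2, hp4⟩
    rw [h2]
    exact h1.preimage (by fun_prop)
  · have h1 : discMeasure N < ∞ := by
      rw [discMeasure, withDensity_apply _ hN.measurableSet]
      calc ∫⁻ y in N, ENNReal.ofReal |disc y|⁻¹
          ≤ ∫⁻ y in N, ENNReal.ofReal (|disc v| / 2)⁻¹ := by
            refine setLIntegral_mono measurable_const fun y hy => ?_
            exact ENNReal.ofReal_le_ofReal
              (inv_anti₀ (half_pos (abs_pos.2 hv)) (le_of_lt hy.2))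
        _ < ∞ := by
            rw [setLIntegral_const]
            exact ENNReal.mul_lt_top ENNReal.ofReal_lt_top
              ((measure_mono Set.inter_subset_left).trans_lt measure_ball_lt_top)
    refine (measure_mono ?_).trans_lt h1
    rintro _ ⟨g, hg, rfl⟩
    exact hg.2

/-! ### Integration along a countable-to-one map -/

lemma encard_eq_tsum_indicator {X Y : Type*} {π : X → Y} {D : ℕ → Set X}
    (hinj : ∀ i, (D i).InjOn π) (hdisj : Pairwise (Function.onFun Disjoint D))
    (hcov : ⋃ i, D i = Set.univ) (E : Set X) (y : Y) :
    (({x | x ∈ E ∧ π x = y}.encard : ℕ∞) : ℝ≥0∞)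
      = ∑' i, (π '' (E ∩ D i)).indicator (fun _ => (1 : ℝ≥0∞)) y := by
  -- Counting measure on the full σ-algebra supplies the countable additivity of `encard`.
  let M : MeasurableSpace X := ⊤
  have h (s : Set X) : ((s.encard : ℕ∞) : ℝ≥0∞) = @Measure.count X M s :=
    (@Measure.count_apply X M s trivial).symm
  have h1 : {x | x ∈ E ∧ π x = y} = ⋃ i, {x | x ∈ E ∩ D i ∧ π x = y} := by
    ext x
    have hx : x ∈ ⋃ i, D i := hcov ▸ Set.mem_univ x
    obtain ⟨i, hi⟩ := Set.mem_iUnion.1 hx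
    simp only [Set.mem_ofPred_eq, Set.mem_iUnion, Set.mem_inter_iff]
    exact ⟨fun hx => ⟨i, ⟨hx.1, hi⟩, hx.2⟩, fun ⟨_, hx⟩ => ⟨hx.1.1, hx.2⟩⟩
  rw [h, h1, measure_iUnion (μ := @Measure.count X M) (fun i j hij => (hdisj hij).mono (fun x hx => hx.1.2)
    (fun x hx => hx.1.2)) (fun i => trivial)]
  refine tsum_congr fun i => ?_
  rw [← h]
  by_cases hy : y ∈ π '' (E ∩ D i)
  · obtain ⟨x, hx, rfl⟩ := hy
    have : {x' | x' ∈ E ∩ D i ∧ π x' = π x} = {x} := by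
      ext x'
      simp only [Set.mem_ofPred_eq, Set.mem_singleton_iff]
      exact ⟨fun h => hinj i h.1.2 hx.2 h.2, by rintro rfl; exact ⟨hx, rfl⟩⟩
    rw [this, Set.indicator_of_mem (Set.mem_image_of_mem π hx)]
    simp
  · have : {x' | x' ∈ E ∩ D i ∧ π x' = y} = ∅ := by
      ext x'
      simp only [Set.mem_ofPred_eq, Set.mem_empty_iff_false, iff_false]
      exact fun h => hy ⟨x', h.1, h.2⟩
    rw [this, Set.indicator_of_notMem hy]
    simp

section Counting

variable {X Y : Type*} [MeasurableSpace X] [MeasurableSpace Y]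

/-- The measure on `X` that corresponds to `μ` under a map that is injective on each of the pieces
`D i`. -/
def countingMeasure (π : X → Y) (μ : Measure Y) (D : ℕ → Set X) : Measure X :=
  Measure.sum fun i => (μ.comap fun x : D i => π x).map Subtype.val

lemma setLIntegral_map_comap {π : X → Y} (μ : Measure Y) {D : Set X} (hD : MeasurableSet D)
    (hπ : MeasurableEmbedding fun x : D => π x) (E : Set X)
    (φ : Y → ℝ≥0∞) :
    ∫⁻ x in E, φ (π x) ∂((μ.comap fun x : D => π x).map Subtype.val)
      = ∫⁻ y in π '' (E ∩ D), φ y ∂μ := by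
  set f : D → Y := fun x => π x
  have hv := MeasurableEmbedding.subtype_coe hD
  have hm : Measure.map f ((μ.comap f).restrict (Subtype.val ⁻¹' E))
      = μ.restrict (π '' (E ∩ D)) := by
    ext s hs
    rw [Measure.map_apply hπ.measurable hs, Measure.restrict_apply (hπ.measurable hs),
      hπ.comap_apply, Measure.restrict_apply hs]
    congr 1
    ext y
    constructor
    · rintro ⟨x, ⟨hx1, hx2⟩, rfl⟩
      exact ⟨hx1, x, ⟨hx2, x.2⟩, rfl⟩
    · rintro ⟨hy, x, ⟨hx1, hx2⟩, rfl⟩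
      exact ⟨⟨x, hx2⟩, ⟨hy, hx1⟩, rfl⟩
  rw [hv.restrict_map, hv.lintegral_map, ← hm, hπ.lintegral_map]

/-- On each D i the map is injective and the formula is a change of variables; summation over i
turns indicators of images into the cardinality of the fibre. -/
lemma setLIntegral_countingMeasure {π : X → Y} (μ : Measure Y) {D : ℕ → Set X}
    (hD : ∀ i, MeasurableSet (D i)) (hπ : ∀ i, MeasurableEmbedding fun x : D i => π x)
    (hdisj : Pairwise (Function.onFun Disjoint D)) (hcov : ⋃ i, D i = Set.univ) {E : Set X}
    (hE : MeasurableSet E) {φ : Y → ℝ≥0∞} (hφ : Measurable φ) :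
    ∫⁻ x in E, φ (π x) ∂countingMeasure π μ D
      = ∫⁻ y, (({x | x ∈ E ∧ π x = y}.encard : ℕ∞) : ℝ≥0∞) * φ y ∂μ := by
  have hinj (i : ℕ) : (D i).InjOn π := Set.injOn_iff_injective.2 (hπ i).injective
  have him (i : ℕ) : MeasurableSet (π '' (E ∩ D i)) := by
    have h1 : π '' (E ∩ D i) = (fun x : D i => π x) '' (Subtype.val ⁻¹' E) := by
      ext y
      constructor
      · rintro ⟨x, ⟨hx1, hx2⟩, rfl⟩
        exact ⟨⟨x, hx2⟩, hx1, rfl⟩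
      · rintro ⟨x, hx, rfl⟩
        exact ⟨x, ⟨hx, x.2⟩, rfl⟩
    rw [h1]
    exact (hπ i).measurableSet_image.2 (measurable_subtype_coe hE)
  rw [countingMeasure, Measure.restrict_sum _ hE, lintegral_sum_measure]
  simp only [fun i => setLIntegral_map_comap μ (hD i) (hπ i) E φ]
  simp only [← fun i => lintegral_indicator (him i) (μ := μ) φ]
  rw [← lintegral_tsum fun i => (hφ.indicator (him i)).aemeasurable]
  refine lintegral_congr fun y => ?_
  rw [encard_eq_tsum_indicator hinj hdisj hcov, ← ENNReal.tsum_mul_right]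
  refine tsum_congr fun i => ?_
  by_cases hy : y ∈ π '' (E ∩ D i)
  · rw [Set.indicator_of_mem hy, Set.indicator_of_mem hy, one_mul]
  · rw [Set.indicator_of_notMem hy, Set.indicator_of_notMem hy, zero_mul]

end Counting

lemma discMeasure_pos_of_isOpen {O : Set VR} (hO : IsOpen O) (hne : O.Nonempty)
    (hd : ∀ y ∈ O, disc y ≠ 0) : discMeasure O ≠ 0 := by
  rw [discMeasure, withDensity_apply _ hO.measurableSet]
  intro h
  rw [lintegral_eq_zero_iff measurable_discDensity, Filter.EventuallyEq,
    ae_restrict_iff' hO.measurableSet] at h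
  have h1 : (volume : Measure VR) O = 0 := by
    refine measure_mono_null (fun y hy => ?_) h
    simp only [Set.mem_compl_iff, Set.mem_ofPred_eq, Pi.zero_apply, ENNReal.ofReal_eq_zero, not_le,
      Classical.not_imp]
    exact ⟨hy, inv_pos.2 (abs_pos.2 (hd y hy))⟩
  exact (hO.measure_pos volume hne).ne' h1

/-! ### The Haar measure defined by the orbit map -/

/-- The measure on `G'_ℝ` that corresponds to `|Disc(x)|⁻¹ dx` under the orbit map is a Haar
measure. -/
theorem exists_isHaarMeasure_orbit {v : VR} (hv : disc v ≠ 0) :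
    ∃ m : Measure GR, m.IsHaarMeasure ∧ ∀ E : Set GR, MeasurableSet E → ∀ φ : VR → ℝ≥0∞,
      Measurable φ → ∫⁻ g in E, φ (act g v) ∂m
        = ∫⁻ y, (({g | g ∈ E ∧ act g v = y}.encard : ℕ∞) : ℝ≥0∞) * φ y ∂discMeasure := by
  obtain ⟨U, hUo, hU1, hUinj, hUopen, hUfin⟩ := exists_nhds_one_orbit hv
  set π : GR → VR := fun g => act g v with hπ
  have hπc : Continuous π := continuous_act_left v
  let h : ℕ → GR := TopologicalSpace.denseSeq GR
  -- Translates of U by a dense sequence cover the group, and equivariance makes the orbit map an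
  -- open embedding on each of them.
  let V : ℕ → Set GR := fun i => (fun g => (h i)⁻¹ * g) ⁻¹' U
  have hVo (i : ℕ) : IsOpen (V i) := hUo.preimage (continuous_const_mul _)
  have hcovV : ⋃ i, V i = Set.univ := by
    refine Set.eq_univ_of_forall fun g => Set.mem_iUnion.2 ?_
    have h1 : IsOpen ((fun x : GR => x⁻¹ * g) ⁻¹' U) :=
      hUo.preimage (continuous_inv.mul continuous_const)
    exact (TopologicalSpace.denseRange_denseSeq GR).exists_mem_open h1 ⟨g, by simpa using hU1⟩
  have hVinj (i : ℕ) : (V i).InjOn π := by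
    intro x hx y hy hxy
    have h1 : π ((h i)⁻¹ * x) = π ((h i)⁻¹ * y) := by
      simp only [hπ, act_mul] at hxy ⊢
      rw [hxy]
    exact mul_left_cancel (hUinj hx hy h1)
  have hVopen (i : ℕ) (O : Set GR) (hO : O ⊆ V i) (hOo : IsOpen O) : IsOpen (π '' O) := by
    have h1 := hUopen ((fun g => (h i)⁻¹ * g) '' O) (by
      rintro _ ⟨g, hg, rfl⟩
      exact hO hg) (isOpenMap_mul_left _ _ hOo)
    have h2 : π '' O = act (h i)⁻¹ ⁻¹' (π '' ((fun g => (h i)⁻¹ * g) '' O)) := by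
      ext y
      constructor
      · rintro ⟨g, hg, rfl⟩
        exact ⟨_, ⟨g, hg, rfl⟩, act_mul _ _ _⟩
      · rintro ⟨_, ⟨g, hg, rfl⟩, hy⟩
        refine ⟨g, hg, ?_⟩
        have h3 := congrArg (act (h i)) hy
        simp only [hπ] at h3 ⊢
        rw [act_mul, act_act_inv, act_act_inv] at h3
        exact h3
    rw [h2]
    exact h1.preimage (continuous_act_right _)
  have hVemb (i : ℕ) : MeasurableEmbedding fun x : V i => π x := by
    refine (Topology.IsOpenEmbedding.of_continuous_injective_isOpenMap
      (hπc.comp continuous_subtype_val) (Set.injOn_iff_injective.1 (hVinj i)) ?_).measurableEmbedding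
    intro O hO
    rw [Set.image_comp]
    refine hVopen i _ ?_ ((hVo i).isOpenMap_subtype_val _ hO)
    rintro _ ⟨x, -, rfl⟩
    exact x.2
  let D := disjointed V
  have hDV (i : ℕ) : D i ⊆ V i := disjointed_subset V i
  have hD (i : ℕ) : MeasurableSet (D i) :=
    MeasurableSet.disjointed (fun i => (hVo i).measurableSet) i
  have hDemb (i : ℕ) : MeasurableEmbedding fun x : D i => π x := by
    refine ⟨Set.injOn_iff_injective.1 ((hVinj i).mono (hDV i)),
      (hπc.comp continuous_subtype_val).measurable, fun A hA => ?_⟩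
    have h1 : (fun x : D i => π x) '' A
        = (fun x : V i => π x) '' (Subtype.val ⁻¹' (Subtype.val '' A)) := by
      ext y
      constructor
      · rintro ⟨x, hx, rfl⟩
        exact ⟨⟨x, hDV i x.2⟩, ⟨x, hx, rfl⟩, rfl⟩
      · rintro ⟨x, ⟨x', hx', hxx'⟩, rfl⟩
        exact ⟨x', hx', congrArg π hxx'⟩
    rw [h1]
    exact (hVemb i).measurableSet_image.2 (measurable_subtype_coe ((hD i).subtype_image hA))
  have hdisj : Pairwise (Function.onFun Disjoint D) := disjoint_disjointed V
  have hcov : ⋃ i, D i = Set.univ := by rw [iUnion_disjointed, hcovV]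
  set m := countingMeasure π discMeasure D with hm
  have key (E : Set GR) (hE : MeasurableSet E) (φ : VR → ℝ≥0∞) (hφ : Measurable φ) :=
    setLIntegral_countingMeasure discMeasure hD hDemb hdisj hcov hE hφ
  have hmE (E : Set GR) (hE : MeasurableSet E) :
      m E = ∫⁻ y, (({g | g ∈ E ∧ π g = y}.encard : ℕ∞) : ℝ≥0∞) ∂discMeasure := by
    have := key E hE (fun _ => 1) measurable_const
    simpa using this
  -- The part of the fibre over xy in E is x times the part of the fibre over y in x⁻¹E, and
  -- |Disc|⁻¹ dx is invariant.
  have hinv : m.IsMulLeftInvariant := by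
    refine ⟨fun x => ?_⟩
    ext E hE
    rw [Measure.map_apply (measurable_const_mul x) hE, hmE _ (measurable_const_mul x hE), hmE _ hE,
      ← (measurePreserving_act x).lintegral_comp_emb
        ((MeasurableEquiv.mk ⟨act x, act x⁻¹, act_inv_act x, act_act_inv x⟩
          (continuous_act_right x).measurable
          (continuous_act_right x⁻¹).measurable).measurableEmbedding)
        (fun y => (({g | g ∈ E ∧ π g = y}.encard : ℕ∞) : ℝ≥0∞))]
    refine lintegral_congr fun y => ?_
    congr 1
    have h1 : {g | g ∈ E ∧ π g = act x y}
        = (fun g => x * g) '' {g | g ∈ (fun g => x * g) ⁻¹' E ∧ π g = y} := by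
      ext g
      constructor
      · rintro ⟨hg1, hg2⟩
        refine ⟨x⁻¹ * g, ⟨by simpa using hg1, ?_⟩, by simp⟩
        simp only [hπ] at hg2 ⊢
        rw [act_mul, hg2, act_inv_act]
      · rintro ⟨g, ⟨hg1, hg2⟩, rfl⟩
        refine ⟨hg1, ?_⟩
        simp only [hπ] at hg2 ⊢
        rw [act_mul, hg2]
    rw [h1, (mul_right_injective x).injOn.encard_image]
  have hfibre (y : VR) : {g | g ∈ U ∧ π g = y}.encard ≤ 1 :=
    Set.encard_le_one_iff.2 fun a b ha hb => hUinj ha.1 hb.1 (ha.2.trans hb.2.symm)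
  have hUm : m U = discMeasure (π '' U) := by
    have hUi : MeasurableSet (π '' U) := (hUopen U le_rfl hUo).measurableSet
    rw [hmE U hUo.measurableSet, ← lintegral_indicator_one hUi]
    refine lintegral_congr fun y => ?_
    by_cases hy : y ∈ π '' U
    · obtain ⟨g, hg, rfl⟩ := hy
      have h1 : {g' | g' ∈ U ∧ π g' = π g}.encard = 1 :=
        le_antisymm (hfibre _) (Set.one_le_encard_iff_nonempty.2 ⟨g, hg, rfl⟩)
      rw [h1, Set.indicator_of_mem (Set.mem_image_of_mem π hg)]
      simp
    · have h1 : {g' | g' ∈ U ∧ π g' = y} = ∅ := by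
        ext g
        simp only [Set.mem_ofPred_eq, Set.mem_empty_iff_false, iff_false]
        exact fun h => hy ⟨g, h.1, h.2⟩
      rw [h1, Set.indicator_of_notMem hy]
      simp
  have hUpos (O : Set GR) (hO : O ⊆ U) (hOo : IsOpen O) (hne : O.Nonempty) : m O ≠ 0 := by
    intro h0
    refine discMeasure_pos_of_isOpen (hUopen O hO hOo) (hne.image π) ?_ ?_
    · rintro _ ⟨g, -, rfl⟩
      exact disc_act_ne_zero hv g
    · rw [hmE O hOo.measurableSet] at h0
      refine le_antisymm ?_ zero_le
      rw [← h0, ← lintegral_indicator_one (hUopen O hO hOo).measurableSet]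
      refine lintegral_mono fun y => ?_
      by_cases hy : y ∈ π '' O
      · rw [Set.indicator_of_mem hy]
        obtain ⟨g, hg, rfl⟩ := hy
        have : (1 : ℕ∞) ≤ {g' | g' ∈ O ∧ π g' = π g}.encard :=
          Set.one_le_encard_iff_nonempty.2 ⟨g, hg, rfl⟩
        rw [Pi.one_apply]
        rw [← ENat.toENNReal_one]
        exact ENat.toENNReal_le.2 this
      · rw [Set.indicator_of_notMem hy]
        exact zero_le
  obtain ⟨K, hK, hK1, hKU⟩ := exists_compact_subset hUo hU1
  refine ⟨m, Measure.isHaarMeasure_of_isCompact_nonempty_interior m K hK ⟨1, hK1⟩ ?_ ?_, key⟩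
  · intro h0
    exact hUpos (interior K) (interior_subset.trans hKU) isOpen_interior ⟨1, hK1⟩
      (measure_mono_null interior_subset h0)
  · exact ((measure_mono hKU).trans_lt (hUm ▸ hUfin)).ne

/-! ### Powers integrated over the multiplicative group -/

lemma lintegral_units_pow_ne_zero (μ : Measure ℝˣ) [μ.IsHaarMeasure] (n : ℕ) :
    ∫⁻ x in {x : ℝˣ | 0 < (x : ℝ) ∧ (x : ℝ) < 1}, ENNReal.ofReal (|(x : ℝ)| ^ n) ∂μ ≠ 0 := by
  have ho : IsOpen {x : ℝˣ | 0 < (x : ℝ) ∧ (x : ℝ) < 1} :=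
    (isOpen_lt continuous_const Units.continuous_val).inter
      (isOpen_lt Units.continuous_val continuous_const)
  have hm : Measurable fun x : ℝˣ => ENNReal.ofReal (|(x : ℝ)| ^ n) :=
    (Units.continuous_val.abs.pow n).measurable.ennreal_ofReal
  rw [← pos_iff_ne_zero, setLIntegral_pos_iff hm]
  refine (ho.measure_pos μ ⟨Units.mk0 (1 / 2) (by norm_num), by norm_num⟩).trans_le
    (measure_mono fun x hx => ⟨?_, hx⟩)
  rw [Function.mem_support]
  have : 0 < |(x : ℝ)| ^ n := pow_pos (abs_pos.2 x.ne_zero) n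
  exact (ENNReal.ofReal_pos.2 this).ne'

/-- The dyadic pieces of (0, 1) are translates of one another, so they have equal Haar measure,
while the integrand is at most 2⁻ᵏ on the k-th: a geometric series. -/
lemma lintegral_units_pow_lt_top (μ : Measure ℝˣ) [μ.IsHaarMeasure] {n : ℕ} (hn : n ≠ 0) :
    ∫⁻ x in {x : ℝˣ | 0 < (x : ℝ) ∧ (x : ℝ) < 1}, ENNReal.ofReal (|(x : ℝ)| ^ n) ∂μ < ∞ := by
  let h : ℝˣ := Units.mk0 (1 / 2) (by norm_num)
  have hh : (h : ℝ) = 1 / 2 := rfl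
  let A : ℕ → Set ℝˣ := fun k => {x | (1 / 2 : ℝ) ^ (k + 1) < x ∧ (x : ℝ) ≤ (1 / 2) ^ k}
  have hA0 : μ (A 0) < ∞ := by
    have hc : IsCompact (Units.val ⁻¹' Set.Icc (1 / 2 : ℝ) 1 : Set ℝˣ) := by
      rw [Units.isEmbedding_val₀.isCompact_iff, Set.image_preimage_eq_of_subset]
      · exact isCompact_Icc
      · intro x hx
        exact ⟨Units.mk0 x (by linarith [hx.1]), rfl⟩
    refine (measure_mono fun x hx => ?_).trans_lt hc.measure_lt_top
    simp only [A, Set.mem_ofPred_eq] at hx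
    norm_num at hx
    exact ⟨hx.1.le, hx.2⟩
  have hA (k : ℕ) : μ (A k) = μ (A 0) := by
    rw [← measure_preimage_mul μ (h ^ k) (A k)]
    congr 1
    ext x
    have hk : (0 : ℝ) < (1 / 2) ^ k := by positivity
    simp only [A, Set.mem_preimage, Set.mem_ofPred_eq, Units.val_mul, Units.val_pow_eq_pow_val, hh,
      pow_succ, pow_zero, one_mul]
    rw [mul_lt_mul_iff_right₀ hk, mul_le_iff_le_one_right hk]
  calc ∫⁻ x in {x : ℝˣ | 0 < (x : ℝ) ∧ (x : ℝ) < 1}, ENNReal.ofReal (|(x : ℝ)| ^ n) ∂μ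
      ≤ ∫⁻ x in ⋃ k, A k, ENNReal.ofReal (|(x : ℝ)| ^ n) ∂μ := by
        refine lintegral_mono_set fun x hx => Set.mem_iUnion.2 ?_
        obtain ⟨k, hk1, hk2⟩ := exists_nat_pow_near_of_lt_one hx.1 hx.2.le
          (by norm_num : (0 : ℝ) < 1 / 2) (by norm_num)
        exact ⟨k, hk1, hk2⟩
    _ ≤ ∑' k, ∫⁻ x in A k, ENNReal.ofReal (|(x : ℝ)| ^ n) ∂μ := lintegral_iUnion_le _ _
    _ ≤ ∑' k : ℕ, ENNReal.ofReal (1 / 2) ^ k * μ (A 0) := by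
        refine ENNReal.tsum_le_tsum fun k => ?_
        rw [← hA k, ← setLIntegral_const]
        refine setLIntegral_mono measurable_const fun x hx => ?_
        rw [← ENNReal.ofReal_pow (by norm_num)]
        refine ENNReal.ofReal_le_ofReal ?_
        have hx0 : 0 < (x : ℝ) := lt_trans (by positivity) hx.1
        have hx1 : (x : ℝ) ≤ 1 := hx.2.trans (pow_le_one₀ (by norm_num) (by norm_num))
        rw [abs_of_pos hx0]
        exact (pow_le_of_le_one hx0.le hx1 hn).trans hx.2
    _ < ∞ := by
        rw [ENNReal.tsum_mul_right, ENNReal.tsum_geometric]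
        refine ENNReal.mul_lt_top (ENNReal.inv_lt_top.2 ?_) hA0
        rw [tsub_pos_iff_lt, ← ENNReal.ofReal_one]
        exact (ENNReal.ofReal_lt_ofReal_iff one_pos).2 (by norm_num)

/-! ### Haar measure on G'_ℝ as a product measure -/

/-- The group `G'_ℝ` as a product. -/
def GR.ofProd : ℝˣ × GLpm 3 × GLpm 2 ≃* GR where
  toFun q := q
  invFun g := g
  left_inv _ := rfl
  right_inv _ := rfl
  map_mul' _ _ := rfl

lemma GR.continuous_ofProd : Continuous GR.ofProd :=
  (continuous_id : Continuous (id : ℝˣ × GLpm 3 × GLpm 2 → _))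

lemma GR.continuous_ofProd_symm : Continuous GR.ofProd.symm :=
  (continuous_id : Continuous (id : ℝˣ × GLpm 3 × GLpm 2 → _))

lemma GR.continuous_fst : Continuous fun g : GR => g.1 :=
  (_root_.continuous_fst : Continuous (Prod.fst : ℝˣ × GLpm 3 × GLpm 2 → ℝˣ))

lemma GR.continuous_snd_fst : Continuous fun g : GR => g.2.1 :=
  (_root_.continuous_fst.comp _root_.continuous_snd :
    Continuous (fun q : ℝˣ × GLpm 3 × GLpm 2 => q.2.1))

lemma GR.continuous_snd_snd : Continuous fun g : GR => g.2.2 :=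
  (_root_.continuous_snd.comp _root_.continuous_snd :
    Continuous (fun q : ℝˣ × GLpm 3 × GLpm 2 => q.2.2))

instance : BorelSpace (GLpm 3 × GLpm 2) := Prod.borelSpace

instance : BorelSpace (ℝˣ × GLpm 3 × GLpm 2) := Prod.borelSpace

/-- The product of Haar measures on the factors of `G'_ℝ`. -/
def haarGR : Measure GR :=
  Measure.map GR.ofProd ((Measure.haar : Measure ℝˣ).prod ((haarGLpm 3).prod (haarGLpm 2)))

instance : haarGR.IsHaarMeasure := by
  have : ((Measure.haar : Measure ℝˣ).prod ((haarGLpm 3).prod (haarGLpm 2))).IsHaarMeasure :=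
    Measure.prod.instIsHaarMeasure _ _
  exact MulEquiv.isHaarMeasure_map (G := ℝˣ × GLpm 3 × GLpm 2) _ GR.ofProd GR.continuous_ofProd
    GR.continuous_ofProd_symm

/-- The product of subsets of the factors of `G'_ℝ`. -/
def GR.box (F₁ : Set ℝˣ) (F₃ : Set (GLpm 3)) (F₂ : Set (GLpm 2)) : Set GR :=
  {g | g.1 ∈ F₁ ∧ g.2.1 ∈ F₃ ∧ g.2.2 ∈ F₂}

lemma GR.measurableSet_box {F₁ : Set ℝˣ} {F₃ : Set (GLpm 3)} {F₂ : Set (GLpm 2)}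
    (h₁ : MeasurableSet F₁) (h₃ : MeasurableSet F₃) (h₂ : MeasurableSet F₂) :
    MeasurableSet (GR.box F₁ F₃ F₂) :=
  (GR.continuous_fst.measurable h₁).inter
    ((GR.continuous_snd_fst.measurable h₃).inter (GR.continuous_snd_snd.measurable h₂))

lemma setLIntegral_haarGR {F₁ : Set ℝˣ} {F₃ : Set (GLpm 3)} {F₂ : Set (GLpm 2)}
    (h₁ : MeasurableSet F₁) (h₃ : MeasurableSet F₃) (h₂ : MeasurableSet F₂) {f : ℝˣ → ℝ≥0∞}
    (hf : Measurable f) :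
    ∫⁻ g in GR.box F₁ F₃ F₂, f g.1 ∂haarGR
      = (∫⁻ x in F₁, f x ∂Measure.haar) * (haarGLpm 3 F₃ * haarGLpm 2 F₂) := by
  have hf' : Measurable fun g : GR => f g.1 := hf.comp GR.continuous_fst.measurable
  rw [haarGR]
  refine (setLIntegral_map (GR.measurableSet_box h₁ h₃ h₂) hf'
    GR.continuous_ofProd.measurable).trans ?_
  have h : GR.ofProd ⁻¹' GR.box F₁ F₃ F₂ = F₁ ×ˢ (F₃ ×ˢ F₂) := rfl
  rw [h, ← Measure.prod_restrict]
  change ∫⁻ q : ℝˣ × GLpm 3 × GLpm 2, f q.1 ∂_ = _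
  have h2 := lintegral_prod_mul (μ := (Measure.haar : Measure ℝˣ).restrict F₁)
    (ν := ((haarGLpm 3).prod (haarGLpm 2)).restrict (F₃ ×ˢ F₂)) (f := f) (g := fun _ => 1)
    hf.aemeasurable aemeasurable_const
  simp only [mul_one, lintegral_const, Measure.restrict_apply_univ, one_mul] at h2
  rw [h2, Measure.prod_prod]

/-! ### A fundamental domain for `G'_ℤ` -/

instance : Countable GZ := by
  have h : (Set.range (Units.map (Int.castRingHom ℝ : ℤ →* ℝ)) ×ˢ
      (((GLInt 3).subgroupOf (GLpm 3) : Set (GLpm 3)) ×ˢ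
        ((GLInt 2).subgroupOf (GLpm 2) : Set (GLpm 2)))).Countable :=
    (Set.countable_range _).prod
      ((Set.countable_coe_iff.1 (inferInstanceAs (Countable ((GLInt 3).subgroupOf (GLpm 3))))).prod
        (Set.countable_coe_iff.1 (inferInstanceAs (Countable ((GLInt 2).subgroupOf (GLpm 2))))))
  exact h.to_subtype

lemma GR.box_existsUnique {F₃ : Set (GLpm 3)} {F₂ : Set (GLpm 2)}
    (h₃ : ∀ g : GLpm 3, ∃! γ : (GLInt 3).subgroupOf (GLpm 3), γ • g ∈ F₃)
    (h₂ : ∀ g : GLpm 2, ∃! γ : (GLInt 2).subgroupOf (GLpm 2), γ • g ∈ F₂) (g : GR) :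
    ∃! γ : GZ, γ • g ∈ GR.box {x | 0 < (x : ℝ)} F₃ F₂ := by
  obtain ⟨γ₃, h3, h3'⟩ := h₃ g.2.1
  obtain ⟨γ₂, h2, h2'⟩ := h₂ g.2.2
  have hneg : (-1 : ℝˣ) ∈ (Units.map (Int.castRingHom ℝ : ℤ →* ℝ)).range := ⟨-1, by ext; simp⟩
  have hunits (x : ℝˣ) (hx : x ∈ (Units.map (Int.castRingHom ℝ : ℤ →* ℝ)).range) :
      x = 1 ∨ x = -1 := by
    obtain ⟨u, rfl⟩ := hx
    rcases Int.units_eq_one_or u with rfl | rfl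
    · left; ext; simp
    · right; ext; simp
  obtain ⟨ε, hε, hεg⟩ : ∃ ε ∈ (Units.map (Int.castRingHom ℝ : ℤ →* ℝ)).range,
      0 < ((ε * g.1 : ℝˣ) : ℝ) := by
    rcases lt_or_gt_of_ne g.1.ne_zero with h | h
    · exact ⟨-1, hneg, by simpa using h⟩
    · exact ⟨1, one_mem _, by simpa using h⟩
  refine ⟨⟨((ε, γ₃.1, γ₂.1) : ℝˣ × GLpm 3 × GLpm 2), ⟨hε, γ₃.2, γ₂.2⟩⟩, ⟨hεg, h3, h2⟩, ?_⟩
  rintro ⟨δ, hδ1, hδ3, hδ2⟩ ⟨hδ4, hδ5, hδ6⟩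
  have e3 := h3' ⟨δ.2.1, hδ3⟩ hδ5
  have e2 := h2' ⟨δ.2.2, hδ2⟩ hδ6
  have e1 : δ.1 = ε := by
    have hδ4' : 0 < ((δ.1 * g.1 : ℝˣ) : ℝ) := hδ4
    rcases hunits _ hδ1 with h | h <;> rcases hunits _ hε with h' | h' <;> rw [h, h'] <;>
      rw [h] at hδ4' <;> rw [h'] at hεg <;> simp at hδ4' hεg <;> linarith
  refine Subtype.ext (Prod.ext e1 (Prod.ext ?_ ?_))
  · exact congrArg Subtype.val e3
  · exact congrArg Subtype.val e2

/-! ### Volumes as integrals over a fundamental domain -/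

lemma regionW_mono {F F' : Set GR} (hF : F ⊆ F') {W W' : Set S2} (hW : W ⊆ W') (v : VR) (X : ℝ)
    (x : VR) : regionW F v X W x ≤ regionW F' v X W' x :=
  Set.encard_le_encard fun _ hg => ⟨hF hg.1, hg.2.1, hg.2.2.1, hW hg.2.2.2⟩

lemma Vol_mono {m m' : VR → ℕ∞} (h : ∀ x, m x ≤ m' x) : Vol m ≤ Vol m' :=
  lintegral_mono fun x => ENat.toENNReal_le.2 (h x)

lemma region_eq_regionW_univ (F : Set GR) (v : VR) (X : ℝ) :
    region F v X = regionW F v X Set.univ := by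
  ext x
  simp [region, regionW]

/-- The elements of `G'_ℝ` with `|λ| < 1` that move a point of shape `k` to a point with shape
in `W`. -/
def shapeSet (k : GL (Fin 2) ℝ) (W : Set S2) : Set GR :=
  {g | |(g.1 : ℝ)| < 1 ∧ S2.mk (g.2.2.1 * k) ∈ W}

lemma measurableSet_shapeSet (k : GL (Fin 2) ℝ) {W : Set S2} (hW : MeasurableSet W) :
    MeasurableSet (shapeSet k W) := by
  have h1 : Continuous fun g : GR => |(g.1 : ℝ)| :=
    (Units.continuous_val.comp GR.continuous_fst).abs
  have h2 : Continuous fun g : GR => S2.mk (g.2.2.1 * k) :=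
    S2.continuous_mk.comp ((continuous_subtype_val.comp GR.continuous_snd_snd).mul continuous_const)
  exact (measurableSet_lt h1.measurable measurable_const).inter (h2.measurable hW)

/-- The density of the volume with respect to Haar measure. -/
def volDensity (g : GR) : ℝ≥0∞ := ENNReal.ofReal (|(g.1 : ℝ)| ^ 12)

/-- Taking φ = |Disc| converts |Disc|⁻¹ dx back to Lebesgue measure. On the orbit |Disc(gv)| =
|λ|¹², which gives both the density and the condition |λ| < 1. -/
lemma Vol_regionW {v : VR} (hdisc : |disc v| = 1) {k : GL (Fin 2) ℝ}
    (hk : ∀ g : GR, shape (act g v) = S2.mk (g.2.2.1 * k)) {m : Measure GR}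
    (hm : ∀ E : Set GR, MeasurableSet E → ∀ φ : VR → ℝ≥0∞, Measurable φ →
      ∫⁻ g in E, φ (act g v) ∂m
        = ∫⁻ y, (({g | g ∈ E ∧ act g v = y}.encard : ℕ∞) : ℝ≥0∞) * φ y ∂discMeasure)
    {F : Set GR} (hF : MeasurableSet F) {W : Set S2} (hW : MeasurableSet W) :
    Vol (regionW F v 1 W) = ∫⁻ g in F, (shapeSet k W).indicator volDensity g ∂m := by
  have hv : disc v ≠ 0 := fun h => by simp [h] at hdisc
  have hS := measurableSet_shapeSet k hW
  have habs (g : GR) : |disc (act g v)| = |(g.1 : ℝ)| ^ 12 := by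
    rw [disc_act, abs_mul, hdisc, mul_one, abs_pow]
  have h1 := hm (shapeSet k W ∩ F) (hS.inter hF) (fun y => ENNReal.ofReal |disc y|)
    continuous_disc.abs.measurable.ennreal_ofReal
  simp only [habs] at h1
  rw [setLIntegral_indicator hS]
  refine Eq.trans ?_ h1.symm
  rw [discMeasure, lintegral_withDensity_eq_lintegral_mul_non_measurable _ measurable_discDensity
    (Filter.Eventually.of_forall fun _ => ENNReal.ofReal_lt_top), Vol]
  refine lintegral_congr fun y => ?_
  have h2 : {g | g ∈ F ∧ act g v = y ∧ |disc y| < 1 ∧ shape y ∈ W}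
      = {g | g ∈ shapeSet k W ∩ F ∧ act g v = y} := by
    ext g
    simp only [Set.mem_ofPred_eq, Set.mem_inter_iff, shapeSet]
    constructor
    · rintro ⟨h3, rfl, h4, h5⟩
      rw [habs, pow_lt_one_iff_of_nonneg (abs_nonneg _) (by norm_num)] at h4
      exact ⟨⟨⟨h4, hk g ▸ h5⟩, h3⟩, rfl⟩
    · rintro ⟨⟨⟨h4, h5⟩, h3⟩, rfl⟩
      refine ⟨h3, rfl, ?_, (hk g).symm ▸ h5⟩
      rwa [habs, pow_lt_one_iff_of_nonneg (abs_nonneg _) (by norm_num)]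
  rw [regionW, h2, Pi.mul_apply]
  -- Where Disc = 0 the density has the default value 0⁻¹ = 0, but such points have multiplicity
  -- zero.
  by_cases hy : disc y = 0
  · have h3 : {g | g ∈ shapeSet k W ∩ F ∧ act g v = y} = ∅ := by
      ext g
      simp only [Set.mem_ofPred_eq, Set.mem_empty_iff_false, iff_false]
      rintro ⟨-, rfl⟩
      exact disc_act_ne_zero hv g hy
    rw [h3]
    simp
  · rw [mul_left_comm, ← ENNReal.ofReal_mul (by positivity),
      inv_mul_cancel₀ (abs_ne_zero.2 hy), ENNReal.ofReal_one, mul_one]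

/-- Invariance under G'_ℤ makes the integral independent of the fundamental domain. -/
lemma indicator_volDensity_smul {k : GL (Fin 2) ℝ} (W : Set S2) (γ : GZ) (g : GR) :
    (shapeSet k W).indicator volDensity (γ • g) = (shapeSet k W).indicator volDensity g := by
  obtain ⟨γ, ⟨u, hu⟩, -, h2⟩ := γ
  have hu' : |(γ.1 : ℝ)| = 1 := by
    rw [← hu]
    rcases Int.units_eq_one_or u with rfl | rfl <;> simp
  have h1 : |((γ * g).1 : ℝ)| = |(g.1 : ℝ)| := by
    rw [GR.fst_mul, Units.val_mul, abs_mul, hu', one_mul]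
  have h3 : S2.mk ((γ * g).2.2.1 * k) = S2.mk (g.2.2.1 * k) := by
    have h4 : γ.2.2.1 ∈ GLInt 2 := h2
    rw [GR.snd_snd_mul, Subgroup.coe_mul, mul_assoc, S2.mk_mul_left h4]
  change (shapeSet k W).indicator volDensity (γ * g) = _
  have h5 : γ * g ∈ shapeSet k W ↔ g ∈ shapeSet k W := by
    simp only [shapeSet, Set.mem_ofPred_eq, h1, h3]
  have h6 : volDensity (γ * g) = volDensity g := by rw [volDensity, volDensity, h1]
  by_cases hg : g ∈ shapeSet k W
  · rw [Set.indicator_of_mem hg, Set.indicator_of_mem (h5.2 hg), h6]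
  · rw [Set.indicator_of_notMem hg, Set.indicator_of_notMem (fun h => hg (h5.1 h))]

/-- The integral over a fundamental domain that gives the volumes of the regions. -/
lemma exists_setLIntegral_fundamentalDomain (m : Measure GR) [m.IsHaarMeasure]
    {k : GL (Fin 2) ℝ} (hk : k ∈ GLInt 2) :
    ∃ K : ℝ≥0∞, K ≠ 0 ∧ K ≠ ∞ ∧ ∀ F : Set GR, IsFundamentalDomain GZ F m →
      ∀ W : Set S2, MeasurableSet W →
        ∫⁻ g in F, (shapeSet k W).indicator volDensity g ∂m = K * shapeMeasure W := by
  obtain ⟨F₃, hF₃, h₃⟩ := exists_fundamentalDomain_GLInt 3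
  obtain ⟨F₂, hF₂, h₂⟩ := exists_fundamentalDomain_GLInt 2
  have h₃' : IsFundamentalDomain ((GLInt 3).subgroupOf (GLpm 3)) F₃ (haarGLpm 3) :=
    IsFundamentalDomain.mk' hF₃.nullMeasurableSet h₃
  have hpos : MeasurableSet {x : ℝˣ | 0 < (x : ℝ)} :=
    (isOpen_lt continuous_const Units.continuous_val).measurableSet
  have hI : MeasurableSet {x : ℝˣ | 0 < (x : ℝ) ∧ (x : ℝ) < 1} :=
    hpos.inter (isOpen_lt Units.continuous_val continuous_const).measurableSet
  have hbox := GR.measurableSet_box hpos hF₃ hF₂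
  have hfd : IsFundamentalDomain GZ (GR.box {x : ℝˣ | 0 < (x : ℝ)} F₃ F₂) m :=
    IsFundamentalDomain.mk' hbox.nullMeasurableSet (GR.box_existsUnique h₃ h₂)
  -- By uniqueness of Haar measure m may be replaced by the product measure, up to a nonzero
  -- constant.
  set c := m.haarScalarFactor haarGR with hc
  have hmc : m = c • haarGR := Measure.isMulLeftInvariant_eq_smul m haarGR
  have hc0 : c ≠ 0 := by
    intro h0
    rw [h0, zero_smul] at hmc
    exact (NeZero.ne m) hmc
  set J := ∫⁻ x in {x : ℝˣ | 0 < (x : ℝ) ∧ (x : ℝ) < 1}, ENNReal.ofReal (|(x : ℝ)| ^ 12)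
    ∂Measure.haar with hJ
  refine ⟨c * (J * (haarGLpm 3 F₃ * (2 * haarShapeConst))), ?_, ?_, fun F hF W hW => ?_⟩
  · exact mul_ne_zero (by simpa using hc0) (mul_ne_zero (lintegral_units_pow_ne_zero _ _)
      (mul_ne_zero (h₃'.measure_ne_zero (NeZero.ne _))
        (mul_ne_zero two_ne_zero haarShapeConst_ne_zero)))
  · exact ENNReal.mul_ne_top ENNReal.coe_ne_top
      (ENNReal.mul_ne_top (lintegral_units_pow_lt_top _ (by norm_num)).ne
        (ENNReal.mul_ne_top (haarGLpm_three_lt_top h₃').ne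
          (ENNReal.mul_ne_top (by norm_num) haarShapeConst_lt_top.ne)))
  · have hS := measurableSet_shapeSet k hW
    -- On the product domain λ > 0, so the region of integration is again a box and the integral
    -- factors.
    rw [hF.setLIntegral_eq hfd _ (indicator_volDensity_smul W), setLIntegral_indicator hS]
    have h2 : MeasurableSet {g : GLpm 2 | S2.mk (g.1 * k) ∈ W} :=
      (S2.continuous_mk.comp (continuous_subtype_val.mul continuous_const)).measurable hW
    have h1 : shapeSet k W ∩ GR.box {x : ℝˣ | 0 < (x : ℝ)} F₃ F₂
        = GR.box {x : ℝˣ | 0 < (x : ℝ) ∧ (x : ℝ) < 1} F₃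
          (F₂ ∩ {g : GLpm 2 | S2.mk (g.1 * k) ∈ W}) := by
      ext g
      simp only [shapeSet, GR.box, Set.mem_inter_iff, Set.mem_ofPred_eq]
      constructor
      · rintro ⟨⟨h4, h5⟩, h6, h7, h8⟩
        exact ⟨⟨h6, by rwa [abs_of_pos h6] at h4⟩, h7, h8, h5⟩
      · rintro ⟨⟨h6, h4⟩, h7, h8, h5⟩
        exact ⟨⟨by rwa [abs_of_pos h6], h5⟩, h6, h7, h8⟩
    have h3 := setLIntegral_haarGR hI hF₃ (hF₂.inter h2)
      (f := fun x : ℝˣ => ENNReal.ofReal (|(x : ℝ)| ^ 12))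
      (Units.continuous_val.abs.pow 12).measurable.ennreal_ofReal
    rw [haarGLpm_two_shape hF₂ h₂ hk hW] at h3
    rw [h1, hmc, Measure.restrict_smul, lintegral_smul_measure]
    refine (congrArg (fun z => c • z) h3).trans ?_
    rw [ENNReal.smul_def, smul_eq_mul]
    simp only [mul_assoc]
    rfl

end

/-! ### The equidistribution of shapes -/

theorem mainTheorem5 (ν : Measure GR) [ν.IsHaarMeasure]
    (F : Set GR) (hF : IsFundamentalDomain GZ F ν)
    (v : VR) (hdisc : |disc v| = 1) (hshape : shape v = S2.mk 1)
    (W : Set S2) (hW : NullMeasurableSet W shapeMeasure) :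
    (0 < Vol (region F v 1) ∧ Vol (region F v 1) < ∞) ∧
    (0 < shapeMeasure Set.univ ∧ shapeMeasure Set.univ < ∞) ∧
    Vol (regionW F v 1 W) / Vol (region F v 1) = shapeMeasure W / shapeMeasure Set.univ := by
  have hv : disc v ≠ 0 := fun h => by simp [h] at hdisc
  obtain ⟨k, hk, hsh⟩ := exists_shape_act hv hshape
  obtain ⟨m, hm, hπ⟩ := exists_isHaarMeasure_orbit hv
  obtain ⟨K, hK0, hK, hKW⟩ := exists_setLIntegral_fundamentalDomain m hk
  have hac : m ≪ ν := by
    rw [Measure.isMulLeftInvariant_eq_smul m ν]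
    exact Measure.smul_absolutelyContinuous
  have hFm : IsFundamentalDomain GZ F m := hF.mono hac
  have hmeas (F' : Set GR) (hF' : MeasurableSet F') (hFF' : F' =ᵐ[m] F) (W' : Set S2)
      (hW' : MeasurableSet W') : Vol (regionW F' v 1 W') = K * shapeMeasure W' := by
    rw [Vol_regionW hdisc hsh hπ hF' hW', setLIntegral_congr hFF', hKW F hFm W' hW']
  -- F and W are only null-measurable. `Vol` is monotone, so it is squeezed between its values for
  -- measurable inner and outer approximations, which agree because the approximations differ by
  -- null sets.
  obtain ⟨F₁, hF₁F, hF₁, hF₁e⟩ := hFm.nullMeasurableSet.exists_measurable_subset_ae_eq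
  obtain ⟨F₂, hFF₂, hF₂, hF₂e⟩ := hFm.nullMeasurableSet.exists_measurable_superset_ae_eq
  have hvol (U : Set S2) (hU : NullMeasurableSet U shapeMeasure) :
      Vol (regionW F v 1 U) = K * shapeMeasure U := by
    obtain ⟨U₁, hU₁U, hU₁, hU₁e⟩ := hU.exists_measurable_subset_ae_eq
    obtain ⟨U₂, hUU₂, hU₂, hU₂e⟩ := hU.exists_measurable_superset_ae_eq
    apply le_antisymm
    · rw [← measure_congr hU₂e, ← hmeas F₂ hF₂ hF₂e U₂ hU₂]
      exact Vol_mono (regionW_mono hFF₂ hUU₂ v 1)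
    · rw [← measure_congr hU₁e, ← hmeas F₁ hF₁ hF₁e U₁ hU₁]
      exact Vol_mono (regionW_mono hF₁F hU₁U v 1)
  have hregion : Vol (region F v 1) = K * shapeMeasure Set.univ := by
    rw [region_eq_regionW_univ, hvol _ MeasurableSet.univ.nullMeasurableSet]
  refine ⟨⟨?_, ?_⟩, ⟨shapeMeasure_univ_pos, shapeMeasure_univ_lt_top⟩, ?_⟩
  · rw [hregion]
    exact ENNReal.mul_pos hK0 shapeMeasure_univ_pos.ne'
  · rw [hregion]
    exact ENNReal.mul_lt_top hK.lt_top shapeMeasure_univ_lt_top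
  · rw [hregion, hvol W hW, ENNReal.mul_div_mul_left _ _ hK0 hK]
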